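/- Let $d\ge 1$ and let $\mu,\sigma_0$ be probability measures on $\mathbb{R}^d$ that are absolutely continuous with respect to the Lebesgue measure and have finite second moments $M_2(\nu)=\int\|x\|^2\,d\nu(x)$. For $\theta\in\mathbb{S}^{d-1}$ write $\nu^\theta$ for the push-forward of $\nu$ by $x\mapsto\langle x,\theta\rangle$, let $\mathcal{U}$ be the uniform distribution on $\mathbb{S}^{d-1}$, and let $$F(\sigma)=\frac d2\,SW_2^2(\sigma,\mu)=\frac d2\int_{\mathbb{S}^{d-1}}W_2^2(\sigma^\theta,\mu^\theta)\,d\mathcal{U}(\theta).$$ The Wasserstein gradient $\nabla_{W_2}F(\sigma)$ at $\sigma\in\mathcal{P}_2(\mathbb{R}^d)$ is the ($\sigma$-a.e. unique) element of the $L^2(\sigma)$-closure of $\{\nabla\psi:\psi\in C_c^\infty(\mathbb{R}^d)\}$ such that $F(\nu)=F(\sigma)+\int\langle\nabla_{W_2}F(\sigma)(x),y-x\rangle\,d\pi(x,y)+o(W_2(\sigma,\nu))$ for all $\nu\in\mathcal{P}_2(\mathbb{R}^d)$ and all optimal couplings $\pi$ of $\sigma$ and $\nu$; and $\|g\|_\sigma^2=\int\|g\|^2\,d\sigma$.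 Let $P_1,P_2,\dots$ be i.i.d. random orthonormal bases of $\mathbb{R}^d$ drawn from the Haar measure on the orthogonal group, let $(\gamma_k)_{k\ge0}$ be step sizes with $0<\gamma_k\le1$, and let $(\sigma_k)$ be the slice-matching scheme $$\sigma_{k+1}=\big((1-\gamma_k)\mathrm{Id}+\gamma_kT_{\sigma_k,P_{k+1}}\big)_\sharp\sigma_k,\qquad T_{\sigma,P}(x)=\sum_{i=1}^d t_{\theta_i}(\langle\theta_i,x\rangle)\,\theta_i\quad\text{for }P=[\theta_1,\dots,\theta_d],$$ where $t_\theta=F_{\mu^\theta}^{-1}\circ F_{\sigma^\theta}$ is the one-dimensional optimal transport map from $\sigma^\theta$ to $\mu^\theta$ ($F_\rho$ and $F_\rho^{-1}$ being the distribution and quantile functions of $\rho$). For $K\ge0$ and $0\le j\le K$ put $\omega_j=\gamma_j/\sum_{k=0}^K\gamma_k$. Then $F$ has a Wasserstein gradient at every $\sigma_k$, the random variables $\|\nabla_{W_2}F(\sigma_k)\|_{\sigma_k}^2$ are integrable, and: 1. If $M_2(\sigma_0)\le M_2(\mu)$, or if $\gamma_0=1$ and $F(\sigma_0)\le2M_2(\mu)$,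 then for every $K\ge0$ $$\sum_{k=0}^K\omega_k\,\mathbb{E}\big[\|\nabla_{W_2}F(\sigma_k)\|_{\sigma_k}^2\big]\le\frac{F(\sigma_0)+4M_2(\mu)\sum_{k=0}^K\gamma_k^2}{\sum_{k=0}^K\gamma_k}.$$ 2. With no assumption relating $\sigma_0$ to $\mu$, the same bound holds for every $K\ge 0$ with $4M_2(\mu)$ replaced by $4\max(M_2(\sigma_0),M_2(\mu))$. 3. With no assumption relating $\sigma_0$ to $\mu$, if $\gamma_k=1/(k+1)^{\alpha}$ with $1/2<\alpha<1$, there is a constant $C$ depending only on $d,\mu,\sigma_0,\alpha$ such that for every $K\ge1$ $$\sum_{k=0}^K\omega_k\,\mathbb{E}\big[\|\nabla_{W_2}F(\sigma_k)\|_{\sigma_k}^2\big]\le C\,K^{\alpha-1}.$$ -/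

import Mathlib

open MeasureTheory Set Filter Topology
open scoped ENNReal NNReal RealInnerProductSpace Gradient

/-- `ℝ^d` with its Euclidean structure. -/
abbrev Euc (d : ℕ) : Type := EuclideanSpace ℝ (Fin d)

/-! ### Probability measures with finite second moment, Wasserstein distance -/

section Wasserstein

variable {X : Type*} [NormedAddCommGroup X] [MeasurableSpace X]

/-- `ν ∈ 𝒫₂(X)`: a probability measure with finite second moment. -/
structure IsP2 (ν : Measure X) : Prop where
  isProbabilityMeasure : IsProbabilityMeasure ν
  integrable_norm_sq : Integrable (fun x => ‖x‖ ^ 2) ν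

/-- The second moment `M₂(ν) = ∫ ‖x‖² dν(x)`. -/
noncomputable def secondMoment (ν : Measure X) : ℝ := ∫ x, ‖x‖ ^ 2 ∂ν

/-- `π` is a coupling of `α` and `β`. -/
structure IsTransportPlan (π : Measure (X × X)) (α β : Measure X) : Prop where
  map_fst : π.map Prod.fst = α
  map_snd : π.map Prod.snd = β

/-- The quadratic transport cost of a coupling. -/
noncomputable def transportCost (π : Measure (X × X)) : ℝ≥0∞ :=
  ∫⁻ p, edist p.1 p.2 ^ 2 ∂π

/-- The squared Wasserstein distance `W₂²(α, β)`, as an infimum over couplings. -/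
noncomputable def wassersteinSq (α β : Measure X) : ℝ≥0∞ :=
  ⨅ (π : Measure (X × X)) (_ : IsTransportPlan π α β), transportCost π

/-- The Wasserstein distance `W₂(α, β)` as a real number (finite on `𝒫₂`). -/
noncomputable def wassersteinDist (α β : Measure X) : ℝ :=
  Real.sqrt (wassersteinSq α β).toReal

/-- `π` is an optimal coupling of `α` and `β`. -/
structure IsOptimalPlan (π : Measure (X × X)) (α β : Measure X) : Prop
    extends IsTransportPlan π α β where
  cost_eq : transportCost π = wassersteinSq α β

end Wasserstein

/-- `ν ∈ 𝒫_{2,ac}(ℝ^d)`: moreover absolutely continuous with respect to Lebesgue measure. -/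
structure IsP2ac {d : ℕ} (ν : Measure (Euc d)) : Prop extends IsP2 ν where
  absolutelyContinuous : ν ≪ (volume : Measure (Euc d))

/-! ### The Wasserstein gradient -/

section Gradient

variable {d : ℕ}

/-- `g` lies in the tangent space of `𝒫₂(ℝ^d)` at `σ`, the closure in `L²(σ)` of the gradients of
smooth compactly supported functions. -/
def InTangentSpace (σ : Measure (Euc d)) (g : Euc d → Euc d) : Prop :=
  MemLp g 2 σ ∧
    ∀ ε : ℝ≥0∞, 0 < ε → ∃ ψ : Euc d → ℝ, ContDiff ℝ ((⊤ : ℕ∞) : WithTop ℕ∞) ψ ∧ HasCompactSupport ψ ∧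
      eLpNorm (fun x => g x - ∇ ψ x) 2 σ < ε

/-- `g` is a Wasserstein gradient of `𝓕` at `σ ∈ 𝒫₂(ℝ^d)`: it is tangent and
`𝓕(ν) = 𝓕(σ) + ∫ ⟪g(x), y - x⟫ dπ(x,y) + o(W₂(σ,ν))` for all `ν ∈ 𝒫₂(ℝ^d)` and all optimal
couplings `π` of `σ` and `ν`. Such a `g` is unique up to `σ`-null sets. -/
structure IsWassersteinGradient (𝓕 : Measure (Euc d) → ℝ) (σ : Measure (Euc d))
    (g : Euc d → Euc d) : Prop where
  isP2 : IsP2 σ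
  inTangentSpace : InTangentSpace σ g
  expansion : ∀ ε : ℝ, 0 < ε → ∃ δ : ℝ, 0 < δ ∧ ∀ ν : Measure (Euc d), IsP2 ν →
    wassersteinDist σ ν < δ → ∀ π : Measure (Euc d × Euc d), IsOptimalPlan π σ ν →
      |𝓕 ν - 𝓕 σ - ∫ p, ⟪g p.1, p.2 - p.1⟫ ∂π| ≤ ε * wassersteinDist σ ν

/-- `𝓕` has a Wasserstein gradient at `σ`. -/
def WassersteinDifferentiableAt (𝓕 : Measure (Euc d) → ℝ) (σ : Measure (Euc d)) : Prop :=
  ∃ g, IsWassersteinGradient 𝓕 σ g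

open Classical in
/-- The Wasserstein gradient of `𝓕` at `σ` (zero by convention if there is none). -/
noncomputable def wassersteinGradient (𝓕 : Measure (Euc d) → ℝ) (σ : Measure (Euc d)) :
    Euc d → Euc d :=
  if h : WassersteinDifferentiableAt 𝓕 σ then h.choose else 0

/-- `‖∇_{W₂} 𝓕(σ)‖²_σ = ∫ ‖∇_{W₂} 𝓕(σ)(x)‖² dσ(x)`. -/
noncomputable def gradNormSq (𝓕 : Measure (Euc d) → ℝ) (σ : Measure (Euc d)) : ℝ :=
  ∫ x, ‖wassersteinGradient 𝓕 σ x‖ ^ 2 ∂σ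

end Gradient

/-! ### The Sliced-Wasserstein objective -/

section Sliced

variable {d : ℕ}

/-- The push-forward `σ^θ` of `σ` by `x ↦ ⟪x, θ⟫`. -/
noncomputable def projMeasure (σ : Measure (Euc d)) (θ : Euc d) : Measure ℝ :=
  σ.map (fun x => ⟪x, θ⟫)

/-- The uniform probability measure on the unit sphere of `ℝ^d`. -/
noncomputable def uniformSphere (d : ℕ) : Measure (Metric.sphere (0 : Euc d) 1) :=
  ((volume : Measure (Euc d)).toSphere univ)⁻¹ • (volume : Measure (Euc d)).toSphere

/-- The squared Sliced-Wasserstein distance. -/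
noncomputable def slicedWassersteinSq (σ μ : Measure (Euc d)) : ℝ≥0∞ :=
  ∫⁻ θ : Metric.sphere (0 : Euc d) 1,
    wassersteinSq (projMeasure σ θ) (projMeasure μ θ) ∂(uniformSphere d)

/-- The objective `F(σ) = (d / 2) SW₂²(σ, μ)` with target `μ`. -/
noncomputable def swLoss (μ σ : Measure (Euc d)) : ℝ :=
  (d : ℝ) / 2 * (slicedWassersteinSq σ μ).toReal

end Sliced

/-! ### Random orthonormal bases and the slice-matching scheme -/

section Scheme

/-- The group of orthogonal `d × d` matrices; the columns of such a matrix are an orthonormal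
basis of `ℝ^d`. -/
abbrev OrthoGroup (d : ℕ) : Type := Matrix.orthogonalGroup (Fin d) ℝ

noncomputable instance (d : ℕ) : MeasurableSpace (OrthoGroup d) := borel _

instance (d : ℕ) : BorelSpace (OrthoGroup d) := ⟨rfl⟩

instance orthoGroup_compactSpace (d : ℕ) : CompactSpace (OrthoGroup d) := by
  refine isCompact_iff_compactSpace.mp ?_
  have hK : IsCompact (Set.pi univ fun _ : Fin d => Set.pi univ fun _ : Fin d =>
      Icc (-1 : ℝ) 1 : Set (Fin d → Fin d → ℝ)) :=
    isCompact_univ_pi fun _ => isCompact_univ_pi fun _ => isCompact_Icc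
  refine IsCompact.of_isClosed_subset (X := Matrix (Fin d) (Fin d) ℝ) hK ?_ ?_
  · have : ((Matrix.orthogonalGroup (Fin d) ℝ : Set (Matrix (Fin d) (Fin d) ℝ))) =
        {A | A * star A = 1} := by
      ext A
      exact Matrix.mem_unitaryGroup_iff
    rw [this]
    exact isClosed_eq (by fun_prop) continuous_const
  · intro A hA i _ j _
    have := entry_norm_bound_of_unitary (𝕜 := ℝ) hA i j
    rw [Real.norm_eq_abs] at this
    exact abs_le.mp this

variable {d : ℕ}

/-- The normalized Haar measure on the orthogonal group. -/
noncomputable def haarOrtho (d : ℕ) : Measure (OrthoGroup d) := Measure.haarMeasure ⊤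

/-- `(P k)` is an i.i.d. sequence of random orthonormal bases drawn from the Haar measure. -/
structure IsIIDHaar {Ω : Type*} [MeasurableSpace Ω] (ℙ : Measure Ω) (P : ℕ → Ω → OrthoGroup d) :
    Prop where
  measurable : ∀ k, Measurable (P k)
  law : ∀ k, ℙ.map (P k) = haarOrtho d
  indep : ProbabilityTheory.iIndepFun P ℙ

/-- The `i`-th column `θ_i` of `P = [θ_1, …, θ_d]`. -/
noncomputable def basisVec (P : OrthoGroup d) (i : Fin d) : Euc d :=
  WithLp.toLp 2 fun j => (P : Matrix (Fin d) (Fin d) ℝ) j i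

/-- The quantile function `F_β⁻¹(p) = inf {y | p ≤ F_β(y)}`. -/
noncomputable def quantile (β : Measure ℝ) (p : ℝ) : ℝ :=
  sInf {y : ℝ | p ≤ ProbabilityTheory.cdf β y}

/-- The one-dimensional optimal transport map `F_β⁻¹ ∘ F_α` from `α` to `β`. -/
noncomputable def otMap (α β : Measure ℝ) (x : ℝ) : ℝ :=
  quantile β (ProbabilityTheory.cdf α x)

/-- The matrix-slice-matching map `T_{σ,P}(x) = ∑_i t_{θ_i}(⟪θ_i, x⟫) θ_i`, where `t_θ` is the
optimal transport map from `σ^θ` to `μ^θ`. -/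
noncomputable def sliceMap (μ σ : Measure (Euc d)) (P : OrthoGroup d) (x : Euc d) : Euc d :=
  ∑ i, otMap (projMeasure σ (basisVec P i)) (projMeasure μ (basisVec P i))
    ⟪basisVec P i, x⟫ • basisVec P i

/-- The slice-matching scheme `σ_{k+1} = ((1 - γ_k) Id + γ_k T_{σ_k, P_k})_♯ σ_k`. The basis used
to pass from `σ_k` to `σ_{k+1}` is `P k`. -/
noncomputable def schemeIterate (μ σ₀ : Measure (Euc d)) (γ : ℕ → ℝ) (P : ℕ → OrthoGroup d) :
    ℕ → Measure (Euc d)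
  | 0 => σ₀
  | k + 1 => (schemeIterate μ σ₀ γ P k).map fun x =>
      (1 - γ k) • x + γ k • sliceMap μ (schemeIterate μ σ₀ γ P k) (P k) x

/-- The random measure `σ_k`, along a random sequence of bases. -/
noncomputable def schemeRandom {Ω : Type*} (μ σ₀ : Measure (Euc d)) (γ : ℕ → ℝ)
    (P : ℕ → Ω → OrthoGroup d) (k : ℕ) (ω : Ω) : Measure (Euc d) :=
  schemeIterate μ σ₀ γ (fun j => P j ω) k

/-- The weights `ω_j = γ_j / ∑_{k=0}^K γ_k`. -/
noncomputable def stepWeight (γ : ℕ → ℝ) (K j : ℕ) : ℝ :=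
  γ j / ∑ k ∈ Finset.range (K + 1), γ k

/-- The weighted average `∑_{k=0}^K ω_k 𝔼[‖∇_{W₂} F(σ_k)‖²_{σ_k}]`. -/
noncomputable def avgGradNormSq {Ω : Type*} [MeasurableSpace Ω] (ℙ : Measure Ω)
    (μ σ₀ : Measure (Euc d)) (γ : ℕ → ℝ) (P : ℕ → Ω → OrthoGroup d) (K : ℕ) : ℝ :=
  ∑ k ∈ Finset.range (K + 1),
    stepWeight γ K k * ∫ ω, gradNormSq (swLoss μ) (schemeRandom μ σ₀ γ P k ω) ∂ℙ

end Scheme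

/-! The columns of a Haar-distributed orthogonal matrix are uniform on the sphere
(`lintegral_sphere_eq_haar`), so F(σ) is half the average over P of `sliceCost`, and for absolutely
continuous σ the slice cost is ∫ ‖x - T_{σ,P}(x)‖² dσ (`sliceCost_eq`). This suggests the gradient
g(x) = x - E_P[T_{σ,P}(x)], called `swGrad`, and makes the scheme a stochastic gradient method with
unbiased direction x - T_{σ,P}(x).

For any coupling π of σ and ν, the exact identity `swLoss_expansion` writes F(ν) - F(σ) - ∫ ⟨g(x), y
- x⟩ dπ as half the cost of π minus half the averaged remainder `sliceRem`. The remainder is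
nonnegative, because (y, T_{σ,P}(x)) projects to an admissible coupling of ν and μ in every
direction of P (`sliceRem_nonneg`). This one-sided bound needs no optimality of π and is already the
descent inequality.

That g is the Wasserstein gradient requires three more facts. First, the averaged remainder is
o(√cost) (`exists_integral_sliceRem_le`). In one dimension a uniform variable p with y = F_ν⁻¹(p) is
glued to the coupling, and the error is governed by the L² distance between t_θ(x) and F_β⁻¹(p),
where β = μ^θ; this tends to zero with the cost (`exists_integral_sq_otMap_sub_lt`). Dominated
convergence then handles the average over P. Second, g is tangent: x - T_{σ,P}(x) is a sum of fields
f(⟨θ,x⟩)θ, each a limit of gradients of truncated ridge functions (`inTangentSpace_swGrad`). Third,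
tangent gradients are unique, by testing on the maps x + t∇ψ, which are optimal for small t
(`IsWassersteinGradient.ae_eq`). Hence the norm of the chosen gradient is that of g.

The gradient formula needs densities, and the scheme keeps them: a step acts coordinatewise in the
basis P, each coordinate map either expands by at least 1 - γ or, when γ = 1, has the law of a
marginal of μ, and a measure with a density is dominated by the product of its marginals
(`map_interp_sliceMap_absolutelyContinuous`).

Applied to one step and averaged over the fresh basis, the descent inequality reads E F(σ_{k+1}) ≤ E
F(σ_k) - γ_k E‖g‖² + γ_k² E F(σ_k) (`integral_swLoss_schemeRandom_succ_le`). Second moments never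
exceed the larger of M₂(σ₀) and M₂(μ), so F stays bounded along the scheme, and telescoping gives
the averaged bounds. For γ_k = (k+1)^{-α} the squares are summable and the sum of the steps is at
least K^{1-α}. -/

set_option linter.unusedSectionVars false

/-! ### Quantile functions and one-dimensional optimal transport -/

open ProbabilityTheory in
theorem exists_le_cdf (β : Measure ℝ) {p : ℝ} (hp : p < 1) : ∃ y, p ≤ cdf β y := by
  obtain ⟨y, hy⟩ := ((tendsto_cdf_atTop β).eventually (lt_mem_nhds hp)).exists
  exact ⟨y, hy.le⟩

open ProbabilityTheory in
theorem bddBelow_setOf_le_cdf (β : Measure ℝ) {p : ℝ} (hp : 0 < p) :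
    BddBelow {y : ℝ | p ≤ cdf β y} := by
  obtain ⟨y, hy⟩ := ((tendsto_cdf_atBot β).eventually (gt_mem_nhds hp)).exists
  refine ⟨y, fun z hz => ?_⟩
  by_contra h
  exact absurd (hz.trans (monotone_cdf β (not_le.1 h).le)) (not_le.2 hy)

open ProbabilityTheory in
-- Right-continuity of the distribution function makes the infimum attained. This Galois connection
-- drives every later use of quantiles.
theorem quantile_le_iff_of_nonempty {β : Measure ℝ} {p : ℝ} (hp : 0 < p)
    (hne : ∃ y, p ≤ cdf β y) (y : ℝ) : quantile β p ≤ y ↔ p ≤ cdf β y := by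
  constructor
  · intro h
    have key : ∀ z, y < z → p ≤ cdf β z := by
      intro z hz
      obtain ⟨w, hw, hwz⟩ := exists_lt_of_csInf_lt (s := {y : ℝ | p ≤ cdf β y}) hne (h.trans_lt hz)
      exact hw.trans (monotone_cdf β hwz.le)
    have hr : Tendsto (cdf β) (𝓝[>] y) (𝓝 (cdf β y)) :=
      ((cdf β).right_continuous y).mono_left (nhdsWithin_mono _ Ioi_subset_Ici_self)
    refine ge_of_tendsto hr ?_
    filter_upwards [self_mem_nhdsWithin] with z hz using key z hz
  · intro h
    exact csInf_le (bddBelow_setOf_le_cdf β hp) h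

open ProbabilityTheory in
theorem quantile_le_iff (β : Measure ℝ) {p : ℝ} (hp : p ∈ Ioo (0 : ℝ) 1) (y : ℝ) :
    quantile β p ≤ y ↔ p ≤ cdf β y :=
  quantile_le_iff_of_nonempty hp.1 (exists_le_cdf β hp.2) y

open ProbabilityTheory in
theorem monotoneOn_quantile (β : Measure ℝ) : MonotoneOn (quantile β) (Ioo 0 1) := by
  intro p hp q hq hpq
  rw [quantile_le_iff β hp]
  exact hpq.trans ((quantile_le_iff β hq _).1 le_rfl)

/-- The uniform distribution on the unit interval. -/
noncomputable abbrev unifUnit : Measure ℝ := (volume : Measure ℝ).restrict (Ioo 0 1)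

instance isProbabilityMeasure_unifUnit : IsProbabilityMeasure unifUnit := ⟨by simp⟩

theorem ae_unifUnit_mem : ∀ᵐ p ∂unifUnit, p ∈ Ioo (0 : ℝ) 1 := ae_restrict_mem measurableSet_Ioo

/-! ### Joint measurability of quantiles and optimal maps in a parameter -/

section QuantileMeasurable

variable {Ω : Type*} [MeasurableSpace Ω]

open ProbabilityTheory in
/-- The quantile functions of a measurable family of probability measures are jointly
measurable. -/
theorem measurable_quantile_kernel {κ : Ω → Measure ℝ} (hκ : Measurable κ)
    (hprob : ∀ ω, IsProbabilityMeasure (κ ω)) :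
    Measurable fun z : Ω × ℝ => quantile (κ z.1) z.2 := by
  have hset : ∀ y : ℝ, MeasurableSet {z : Ω × ℝ | z.2 ≤ cdf (κ z.1) y} := by
    intro y
    refine measurableSet_le measurable_snd ?_
    have : (fun z : Ω × ℝ => cdf (κ z.1) y) = fun z => (κ z.1 (Iic y)).toReal := by
      funext z
      have := hprob z.1
      rw [cdf_eq_real]; rfl
    rw [this]
    exact ((Measure.measurable_coe measurableSet_Iic).comp
      (hκ.comp measurable_fst)).ennreal_toReal
  -- On `E` the defining set of the quantile is nonempty and bounded below, so the Galois connection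
  -- applies. Off `E` that set is all of ℝ or empty, and `sInf` returns its default 0 in both cases.
  set E : Set (Ω × ℝ) := {z | 0 < z.2} ∩ ⋃ n : ℕ, {z : Ω × ℝ | z.2 ≤ cdf (κ z.1) n} with hE
  have hEm : MeasurableSet E :=
    (measurableSet_lt measurable_const measurable_snd).inter
      (MeasurableSet.iUnion fun n => hset n)
  have hmem : ∀ z ∈ E, ∃ y, z.2 ≤ cdf (κ z.1) y := by
    rintro z ⟨-, hz⟩
    obtain ⟨n, hn⟩ := mem_iUnion.1 hz
    exact ⟨n, hn⟩
  have hoff : ∀ z ∉ E, quantile (κ z.1) z.2 = 0 := by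
    intro z hz
    rcases le_or_gt z.2 0 with h0 | h0
    · have : {y : ℝ | z.2 ≤ cdf (κ z.1) y} = univ :=
        eq_univ_of_forall fun y => h0.trans (cdf_nonneg _ _)
      rw [quantile, this, Real.sInf_univ]
    · have : {y : ℝ | z.2 ≤ cdf (κ z.1) y} = ∅ := by
        refine eq_empty_of_forall_notMem fun y hy => hz ⟨h0, mem_iUnion.2 ?_⟩
        obtain ⟨n, hn⟩ := exists_nat_ge y
        exact ⟨n, le_trans hy (monotone_cdf _ hn)⟩
      rw [quantile, this, Real.sInf_empty]
  refine measurable_of_Iic fun y => ?_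
  have : (fun z : Ω × ℝ => quantile (κ z.1) z.2) ⁻¹' Iic y =
      (E ∩ {z | z.2 ≤ cdf (κ z.1) y}) ∪ (Eᶜ ∩ {_z | 0 ≤ y}) := by
    ext z
    by_cases hz : z ∈ E
    · simp [hz, quantile_le_iff_of_nonempty hz.1 (hmem z hz)]
    · simp [hz, hoff z hz]
  rw [this]
  exact (hEm.inter (hset y)).union (hEm.compl.inter (MeasurableSet.const _))

open ProbabilityTheory in
theorem measurable_cdf_kernel {κ : Ω → Measure ℝ} (hκ : Measurable κ)
    (hprob : ∀ ω, IsProbabilityMeasure (κ ω)) :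
    Measurable fun z : Ω × ℝ => cdf (κ z.1) z.2 := by
  let K : Kernel (Ω × ℝ) ℝ := ⟨fun z => κ z.1, hκ.comp measurable_fst⟩
  have : IsMarkovKernel K := ⟨fun z => hprob z.1⟩
  have hm := Kernel.measurable_kernel_prodMk_left (κ := K)
    (t := {w : (Ω × ℝ) × ℝ | w.2 ≤ w.1.2})
    (measurableSet_le measurable_snd (measurable_snd.comp measurable_fst))
  have : (fun z : Ω × ℝ => cdf (κ z.1) z.2) =
      fun z => (K z (Prod.mk z ⁻¹' {w : (Ω × ℝ) × ℝ | w.2 ≤ w.1.2})).toReal := by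
    funext z
    have := hprob z.1
    rw [cdf_eq_real]; rfl
  rw [this]
  exact hm.ennreal_toReal

theorem measurable_otMap_kernel {κ η : Ω → Measure ℝ} (hκ : Measurable κ) (hη : Measurable η)
    (hκp : ∀ ω, IsProbabilityMeasure (κ ω)) (hηp : ∀ ω, IsProbabilityMeasure (η ω)) :
    Measurable fun z : Ω × ℝ => otMap (κ z.1) (η z.1) z.2 :=
  (measurable_quantile_kernel hη hηp).comp
    (measurable_fst.prodMk (measurable_cdf_kernel hκ hκp))

end QuantileMeasurable

theorem measurable_quantile (β : Measure ℝ) [IsProbabilityMeasure β] : Measurable (quantile β) :=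
  (measurable_quantile_kernel (Ω := Unit) (κ := fun _ => β) measurable_const
    fun _ => inferInstance).comp (measurable_const (a := ()) |>.prodMk measurable_id)

theorem measurable_otMap (α β : Measure ℝ) [IsProbabilityMeasure α] [IsProbabilityMeasure β] :
    Measurable (otMap α β) :=
  (measurable_otMap_kernel (Ω := Unit) (κ := fun _ => α) (η := fun _ => β) measurable_const
    measurable_const (fun _ => inferInstance) fun _ => inferInstance).comp
    (measurable_const (a := ()) |>.prodMk measurable_id)

theorem measurable_otMap_graph (α β : Measure ℝ) [IsProbabilityMeasure α]
    [IsProbabilityMeasure β] : Measurable fun x => (x, otMap α β x) :=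
  measurable_id.prodMk (measurable_otMap α β)

theorem unifUnit_Iic {c : ℝ} (h1 : c ≤ 1) : unifUnit (Iic c) = ENNReal.ofReal c := by
  rw [unifUnit, Measure.restrict_congr_set Ioo_ae_eq_Ioc, Measure.restrict_apply measurableSet_Iic,
    inter_comm, Ioc_inter_Iic, min_eq_right h1, Real.volume_Ioc, sub_zero]

open ProbabilityTheory in
-- Inverse transform sampling: by the Galois connection the event Q ≤ y is p ≤ F(y), of uniform
-- measure F(y).
theorem map_quantile (β : Measure ℝ) [IsProbabilityMeasure β] :
    unifUnit.map (quantile β) = β := by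
  have := Measure.isProbabilityMeasure_map (μ := unifUnit) (measurable_quantile β).aemeasurable
  refine Measure.ext_of_Iic _ _ fun y => ?_
  rw [Measure.map_apply (measurable_quantile β) measurableSet_Iic, ← ofReal_cdf,
    ← unifUnit_Iic (cdf_le_one β y)]
  refine measure_congr ?_
  filter_upwards [ae_unifUnit_mem] with p hp
  exact propext (quantile_le_iff β hp y)

open ProbabilityTheory in
theorem continuous_cdf (α : Measure ℝ) [IsProbabilityMeasure α] [NullSingletonClass α] :
    Continuous (cdf α) := by
  refine continuous_iff_continuousAt.2 fun x => ?_
  have h := measure_singleton (μ := α) x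
  rw [← measure_cdf α, StieltjesFunction.measure_singleton, ENNReal.ofReal_eq_zero,
    sub_nonpos] at h
  rw [(monotone_cdf α).continuousAt_iff_leftLim_eq_rightLim, StieltjesFunction.rightLim_eq]
  exact le_antisymm ((monotone_cdf α).leftLim_le le_rfl) h

open ProbabilityTheory in
theorem cdf_quantile (α : Measure ℝ) [IsProbabilityMeasure α] [NullSingletonClass α] {p : ℝ}
    (hp : p ∈ Ioo (0 : ℝ) 1) : cdf α (quantile α p) = p := by
  refine le_antisymm ?_ ((quantile_le_iff α hp _).1 le_rfl)
  have hl : Tendsto (cdf α) (𝓝[<] (quantile α p)) (𝓝 (cdf α (quantile α p))) :=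
    ((continuous_cdf α).tendsto _).mono_left nhdsWithin_le_nhds
  refine le_of_tendsto hl ?_
  filter_upwards [self_mem_nhdsWithin] with z hz
  exact le_of_not_ge fun h => absurd ((quantile_le_iff α hp z).2 h) (not_le.2 hz)

open ProbabilityTheory in
-- Without atoms F_α(F_α⁻¹(p)) = p, so along x = F_α⁻¹(p) the optimal map takes the value F_β⁻¹(p).
-- The graph coupling is therefore the quantile coupling.
theorem map_otMap_graph (α β : Measure ℝ) [IsProbabilityMeasure α] [NullSingletonClass α]
    [IsProbabilityMeasure β] :
    α.map (fun x => (x, otMap α β x)) = unifUnit.map fun p => (quantile α p, quantile β p) := by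
  have h := Measure.map_map (μ := unifUnit) (measurable_otMap_graph α β) (measurable_quantile α)
  rw [map_quantile α] at h
  rw [h]
  refine Measure.map_congr ?_
  filter_upwards [ae_unifUnit_mem] with p hp
  simp only [Function.comp, otMap, cdf_quantile α hp]

open ProbabilityTheory in
theorem map_cdf (α : Measure ℝ) [IsProbabilityMeasure α] [NullSingletonClass α] :
    α.map (cdf α) = unifUnit := by
  have h := Measure.map_map (μ := unifUnit) (monotone_cdf α).measurable (measurable_quantile α)
  rw [map_quantile α] at h
  rw [h]
  conv_rhs => rw [← Measure.map_id (μ := unifUnit)]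
  refine Measure.map_congr ?_
  filter_upwards [ae_unifUnit_mem] with p hp
  simp only [Function.comp, cdf_quantile α hp, id]

theorem map_otMap (α β : Measure ℝ) [IsProbabilityMeasure α] [NullSingletonClass α]
    [IsProbabilityMeasure β] : α.map (otMap α β) = β := by
  have h := congrArg (Measure.map Prod.snd) (map_otMap_graph α β)
  rw [Measure.map_map measurable_snd (measurable_otMap_graph α β),
    Measure.map_map measurable_snd ((measurable_quantile α).prodMk (measurable_quantile β))] at h
  exact h.trans (map_quantile β)

/-! #### The quantile coupling is optimal -/

/-- The right side is the area of a square whose side is the interval between u and v; one of the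
two intervals is empty. It rewrites the quadratic cost through events on which u and v are separated
by given levels. -/
theorem edist_sq_eq_lintegral (u v : ℝ) :
    edist u v ^ 2 = ∫⁻ s : ℝ, ∫⁻ t : ℝ,
      ((Ico u v).indicator 1 s * (Ico u v).indicator 1 t
        + (Ico v u).indicator 1 s * (Ico v u).indicator 1 t) := by
  have h : ∀ a b : ℝ, ∫⁻ s : ℝ, ∫⁻ t : ℝ,
      ((Ico a b).indicator (1 : ℝ → ℝ≥0∞) s * (Ico a b).indicator 1 t) =
        ENNReal.ofReal (b - a) ^ 2 := by
    intro a b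
    have hm : Measurable ((Ico a b).indicator (1 : ℝ → ℝ≥0∞)) :=
      measurable_one.indicator measurableSet_Ico
    simp_rw [lintegral_const_mul _ hm]
    rw [lintegral_mul_const _ hm, lintegral_indicator_one measurableSet_Ico, Real.volume_Ico, sq]
  have hm1 : Measurable ((Ico u v).indicator (1 : ℝ → ℝ≥0∞)) :=
    measurable_one.indicator measurableSet_Ico
  have hm2 : Measurable ((Ico v u).indicator (1 : ℝ → ℝ≥0∞)) :=
    measurable_one.indicator measurableSet_Ico
  simp_rw [lintegral_add_left (hm1.const_mul _)]
  rw [lintegral_add_left (by simp_rw [lintegral_const_mul _ hm1]; exact hm1.mul_const _), h, h,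
    edist_dist, Real.dist_eq]
  rcases le_total u v with huv | huv
  · rw [ENNReal.ofReal_of_nonpos (sub_nonpos.2 huv), abs_sub_comm,
      abs_of_nonneg (sub_nonneg.2 huv)]; simp
  · rw [ENNReal.ofReal_of_nonpos (sub_nonpos.2 huv), abs_of_nonneg (sub_nonneg.2 huv)]; simp

theorem indicator_Ico_mul_eq (u v s t : ℝ) :
    (Ico u v).indicator (1 : ℝ → ℝ≥0∞) s * (Ico u v).indicator 1 t =
      {p : ℝ × ℝ | p.1 ≤ min s t ∧ max s t < p.2}.indicator 1 (u, v) := by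
  simp only [indicator, mem_Ico, mem_ofPred_eq, Pi.one_apply, le_min_iff, max_lt_iff]
  by_cases h1 : u ≤ s <;> by_cases h2 : s < v <;> by_cases h3 : u ≤ t <;> by_cases h4 : t < v <;>
    simp [h1, h2, h3, h4]

theorem measurableSet_crossing (a b : ℝ) : MeasurableSet {p : ℝ × ℝ | p.1 ≤ a ∧ b < p.2} :=
  (measurableSet_le measurable_fst measurable_const).inter
    (measurableSet_lt measurable_const measurable_snd)

theorem measurableSet_crossing' (a b : ℝ) : MeasurableSet {p : ℝ × ℝ | p.2 ≤ a ∧ b < p.1} :=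
  (measurableSet_le measurable_snd measurable_const).inter
    (measurableSet_lt measurable_const measurable_fst)

/-- By Tonelli the cost is an integral of crossing probabilities, hence increasing in each of them.
Optimality can then be checked one pair of levels at a time, without duality or moment assumptions.
-/
theorem transportCost_eq_lintegral (π : Measure (ℝ × ℝ)) [SFinite π] :
    transportCost π = ∫⁻ s : ℝ, ∫⁻ t : ℝ,
      (π {p | p.1 ≤ min s t ∧ max s t < p.2} + π {p | p.2 ≤ min s t ∧ max s t < p.1}) := by
  have hm : ∀ f g : ℝ × ℝ × ℝ × ℝ → ℝ, Measurable f → Measurable g →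
      ∀ h : ℝ × ℝ × ℝ × ℝ → ℝ, Measurable h → Measurable fun w =>
      (Ico (f w) (g w)).indicator (1 : ℝ → ℝ≥0∞) (h w) := by
    intro f g hf hg h hh
    have : (fun w => (Ico (f w) (g w)).indicator (1 : ℝ → ℝ≥0∞) (h w)) =
        {w | f w ≤ h w ∧ h w < g w}.indicator 1 := by
      funext w; simp [indicator]
    rw [this]
    exact measurable_one.indicator ((measurableSet_le hf hh).inter (measurableSet_lt hh hg))
  have hu : Measurable fun w : ℝ × ℝ × ℝ × ℝ => w.1 := by fun_prop
  have hv : Measurable fun w : ℝ × ℝ × ℝ × ℝ => w.2.1 := by fun_prop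
  have hs : Measurable fun w : ℝ × ℝ × ℝ × ℝ => w.2.2.1 := by fun_prop
  have ht : Measurable fun w : ℝ × ℝ × ℝ × ℝ => w.2.2.2 := by fun_prop
  have hG : Measurable fun w : ℝ × ℝ × ℝ × ℝ =>
      ((Ico w.1 w.2.1).indicator (1 : ℝ → ℝ≥0∞) w.2.2.1 * (Ico w.1 w.2.1).indicator 1 w.2.2.2
        + (Ico w.2.1 w.1).indicator 1 w.2.2.1 * (Ico w.2.1 w.1).indicator 1 w.2.2.2) :=
    ((hm _ _ hu hv _ hs).mul (hm _ _ hu hv _ ht)).add ((hm _ _ hv hu _ hs).mul (hm _ _ hv hu _ ht))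
  unfold transportCost
  simp_rw [edist_sq_eq_lintegral]
  rw [lintegral_lintegral_swap]
  · refine lintegral_congr fun s => ?_
    rw [lintegral_lintegral_swap]
    · refine lintegral_congr fun t => ?_
      simp_rw [indicator_Ico_mul_eq]
      rw [lintegral_add_left (measurable_one.indicator (measurableSet_crossing _ _))]
      congr 1
      · exact lintegral_indicator_one (measurableSet_crossing _ _)
      · exact lintegral_indicator_one (measurableSet_crossing' _ _)
    · exact (hG.comp (f := fun z : (ℝ × ℝ) × ℝ => (z.1.1, z.1.2, s, z.2))
        (by fun_prop)).aemeasurable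
  · refine (Measurable.lintegral_prod_right' (f := fun z : ((ℝ × ℝ) × ℝ) × ℝ =>
      ((Ico z.1.1.1 z.1.1.2).indicator (1 : ℝ → ℝ≥0∞) z.1.2 *
        (Ico z.1.1.1 z.1.1.2).indicator 1 z.2
        + (Ico z.1.1.2 z.1.1.1).indicator 1 z.1.2 *
          (Ico z.1.1.2 z.1.1.1).indicator 1 z.2)) ?_).aemeasurable
    exact hG.comp (f := fun z : ((ℝ × ℝ) × ℝ) × ℝ => (z.1.1.1, z.1.1.2, z.1.2, z.2))
        (by fun_prop)

open ProbabilityTheory in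
-- If x ≤ a, then either y ≤ b or the pair crosses. The resulting lower bound depends on the
-- marginals alone.
theorem crossing_ge {α β : Measure ℝ} [IsProbabilityMeasure α] [IsProbabilityMeasure β]
    {π : Measure (ℝ × ℝ)} (h1 : π.map Prod.fst = α) (h2 : π.map Prod.snd = β) (a b : ℝ) :
    ENNReal.ofReal (cdf α a - cdf β b) ≤ π {p | p.1 ≤ a ∧ b < p.2} := by
  rw [ENNReal.ofReal_sub _ (cdf_nonneg _ _), ofReal_cdf, ofReal_cdf, tsub_le_iff_right, ← h1, ← h2,
    Measure.map_apply measurable_fst measurableSet_Iic,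
    Measure.map_apply measurable_snd measurableSet_Iic]
  refine (measure_mono ?_).trans (measure_union_le _ _)
  intro p hp
  by_cases h : p.2 ≤ b
  · exact Or.inr h
  · exact Or.inl ⟨hp, not_le.1 h⟩

/-- The coupling of `α` and `β` through their quantile functions. -/
noncomputable def quantilePlan (α β : Measure ℝ) : Measure (ℝ × ℝ) :=
  unifUnit.map fun p => (quantile α p, quantile β p)

open ProbabilityTheory in
-- The crossing event is, up to null sets, the interval (F_β(b), F_α(a)], so the quantile coupling
-- attains equality in `crossing_ge`.
theorem unifUnit_crossing (α β : Measure ℝ) [IsProbabilityMeasure α] [IsProbabilityMeasure β]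
    (a b : ℝ) : unifUnit {p | quantile α p ≤ a ∧ b < quantile β p} =
      ENNReal.ofReal (cdf α a - cdf β b) := by
  have : unifUnit {p | quantile α p ≤ a ∧ b < quantile β p} =
      unifUnit (Ioc (cdf β b) (cdf α a)) := by
    refine measure_congr ?_
    filter_upwards [ae_unifUnit_mem] with p hp
    refine propext ?_
    change (quantile α p ≤ a ∧ b < quantile β p) ↔ (cdf β b < p ∧ p ≤ cdf α a)
    rw [quantile_le_iff α hp, ← not_le, quantile_le_iff β hp, not_le, and_comm]
  rw [this, unifUnit, Measure.restrict_congr_set Ioo_ae_eq_Ioc,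
    Measure.restrict_apply measurableSet_Ioc, inter_eq_left.2, Real.volume_Ioc]
  exact Ioc_subset_Ioc (cdf_nonneg _ _) (cdf_le_one _ _)

theorem isTransportPlan_quantilePlan (α β : Measure ℝ) [IsProbabilityMeasure α]
    [IsProbabilityMeasure β] : IsTransportPlan (quantilePlan α β) α β where
  map_fst := by
    rw [quantilePlan, Measure.map_map measurable_fst
      ((measurable_quantile α).prodMk (measurable_quantile β))]
    exact map_quantile α
  map_snd := by
    rw [quantilePlan, Measure.map_map measurable_snd
      ((measurable_quantile α).prodMk (measurable_quantile β))]
    exact map_quantile β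

instance isProbabilityMeasure_quantilePlan (α β : Measure ℝ) [IsProbabilityMeasure α]
    [IsProbabilityMeasure β] : IsProbabilityMeasure (quantilePlan α β) :=
  Measure.isProbabilityMeasure_map
    ((measurable_quantile α).prodMk (measurable_quantile β)).aemeasurable

theorem IsTransportPlan.isProbabilityMeasure {X : Type*} [NormedAddCommGroup X]
    [MeasurableSpace X] {π : Measure (X × X)} {α β : Measure X} [IsProbabilityMeasure α]
    (h : IsTransportPlan π α β) : IsProbabilityMeasure π :=
  ⟨by have := h.map_fst ▸ measure_univ (μ := α)
      rwa [Measure.map_apply measurable_fst MeasurableSet.univ, preimage_univ] at this⟩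

theorem transportCost_quantilePlan_le {α β : Measure ℝ} [IsProbabilityMeasure α]
    [IsProbabilityMeasure β] {π : Measure (ℝ × ℝ)} (h : IsTransportPlan π α β) :
    transportCost (quantilePlan α β) ≤ transportCost π := by
  have := h.isProbabilityMeasure
  have hmq := (measurable_quantile α).prodMk (measurable_quantile β)
  rw [transportCost_eq_lintegral, transportCost_eq_lintegral]
  refine lintegral_mono fun s => lintegral_mono fun t => add_le_add ?_ ?_
  · rw [quantilePlan, Measure.map_apply hmq (measurableSet_crossing _ _)]
    exact (unifUnit_crossing α β _ _).le.trans (crossing_ge h.map_fst h.map_snd _ _)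
  · rw [quantilePlan, Measure.map_apply hmq (measurableSet_crossing' _ _)]
    refine (unifUnit_crossing β α _ _).le.trans ?_
    -- Crossings in the other direction are those of the swapped coupling.
    refine (crossing_ge (π := π.map Prod.swap) (α := β) (β := α) ?_ ?_ _ _).trans ?_
    · rw [Measure.map_map measurable_fst measurable_swap]; exact h.map_snd
    · rw [Measure.map_map measurable_snd measurable_swap]; exact h.map_fst
    · rw [Measure.map_apply measurable_swap (measurableSet_crossing _ _)]; rfl

theorem wassersteinSq_le_transportCost {X : Type*} [NormedAddCommGroup X] [MeasurableSpace X]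
    {π : Measure (X × X)} {α β : Measure X} (h : IsTransportPlan π α β) :
    wassersteinSq α β ≤ transportCost π :=
  iInf₂_le π h

/-- The quantile formula for the one-dimensional Wasserstein distance. -/
theorem wassersteinSq_eq_quantilePlan (α β : Measure ℝ) [IsProbabilityMeasure α]
    [IsProbabilityMeasure β] : wassersteinSq α β = transportCost (quantilePlan α β) :=
  le_antisymm (wassersteinSq_le_transportCost (isTransportPlan_quantilePlan α β))
    (le_iInf₂ fun _ h => transportCost_quantilePlan_le h)

theorem wassersteinSq_eq_lintegral_quantile (α β : Measure ℝ) [IsProbabilityMeasure α]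
    [IsProbabilityMeasure β] :
    wassersteinSq α β = ∫⁻ p, edist (quantile α p) (quantile β p) ^ 2 ∂unifUnit := by
  rw [wassersteinSq_eq_quantilePlan, transportCost, quantilePlan, lintegral_map (by fun_prop)
    ((measurable_quantile α).prodMk (measurable_quantile β))]

theorem wassersteinSq_eq_lintegral_otMap (α β : Measure ℝ) [IsProbabilityMeasure α] [NullSingletonClass α]
    [IsProbabilityMeasure β] :
    wassersteinSq α β = ∫⁻ x, edist x (otMap α β x) ^ 2 ∂α := by
  rw [wassersteinSq_eq_quantilePlan, transportCost, quantilePlan, ← map_otMap_graph,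
    lintegral_map (by fun_prop) (measurable_otMap_graph α β)]

/-! ### Square-integrable functions -/

section SquareIntegrable

variable {Y E : Type*} [MeasurableSpace Y] {m : Measure Y} [NormedAddCommGroup E]

theorem lintegral_edist_sq_eq {f g : Y → E} (h : MemLp (fun y => f y - g y) 2 m) :
    ∫⁻ y, edist (f y) (g y) ^ 2 ∂m = ENNReal.ofReal (∫ y, ‖f y - g y‖ ^ 2 ∂m) := by
  rw [ofReal_integral_eq_lintegral_ofReal ((memLp_two_iff_integrable_sq_norm h.1).1 h)
    (Eventually.of_forall fun y => by positivity)]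
  refine lintegral_congr fun y => ?_
  rw [edist_eq_enorm_sub, ENNReal.ofReal_pow (norm_nonneg _), ofReal_norm]

theorem MeasureTheory.MemLp.integrable_norm_sq {f : Y → E} (h : MemLp f 2 m) :
    Integrable (fun y => ‖f y‖ ^ 2) m := (memLp_two_iff_integrable_sq_norm h.1).1 h

variable [InnerProductSpace ℝ E]

theorem abs_integral_inner_le {f g : Y → E} (hf : MemLp f 2 m) (hg : MemLp g 2 m) :
    |∫ y, ⟪f y, g y⟫ ∂m| ≤ √(∫ y, ‖f y‖ ^ 2 ∂m) * √(∫ y, ‖g y‖ ^ 2 ∂m) := by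
  have h1 : ∀ {k : Y → E} (hk : MemLp k 2 m), ‖hk.toLp k‖ = √(∫ y, ‖k y‖ ^ 2 ∂m) := by
    intro k hk
    rw [norm_eq_sqrt_real_inner, L2.inner_def]
    congr 1
    refine integral_congr_ae ?_
    filter_upwards [hk.coeFn_toLp] with y hy
    rw [hy, real_inner_self_eq_norm_sq]
  have h2 : (∫ y, ⟪f y, g y⟫ ∂m) = ⟪hf.toLp f, hg.toLp g⟫ := by
    rw [L2.inner_def]
    refine integral_congr_ae ?_
    filter_upwards [hf.coeFn_toLp, hg.coeFn_toLp] with y hy hy'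
    rw [hy, hy']
  rw [h2, ← h1 hf, ← h1 hg]
  exact abs_real_inner_le_norm _ _

theorem integrable_inner_of_memLp {f g : Y → E} (hf : MemLp f 2 m) (hg : MemLp g 2 m) :
    Integrable (fun y => ⟪f y, g y⟫) m := by
  have := L2.integrable_inner (𝕜 := ℝ) (hf.toLp f) (hg.toLp g)
  refine this.congr ?_
  filter_upwards [hf.coeFn_toLp, hg.coeFn_toLp] with y hy hy'
  rw [hy, hy']

end SquareIntegrable

/-! ### Couplings with finite second moments -/

section Plans

variable {X : Type*} [NormedAddCommGroup X] [MeasurableSpace X] [BorelSpace X]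
  [SecondCountableTopology X] {α β : Measure X} {π : Measure (X × X)}

theorem IsP2.memLp {ν : Measure X} (h : IsP2 ν) : MemLp (fun x => x) 2 ν :=
  (memLp_two_iff_integrable_sq_norm aestronglyMeasurable_id).2 h.integrable_norm_sq

theorem isP2_of_memLp {ν : Measure X} (hp : IsProbabilityMeasure ν)
    (h : MemLp (fun x => x) 2 ν) : IsP2 ν := ⟨hp, h.integrable_norm_sq⟩

theorem memLp_map_id {Y : Type*} [MeasurableSpace Y]
    {m : Measure Y} {f : Y → X} (hf : AEMeasurable f m) :
    MemLp (fun x => x) 2 (m.map f) ↔ MemLp f 2 m :=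
  memLp_map_measure_iff aestronglyMeasurable_id hf

theorem memLp_of_map_eq {Y : Type*} [MeasurableSpace Y] {m : Measure Y} {f : Y → X}
    {ν : Measure X} (hf : AEMeasurable f m) (h : m.map f = ν) (hν : MemLp (fun x => x) 2 ν) :
    MemLp f 2 m :=
  (memLp_map_id hf).1 (h ▸ hν)

theorem IsTransportPlan.memLp_fst (h : IsTransportPlan π α β) (hα : MemLp (fun x => x) 2 α) :
    MemLp (fun p : X × X => p.1) 2 π := by
  rw [← h.map_fst] at hα; exact (memLp_map_id measurable_fst.aemeasurable).1 hα

theorem IsTransportPlan.memLp_snd (h : IsTransportPlan π α β) (hβ : MemLp (fun x => x) 2 β) :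
    MemLp (fun p : X × X => p.2) 2 π := by
  rw [← h.map_snd] at hβ; exact (memLp_map_id measurable_snd.aemeasurable).1 hβ

theorem IsTransportPlan.memLp_sub (h : IsTransportPlan π α β) (hα : MemLp (fun x => x) 2 α)
    (hβ : MemLp (fun x => x) 2 β) : MemLp (fun p : X × X => p.1 - p.2) 2 π :=
  (h.memLp_fst hα).sub (h.memLp_snd hβ)

theorem transportCost_eq_ofReal (h : MemLp (fun p : X × X => p.1 - p.2) 2 π) :
    transportCost π = ENNReal.ofReal (∫ p, ‖p.1 - p.2‖ ^ 2 ∂π) :=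
  lintegral_edist_sq_eq h

theorem wassersteinSq_ne_top [IsProbabilityMeasure α] [IsProbabilityMeasure β]
    (hα : MemLp (fun x => x) 2 α)
    (hβ : MemLp (fun x => x) 2 β) : wassersteinSq α β ≠ ∞ := by
  have h : IsTransportPlan (α.prod β) α β := ⟨by simp, by simp⟩
  refine ((wassersteinSq_le_transportCost h).trans_lt ?_).ne
  rw [transportCost_eq_ofReal (h.memLp_sub hα hβ)]
  exact ENNReal.ofReal_lt_top

theorem toReal_wassersteinSq_le (h : IsTransportPlan π α β)
    (hα : MemLp (fun x => x) 2 α) (hβ : MemLp (fun x => x) 2 β) :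
    (wassersteinSq α β).toReal ≤ ∫ p, ‖p.1 - p.2‖ ^ 2 ∂π := by
  refine ENNReal.toReal_le_of_le_ofReal (integral_nonneg fun p => by positivity) ?_
  rw [← transportCost_eq_ofReal (h.memLp_sub hα hβ)]
  exact wassersteinSq_le_transportCost h

end Plans

/-! ### First-order expansion of the one-dimensional distance -/

open ProbabilityTheory in
/-- A coupling `π` of `α` and `ν` can be extended by a uniform random variable whose
`ν`-quantile is the second coordinate. -/
theorem exists_quantile_gluing {α ν : Measure ℝ} [IsProbabilityMeasure α]
    [IsProbabilityMeasure ν] {π : Measure (ℝ × ℝ)} (h : IsTransportPlan π α ν) :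
    ∃ Γ : Measure ((ℝ × ℝ) × ℝ), IsProbabilityMeasure Γ ∧ Γ.map Prod.fst = π ∧
      Γ.map (fun w => (w.1.2, w.2)) = unifUnit.map fun p => (quantile ν p, p) := by
  have := h.isProbabilityMeasure
  have hmq : Measurable fun p => (quantile ν p, p) := (measurable_quantile ν).prodMk measurable_id
  set ρ : Measure (ℝ × ℝ) := unifUnit.map fun p => (quantile ν p, p) with hρ
  have : IsProbabilityMeasure ρ := Measure.isProbabilityMeasure_map hmq.aemeasurable
  have hfst : ρ.fst = ν := by
    rw [Measure.fst, hρ, Measure.map_map measurable_fst hmq]; exact map_quantile ν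
  -- `κ` is the conditional law of p given F_ν⁻¹(p) = y. Drawing p from it given y attaches p to the
  -- coupling even when ν has atoms.
  obtain ⟨κ, hκ, hdis⟩ : ∃ κ : Kernel ℝ ℝ, IsMarkovKernel κ ∧ ρ.fst ⊗ₘ κ = ρ :=
    ⟨ρ.condKernel, inferInstance, ρ.disintegrate _⟩
  let K : Kernel (ℝ × ℝ) ℝ := κ.comap Prod.snd measurable_snd
  refine ⟨π ⊗ₘ K, inferInstance, Measure.fst_compProd π K, ?_⟩
  refine Measure.ext fun s hs => ?_
  have hm2 : Measurable fun w : (ℝ × ℝ) × ℝ => (w.1.2, w.2) := by fun_prop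
  rw [Measure.map_apply hm2 hs, Measure.compProd_apply (hm2 hs)]
  rw [← hdis, Measure.compProd_apply hs, hfst, ← h.map_snd,
    lintegral_map (Kernel.measurable_kernel_prodMk_left hs) measurable_snd]
  rfl

section Gluing

variable {α β ν : Measure ℝ} [IsProbabilityMeasure α] [NullSingletonClass α]
  [IsProbabilityMeasure β] [IsProbabilityMeasure ν] {π : Measure (ℝ × ℝ)}
  {Γ : Measure ((ℝ × ℝ) × ℝ)}

theorem measurable_quantile_graph (ν : Measure ℝ) [IsProbabilityMeasure ν] :
    Measurable fun p => (quantile ν p, p) := (measurable_quantile ν).prodMk measurable_id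

theorem map_snd_of_gluing (hΓ : Γ.map (fun w => (w.1.2, w.2)) =
      unifUnit.map fun p => (quantile ν p, p)) : Γ.map Prod.snd = unifUnit := by
  have hm2 : Measurable fun w : (ℝ × ℝ) × ℝ => (w.1.2, w.2) := by fun_prop
  have h := congrArg (Measure.map Prod.snd) hΓ
  rw [Measure.map_map measurable_snd hm2, Measure.map_map measurable_snd
    (measurable_quantile_graph ν)] at h
  exact h.trans Measure.map_id

theorem map_quantile_of_gluing (hΓ : Γ.map (fun w => (w.1.2, w.2)) =
      unifUnit.map fun p => (quantile ν p, p)) :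
    Γ.map (fun w => quantile β w.2) = β := by
  have h := Measure.map_map (μ := Γ) (measurable_quantile β) measurable_snd
  rw [map_snd_of_gluing hΓ, map_quantile] at h
  exact h.symm

theorem map_quantilePlan_of_gluing (hΓ : Γ.map (fun w => (w.1.2, w.2)) =
      unifUnit.map fun p => (quantile ν p, p)) :
    Γ.map (fun w => (w.1.2, quantile β w.2)) = quantilePlan ν β := by
  have hm2 : Measurable fun w : (ℝ × ℝ) × ℝ => (w.1.2, w.2) := by fun_prop
  have hmq : Measurable fun p : ℝ × ℝ => (p.1, quantile β p.2) :=
    measurable_fst.prodMk ((measurable_quantile β).comp measurable_snd)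
  have h := congrArg (Measure.map fun p : ℝ × ℝ => (p.1, quantile β p.2)) hΓ
  rw [Measure.map_map hmq hm2, Measure.map_map hmq
    (measurable_quantile_graph ν)] at h
  exact h

theorem map_fst_fst_of_gluing (h : IsTransportPlan π α ν) (h1 : Γ.map Prod.fst = π) :
    Γ.map (fun w => w.1.1) = α := by
  rw [← h.map_fst, ← h1, Measure.map_map measurable_fst measurable_fst]; rfl

theorem map_otMap_of_gluing (h : IsTransportPlan π α ν) (h1 : Γ.map Prod.fst = π) :
    Γ.map (fun w => otMap α β w.1.1) = β := by
  have hm := Measure.map_map (μ := Γ) (measurable_otMap α β) (f := fun w => w.1.1) (by fun_prop)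
  rw [map_fst_fst_of_gluing h h1, map_otMap] at hm
  exact hm.symm

theorem memLp_otMap (hβ : MemLp (fun x => x) 2 β) : MemLp (otMap α β) 2 α := by
  rw [← map_otMap α β] at hβ
  exact (memLp_map_id (measurable_otMap α β).aemeasurable).1 hβ

/-- Put z = F_β⁻¹(p) and let t be the optimal map from α to β. The pair (y, z) is the quantile
coupling of ν and β, hence optimal, while (x, z) is merely some coupling of α and β. Write y - z =
(x - z) + (y - x), split the cross term at t(x), discard the square of y - x, and apply
Cauchy–Schwarz to the term containing t(x) - z. -/
theorem wassersteinSq_ge_of_gluing (hα : MemLp (fun x => x) 2 α) (hβ : MemLp (fun x => x) 2 β)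
    (hν : MemLp (fun x => x) 2 ν) (h : IsTransportPlan π α ν) (h1 : Γ.map Prod.fst = π)
    (hΓ : Γ.map (fun w => (w.1.2, w.2)) = unifUnit.map fun p => (quantile ν p, p)) :
    (wassersteinSq α β).toReal + 2 * ∫ p, (p.1 - otMap α β p.1) * (p.2 - p.1) ∂π
      - 2 * (√(∫ w, (otMap α β w.1.1 - quantile β w.2) ^ 2 ∂Γ) * √(∫ p, ‖p.1 - p.2‖ ^ 2 ∂π))
      ≤ (wassersteinSq ν β).toReal := by
  have hmu : Measurable fun w : (ℝ × ℝ) × ℝ => w.1.1 := by fun_prop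
  have hmv : Measurable fun w : (ℝ × ℝ) × ℝ => w.1.2 := by fun_prop
  have hmz : Measurable fun w : (ℝ × ℝ) × ℝ => quantile β w.2 :=
    (measurable_quantile β).comp measurable_snd
  have hu : MemLp (fun w : (ℝ × ℝ) × ℝ => w.1.1) 2 Γ :=
    memLp_of_map_eq hmu.aemeasurable (map_fst_fst_of_gluing h h1) hα
  have hv : MemLp (fun w : (ℝ × ℝ) × ℝ => w.1.2) 2 Γ := by
    refine memLp_of_map_eq hmv.aemeasurable ?_ hν
    rw [← h.map_snd, ← h1, Measure.map_map measurable_snd measurable_fst]; rfl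
  have hz : MemLp (fun w : (ℝ × ℝ) × ℝ => quantile β w.2) 2 Γ :=
    memLp_of_map_eq hmz.aemeasurable (map_quantile_of_gluing hΓ) hβ
  have ht : MemLp (fun w : (ℝ × ℝ) × ℝ => otMap α β w.1.1) 2 Γ :=
    memLp_of_map_eq (Measurable.aemeasurable ((measurable_otMap α β).comp hmu))
      (map_otMap_of_gluing h h1) hβ
  -- the two distances through `Γ`
  have hW1 : (wassersteinSq ν β).toReal = ∫ w, (w.1.2 - quantile β w.2) ^ 2 ∂Γ := by
    rw [wassersteinSq_eq_quantilePlan, transportCost, ← map_quantilePlan_of_gluing hΓ,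
      lintegral_map (by fun_prop) (hmv.prodMk hmz), lintegral_edist_sq_eq (hv.sub hz),
      ENNReal.toReal_ofReal (integral_nonneg fun w => by positivity)]
    simp [Real.norm_eq_abs, sq_abs]
  have hW2 : (wassersteinSq α β).toReal ≤ ∫ w, (w.1.1 - quantile β w.2) ^ 2 ∂Γ := by
    have hpl : IsTransportPlan (Γ.map fun w => (w.1.1, quantile β w.2)) α β := by
      constructor
      · rw [Measure.map_map measurable_fst (hmu.prodMk hmz)]; exact map_fst_fst_of_gluing h h1
      · rw [Measure.map_map measurable_snd (hmu.prodMk hmz)]; exact map_quantile_of_gluing hΓ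
    refine (toReal_wassersteinSq_le hpl hα hβ).trans_eq ?_
    rw [integral_map (hmu.prodMk hmz).aemeasurable (by fun_prop)]
    simp [Real.norm_eq_abs, sq_abs]
  have hP1 : ∫ p, (p.1 - otMap α β p.1) * (p.2 - p.1) ∂π =
      ∫ w, (w.1.1 - otMap α β w.1.1) * (w.1.2 - w.1.1) ∂Γ := by
    rw [← h1, integral_map measurable_fst.aemeasurable]
    have := measurable_otMap α β
    exact Measurable.aestronglyMeasurable (by fun_prop)
  have hP2 : ∫ p, ‖p.1 - p.2‖ ^ 2 ∂π = ∫ w, (w.1.2 - w.1.1) ^ 2 ∂Γ := by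
    rw [← h1, integral_map measurable_fst.aemeasurable
      (Measurable.aestronglyMeasurable (by fun_prop))]
    refine integral_congr_ae (Eventually.of_forall fun w => ?_)
    simp only [Real.norm_eq_abs, sq_abs]; ring
  have hCS := (abs_le.1 (abs_integral_inner_le (ht.sub hz) (hv.sub hu))).1
  simp only [Pi.sub_apply, Real.norm_eq_abs, sq_abs, RCLike.inner_apply, conj_trivial] at hCS
  have i1 := (hu.sub hz).integrable_norm_sq
  have i2 := integrable_inner_of_memLp (hu.sub ht) (hv.sub hu)
  have i3 := integrable_inner_of_memLp (ht.sub hz) (hv.sub hu)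
  have i4 := (hv.sub hu).integrable_norm_sq
  simp only [Pi.sub_apply, Real.norm_eq_abs, sq_abs, RCLike.inner_apply, conj_trivial]
    at i1 i2 i3 i4
  have hexp : ∫ w, (w.1.2 - quantile β w.2) ^ 2 ∂Γ =
      ∫ w, (w.1.1 - quantile β w.2) ^ 2 ∂Γ
      + 2 * ∫ w, (w.1.2 - w.1.1) * (w.1.1 - otMap α β w.1.1) ∂Γ
      + 2 * ∫ w, (w.1.2 - w.1.1) * (otMap α β w.1.1 - quantile β w.2) ∂Γ
      + ∫ w, (w.1.2 - w.1.1) ^ 2 ∂Γ := by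
    have j1 : Integrable (fun w : (ℝ × ℝ) × ℝ => (w.1.1 - quantile β w.2) ^ 2
        + 2 * ((w.1.2 - w.1.1) * (w.1.1 - otMap α β w.1.1))) Γ := i1.add (i2.const_mul 2)
    have j2 : Integrable (fun w : (ℝ × ℝ) × ℝ => (w.1.1 - quantile β w.2) ^ 2
        + 2 * ((w.1.2 - w.1.1) * (w.1.1 - otMap α β w.1.1))
        + 2 * ((w.1.2 - w.1.1) * (otMap α β w.1.1 - quantile β w.2))) Γ :=
      j1.add (i3.const_mul 2)
    rw [← integral_const_mul, ← integral_const_mul, ← integral_add i1 (i2.const_mul 2),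
      ← integral_add j1 (i3.const_mul 2), ← integral_add j2 i4]
    refine integral_congr_ae (Eventually.of_forall fun w => ?_)
    ring
  have hpos : 0 ≤ ∫ w, (w.1.2 - w.1.1) ^ 2 ∂Γ := integral_nonneg fun w => by positivity
  rw [hW1, hP1, hP2, hexp]
  have hcomm : ∫ w, (w.1.1 - otMap α β w.1.1) * (w.1.2 - w.1.1) ∂Γ =
      ∫ w, (w.1.2 - w.1.1) * (w.1.1 - otMap α β w.1.1) ∂Γ := by simp_rw [mul_comm]
  rw [hcomm]
  linarith

/-- Both t(x) and F_β⁻¹(p) have law β. This crude bound holds for every coupling and later supplies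
the dominating function. -/
theorem integral_sq_otMap_sub_le (hβ : MemLp (fun x => x) 2 β) (h : IsTransportPlan π α ν)
    (h1 : Γ.map Prod.fst = π)
    (hΓ : Γ.map (fun w => (w.1.2, w.2)) = unifUnit.map fun p => (quantile ν p, p)) :
    ∫ w, (otMap α β w.1.1 - quantile β w.2) ^ 2 ∂Γ ≤ 4 * ∫ x, ‖x‖ ^ 2 ∂β := by
  have hmt : Measurable fun w : (ℝ × ℝ) × ℝ => otMap α β w.1.1 :=
    (measurable_otMap α β).comp (by fun_prop)
  have hmz : Measurable fun w : (ℝ × ℝ) × ℝ => quantile β w.2 :=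
    (measurable_quantile β).comp measurable_snd
  have hz := memLp_of_map_eq hmz.aemeasurable (map_quantile_of_gluing hΓ) hβ
  have ht := memLp_of_map_eq hmt.aemeasurable (map_otMap_of_gluing h h1) hβ
  have e1 : ∫ w, ‖otMap α β w.1.1‖ ^ 2 ∂Γ = ∫ x, ‖x‖ ^ 2 ∂β := by
    rw [← map_otMap_of_gluing (β := β) h h1, integral_map hmt.aemeasurable (by fun_prop),
      map_otMap_of_gluing h h1]
  have e2 : ∫ w, ‖quantile β w.2‖ ^ 2 ∂Γ = ∫ x, ‖x‖ ^ 2 ∂β := by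
    rw [← map_quantile_of_gluing (β := β) hΓ, integral_map hmz.aemeasurable (by fun_prop),
      map_quantile_of_gluing hΓ]
  calc ∫ w, (otMap α β w.1.1 - quantile β w.2) ^ 2 ∂Γ
      ≤ ∫ w, (2 * ‖otMap α β w.1.1‖ ^ 2 + 2 * ‖quantile β w.2‖ ^ 2) ∂Γ := by
        refine integral_mono_of_nonneg (Eventually.of_forall fun w => by positivity)
          ((ht.integrable_norm_sq.const_mul 2).add (hz.integrable_norm_sq.const_mul 2))
          (Eventually.of_forall fun w => ?_)
        simp only [Real.norm_eq_abs, sq_abs]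
        nlinarith [sq_nonneg (otMap α β w.1.1 + quantile β w.2)]
    _ = 4 * ∫ x, ‖x‖ ^ 2 ∂β := by
        rw [integral_add (ht.integrable_norm_sq.const_mul 2) (hz.integrable_norm_sq.const_mul 2),
          integral_const_mul, integral_const_mul, e1, e2]
        ring

open ProbabilityTheory in
theorem cdf_le_cdf_add {α ν : Measure ℝ} [IsProbabilityMeasure α] [IsProbabilityMeasure ν]
    {π : Measure (ℝ × ℝ)} (h : IsTransportPlan π α ν) {η : ℝ} (y : ℝ) :
    cdf ν y ≤ cdf α (y + η) + π.real {p | η ≤ |p.1 - p.2|} ∧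
      cdf α y ≤ cdf ν (y + η) + π.real {p | η ≤ |p.1 - p.2|} := by
  have := h.isProbabilityMeasure
  have h1 : ∀ y, cdf α y = π.real (Prod.fst ⁻¹' Iic y) := fun y => by
    rw [cdf_eq_real, ← map_measureReal_apply measurable_fst measurableSet_Iic, h.map_fst]
  have h2 : ∀ y, cdf ν y = π.real (Prod.snd ⁻¹' Iic y) := fun y => by
    rw [cdf_eq_real, ← map_measureReal_apply measurable_snd measurableSet_Iic, h.map_snd]
  rw [h1, h2, h1, h2]
  refine ⟨(measureReal_mono ?_).trans (measureReal_union_le _ _),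
    (measureReal_mono ?_).trans (measureReal_union_le _ _)⟩ <;>
  · intro p hp
    simp only [mem_union, mem_preimage, mem_Iic, mem_ofPred_eq] at hp ⊢
    by_contra hc
    push Not at hc
    have := abs_lt.1 hc.2
    linarith [hc.1, this.1, this.2]

open ProbabilityTheory in
-- Since y = F_ν⁻¹(p), the number p lies between F_ν(y - η) and F_ν(y). Passing to F_α shifts the
-- argument by η and costs the probability of a displacement of at least η. For |x - y| < η the
-- points y - 2η and y + η are within 3η of x, which explains the modulus used.
theorem abs_cdf_sub_le_of_gluing (h : IsTransportPlan π α ν)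
    (hΓ : Γ.map (fun w => (w.1.2, w.2)) = unifUnit.map fun p => (quantile ν p, p))
    {η τ : ℝ} (hη : 0 < η) (hF : ∀ x y, x ≤ y → y ≤ x + 3 * η → cdf α y - cdf α x ≤ τ) :
    ∀ᵐ w ∂Γ, |w.1.1 - w.1.2| < η →
      |cdf α w.1.1 - w.2| ≤ τ + π.real {p | η ≤ |p.1 - p.2|} := by
  have hm2 : Measurable fun w : (ℝ × ℝ) × ℝ => (w.1.2, w.2) := by fun_prop
  have hae : ∀ᵐ w ∂Γ, w.2 ∈ Ioo (0 : ℝ) 1 ∧ w.1.2 = quantile ν w.2 := by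
    have : ∀ᵐ q ∂(unifUnit.map fun p => (quantile ν p, p)),
        q.2 ∈ Ioo (0 : ℝ) 1 ∧ q.1 = quantile ν q.2 := by
      rw [ae_map_iff (measurable_quantile_graph ν).aemeasurable]
      · filter_upwards [ae_unifUnit_mem] with p hp using ⟨hp, rfl⟩
      · exact (measurable_snd measurableSet_Ioo).inter
          (measurableSet_eq_fun measurable_fst ((measurable_quantile ν).comp measurable_snd))
    rw [← hΓ] at this
    exact ae_of_ae_map hm2.aemeasurable this
  filter_upwards [hae] with w hw hlt
  obtain ⟨hp, hv⟩ := hw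
  have hlt := abs_lt.1 hlt
  have a1 : w.2 ≤ cdf ν w.1.2 := (quantile_le_iff ν hp _).1 hv.ge
  have a2 : cdf ν (w.1.2 - η) < w.2 := by
    rw [← not_le, ← quantile_le_iff ν hp, not_le, ← hv]; linarith
  have a3 := (cdf_le_cdf_add h (η := η) w.1.2).1
  have a4 := (cdf_le_cdf_add h (η := η) (w.1.2 - 2 * η)).2
  rw [show w.1.2 - 2 * η + η = w.1.2 - η by ring] at a4
  have a5 := hF w.1.1 (w.1.2 + η) (by linarith) (by linarith)
  have a6 := hF (w.1.2 - 2 * η) w.1.1 (by linarith) (by linarith)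
  exact abs_le.2 ⟨by linarith, by linarith⟩

open ProbabilityTheory in
-- This is the uniform absolute continuity of the integral of the density.
theorem exists_modulus_cdf (hac : α ≪ volume) {τ : ℝ} (hτ : 0 < τ) :
    ∃ η > 0, ∀ x y, x ≤ y → y ≤ x + 3 * η → cdf α y - cdf α x ≤ τ := by
  obtain ⟨δ, hδ, hs⟩ := exists_pos_setLIntegral_lt_of_measure_lt (μ := (volume : Measure ℝ))
    (f := α.rnDeriv volume) (Measure.lintegral_rnDeriv_lt_top α volume).ne
    (ENNReal.ofReal_pos.2 hτ).ne'
  obtain ⟨r, hr0, hr⟩ : ∃ r : ℝ, 0 < r ∧ ENNReal.ofReal r < δ := by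
    obtain ⟨q, hq0, hq⟩ := ENNReal.lt_iff_exists_nnreal_btwn.1 hδ
    exact ⟨q, by exact_mod_cast hq0, by simpa using hq⟩
  refine ⟨r / 3, by positivity, fun x y hxy hyx => ?_⟩
  have h1 := hs (Ioc x y) (by
    rw [Real.volume_Ioc]
    exact (ENNReal.ofReal_le_ofReal (by linarith)).trans_lt hr)
  rw [Measure.setLIntegral_rnDeriv hac, ← measure_cdf α, StieltjesFunction.measure_Ioc] at h1
  exact ((ENNReal.ofReal_lt_ofReal_iff hτ).1 h1).le

open ProbabilityTheory in
/-- Stability of the optimal map: the `β`-quantile of the glued uniform variable converges in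
`L²` to the optimal map from `α` to `β` as the cost of the coupling tends to zero. -/
theorem exists_integral_sq_otMap_sub_lt (hac : α ≪ volume) (hβ : MemLp (fun x => x) 2 β)
    {ε : ℝ} (hε : 0 < ε) :
    ∃ δ > 0, ∀ (ν : Measure ℝ) [IsProbabilityMeasure ν] (π : Measure (ℝ × ℝ))
      (Γ : Measure ((ℝ × ℝ) × ℝ)), IsTransportPlan π α ν →
      MemLp (fun p : ℝ × ℝ => p.1 - p.2) 2 π → ∫ p, ‖p.1 - p.2‖ ^ 2 ∂π < δ →
      Γ.map Prod.fst = π →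
      Γ.map (fun w => (w.1.2, w.2)) = unifUnit.map (fun p => (quantile ν p, p)) →
      ∫ w, (otMap α β w.1.1 - quantile β w.2) ^ 2 ∂Γ ≤ ε := by
  have hQ : MemLp (quantile β) 2 unifUnit :=
    memLp_of_map_eq (measurable_quantile β).aemeasurable (map_quantile β) hβ
  -- The 12 is 3 + 3 + 3·2: a three-term split of the square, whose last term costs e² from uniform
  -- continuity and e² from large displacements.
  obtain ⟨e, he0, he⟩ : ∃ e : ℝ, 0 < e ∧ 12 * e ^ 2 ≤ ε := by
    refine ⟨√(ε / 12), by positivity, ?_⟩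
    rw [Real.sq_sqrt (by positivity)]; linarith
  obtain ⟨h, hcs, hle, hcont, hmem⟩ := hQ.exists_hasCompactSupport_eLpNorm_sub_le
    (by simp) (ENNReal.ofReal_pos.2 he0).ne'
  have hle2 : ∫ p, ‖quantile β p - h p‖ ^ 2 ∂unifUnit ≤ e ^ 2 := by
    have h3 := (hQ.sub hmem).eLpNorm_eq_integral_rpow_norm (by simp) (by simp)
    rw [h3] at hle
    have h4 := (ENNReal.ofReal_le_ofReal_iff he0.le).1 hle
    simp only [ENNReal.toReal_ofNat, Real.rpow_two, Pi.sub_apply] at h4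
    rw [← one_div, ← Real.sqrt_eq_rpow] at h4
    exact (Real.sqrt_le_left he0.le).1 h4
  obtain ⟨τ, hτ, huc⟩ := Metric.uniformContinuous_iff.1
    (hcs.uniformContinuous_of_continuous hcont) e he0
  obtain ⟨M, hM⟩ := hcs.exists_bound_of_continuous hcont
  have hM0 : 0 ≤ M := (norm_nonneg _).trans (hM 0)
  obtain ⟨η, hη, hF⟩ := exists_modulus_cdf hac (half_pos hτ)
  -- By Chebyshev, a cost below this threshold bounds the probability `b` of a displacement of at
  -- least η. Then τ/2 + b < τ, so uniform continuity of `h` applies off that event, and the event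
  -- itself contributes at most 4M²b ≤ e².
  refine ⟨min (τ / 4) (e ^ 2 / (4 * M ^ 2 + 1)) * η ^ 2, by positivity, ?_⟩
  intro ν _ π Γ hpl hL hcost h1 hΓ
  have := hpl.isProbabilityMeasure
  have hΓp : IsProbabilityMeasure Γ := by
    have := Measure.isProbabilityMeasure_map_iff (μ := Γ) (f := Prod.fst) (by fun_prop)
    rw [h1] at this
    exact this.1 inferInstance
  set b := π.real {p | η ≤ |p.1 - p.2|} with hb
  have hbs : b < min (τ / 4) (e ^ 2 / (4 * M ^ 2 + 1)) := by
    have hch := mul_meas_ge_le_integral_of_nonneg (μ := π)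
      (f := fun p : ℝ × ℝ => ‖p.1 - p.2‖ ^ 2) (Eventually.of_forall fun p => by positivity)
      hL.integrable_norm_sq (η ^ 2)
    have hset : {p : ℝ × ℝ | η ^ 2 ≤ ‖p.1 - p.2‖ ^ 2} = {p | η ≤ |p.1 - p.2|} := by
      ext p
      simp only [mem_ofPred_eq, Real.norm_eq_abs]
      exact pow_le_pow_iff_left₀ hη.le (abs_nonneg _) two_ne_zero
    rw [hset] at hch
    have h5 : b * η ^ 2 < min (τ / 4) (e ^ 2 / (4 * M ^ 2 + 1)) * η ^ 2 := by
      rw [mul_comm]; exact hch.trans_lt hcost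
    exact lt_of_mul_lt_mul_right h5 (by positivity)
  have hbτ : b < τ / 4 := hbs.trans_le (min_le_left _ _)
  have hbM : 4 * M ^ 2 * b ≤ e ^ 2 := by
    have h6 := (hbs.trans_le (min_le_right _ _)).le
    rw [le_div_iff₀ (by positivity)] at h6
    have : 0 ≤ b := measureReal_nonneg
    linarith
  have hae := abs_cdf_sub_le_of_gluing hpl hΓ hη hF
  have hmU : Measurable fun w : (ℝ × ℝ) × ℝ => cdf α w.1.1 :=
    (monotone_cdf α).measurable.comp (by fun_prop)
  -- F_α(x) and p are both uniform, so replacing the β-quantile by `h` at either of them costs the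
  -- same e² in L².
  have hlawU : Γ.map (fun w => cdf α w.1.1) = unifUnit := by
    have hm := Measure.map_map (μ := Γ) (monotone_cdf α).measurable (f := fun w => w.1.1)
      (by fun_prop)
    rw [map_fst_fst_of_gluing hpl h1, map_cdf] at hm
    exact hm.symm
  have hlawp := map_snd_of_gluing hΓ
  have hg := (hQ.sub hmem).integrable_norm_sq
  simp only [Pi.sub_apply] at hg
  have hgU : Integrable (fun w : (ℝ × ℝ) × ℝ =>
      ‖quantile β (cdf α w.1.1) - h (cdf α w.1.1)‖ ^ 2) Γ := by
    have := hg; rw [← hlawU] at this; exact this.comp_measurable hmU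
  have hgp : Integrable (fun w : (ℝ × ℝ) × ℝ => ‖quantile β w.2 - h w.2‖ ^ 2) Γ := by
    have := hg; rw [← hlawp] at this; exact this.comp_measurable measurable_snd
  have hgm : Measurable fun p => ‖quantile β p - h p‖ ^ 2 :=
    ((measurable_quantile β).sub hcont.measurable).norm.pow_const 2
  have eU : ∫ w, ‖quantile β (cdf α w.1.1) - h (cdf α w.1.1)‖ ^ 2 ∂Γ ≤ e ^ 2 := by
    refine le_trans (le_of_eq ?_) hle2
    rw [← hlawU, integral_map hmU.aemeasurable hgm.aestronglyMeasurable]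
  have ep : ∫ w, ‖quantile β w.2 - h w.2‖ ^ 2 ∂Γ ≤ e ^ 2 := by
    refine le_trans (le_of_eq ?_) hle2
    rw [← hlawp, integral_map measurable_snd.aemeasurable hgm.aestronglyMeasurable]
  set A : Set ((ℝ × ℝ) × ℝ) := {w | η ≤ |w.1.1 - w.1.2|} with hA
  have hAm : MeasurableSet A := measurableSet_le measurable_const (by fun_prop)
  have hAb : Γ.real A = b := by
    rw [hb, ← h1, map_measureReal_apply measurable_fst
      (measurableSet_le measurable_const (by fun_prop))]
    rfl
  have hI : Integrable (A.indicator fun _ => 4 * M ^ 2) Γ :=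
    (integrable_const _).indicator hAm
  have hiA : ∫ w, A.indicator (fun _ => 4 * M ^ 2) w ∂Γ = 4 * M ^ 2 * b := by
    rw [integral_indicator_const _ hAm, hAb, smul_eq_mul, mul_comm]
  calc ∫ w, (otMap α β w.1.1 - quantile β w.2) ^ 2 ∂Γ
      ≤ ∫ w, (3 * ‖quantile β (cdf α w.1.1) - h (cdf α w.1.1)‖ ^ 2
          + 3 * ‖quantile β w.2 - h w.2‖ ^ 2
          + 3 * (e ^ 2 + A.indicator (fun _ => 4 * M ^ 2) w)) ∂Γ := by
        refine integral_mono_of_nonneg (Eventually.of_forall fun w => by positivity)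
          (((hgU.const_mul 3).add (hgp.const_mul 3)).add
            (((integrable_const _).add hI).const_mul 3)) ?_
        filter_upwards [hae] with w hw
        have hd : (h (cdf α w.1.1) - h w.2) ^ 2 ≤ e ^ 2 + A.indicator (fun _ => 4 * M ^ 2) w := by
          by_cases hwA : w ∈ A
          · rw [indicator_of_mem hwA]
            have q1 := abs_le.1 (hM (cdf α w.1.1))
            have q2 := abs_le.1 (hM w.2)
            have : (h (cdf α w.1.1) - h w.2) ^ 2 ≤ (2 * M) ^ 2 :=
              sq_le_sq' (by linarith) (by linarith)
            nlinarith [sq_nonneg e]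
          · rw [indicator_of_notMem hwA, add_zero]
            have q := huc (a := cdf α w.1.1) (b := w.2)
              ((hw (not_le.1 hwA)).trans_lt (by linarith))
            rw [Real.dist_eq] at q
            exact sq_le_sq' (by linarith [(abs_lt.1 q).1]) (abs_lt.1 q).2.le
        simp only [Real.norm_eq_abs, sq_abs, otMap]
        nlinarith [sq_nonneg (quantile β (cdf α w.1.1) - h (cdf α w.1.1)
            + (quantile β w.2 - h w.2)),
          sq_nonneg (quantile β (cdf α w.1.1) - h (cdf α w.1.1) - (h (cdf α w.1.1) - h w.2)),
          sq_nonneg (quantile β w.2 - h w.2 + (h (cdf α w.1.1) - h w.2))]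
    _ ≤ ε := by
        have j1 : Integrable (fun w : (ℝ × ℝ) × ℝ =>
          3 * ‖quantile β (cdf α w.1.1) - h (cdf α w.1.1)‖ ^ 2
          + 3 * ‖quantile β w.2 - h w.2‖ ^ 2) Γ := (hgU.const_mul 3).add (hgp.const_mul 3)
        have j2 : Integrable (fun w => e ^ 2 + A.indicator (fun _ => 4 * M ^ 2) w) Γ :=
          (integrable_const _).add hI
        rw [integral_add j1 (j2.const_mul 3), integral_add (hgU.const_mul 3) (hgp.const_mul 3),
          integral_const_mul, integral_const_mul, integral_const_mul,
          integral_add (integrable_const _) hI, hiA, integral_const, probReal_univ, one_smul]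
        linarith

end Gluing

/-! ### Random orthonormal bases and the uniform measure on the sphere -/

section Ortho

variable {d : ℕ}

theorem basisVec_apply (P : OrthoGroup d) (i j : Fin d) :
    basisVec P i j = (P : Matrix (Fin d) (Fin d) ℝ) j i := rfl

instance isHaarMeasure_haarOrtho : (haarOrtho d).IsHaarMeasure :=
  Measure.isHaarMeasure_haarMeasure _

instance isProbabilityMeasure_haarOrtho : IsProbabilityMeasure (haarOrtho d) :=
  ⟨Measure.haarMeasure_self (K₀ := (⊤ : TopologicalSpace.PositiveCompacts (OrthoGroup d)))⟩

theorem inner_basisVec_basisVec (P : OrthoGroup d) (i j : Fin d) :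
    ⟪basisVec P i, basisVec P j⟫ = if i = j then 1 else 0 := by
  have h := Matrix.mem_unitaryGroup_iff'.1 P.2
  have := congrFun (congrFun h i) j
  rw [Matrix.mul_apply, Matrix.one_apply] at this
  rw [← this, PiLp.inner_apply]
  refine Finset.sum_congr rfl fun k _ => ?_
  simp [basisVec_apply, Matrix.star_apply, mul_comm]

theorem orthonormal_basisVec (P : OrthoGroup d) : Orthonormal ℝ (basisVec P) :=
  orthonormal_iff_ite.2 (inner_basisVec_basisVec P)

/-- The columns of an orthogonal matrix, as an orthonormal basis. -/
noncomputable def orthoBasis (P : OrthoGroup d) : OrthonormalBasis (Fin d) ℝ (Euc d) :=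
  OrthonormalBasis.mk (orthonormal_basisVec P)
    ((orthonormal_basisVec P).linearIndependent.span_eq_top_of_card_eq_finrank' (by simp)).ge

@[simp]
theorem orthoBasis_apply (P : OrthoGroup d) (i : Fin d) : orthoBasis P i = basisVec P i := by
  simp [orthoBasis]

theorem norm_basisVec (P : OrthoGroup d) (i : Fin d) : ‖basisVec P i‖ = 1 :=
  (orthonormal_basisVec P).1 i

theorem sum_inner_basisVec_sq (P : OrthoGroup d) (x : Euc d) :
    ∑ i, ⟪basisVec P i, x⟫ ^ 2 = ‖x‖ ^ 2 := by
  have := (orthoBasis P).sum_sq_norm_inner_right x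
  simpa [Real.norm_eq_abs, sq_abs] using this

theorem sum_inner_basisVec_smul (P : OrthoGroup d) (x : Euc d) :
    ∑ i, ⟪basisVec P i, x⟫ • basisVec P i = x := by
  have := (orthoBasis P).sum_repr' x
  simpa using this

theorem inner_basisVec_sum (P : OrthoGroup d) (c : Fin d → ℝ) (i : Fin d) :
    ⟪basisVec P i, ∑ j, c j • basisVec P j⟫ = c i := by
  simp [inner_sum, inner_smul_right, inner_basisVec_basisVec]

theorem inner_eq_sum_basisVec (P : OrthoGroup d) (x y : Euc d) :
    ⟪x, y⟫ = ∑ i, ⟪basisVec P i, x⟫ * ⟪basisVec P i, y⟫ := by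
  have := (orthoBasis P).sum_inner_mul_inner x y
  simp only [orthoBasis_apply] at this
  rw [← this]
  refine Finset.sum_congr rfl fun i _ => ?_
  rw [real_inner_comm]

theorem continuous_basisVec (i : Fin d) : Continuous fun P : OrthoGroup d => basisVec P i := by
  unfold basisVec
  refine (PiLp.continuous_toLp 2 _).comp (continuous_pi fun j => ?_)
  exact (continuous_apply i).comp ((continuous_apply j).comp continuous_subtype_val)

theorem measurable_basisVec (i : Fin d) : Measurable fun P : OrthoGroup d => basisVec P i :=
  (continuous_basisVec i).measurable

theorem orthoBasis_repr_symm_basisVec (P Q : OrthoGroup d) (i : Fin d) :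
    (orthoBasis Q).repr.symm (basisVec P i) = basisVec (Q * P) i := by
  rw [← (orthoBasis Q).sum_repr_symm]
  ext j
  simp [basisVec_apply, Matrix.mul_apply, mul_comm]

/-- Transitivity of the orthogonal group on the sphere, by completing θ to an orthonormal basis. -/
theorem exists_basisVec_eq (θ : Euc d) (hθ : ‖θ‖ = 1) (i : Fin d) :
    ∃ P : OrthoGroup d, basisVec P i = θ := by
  have hon : Orthonormal ℝ (({i} : Set (Fin d)).domRestrict fun _ => θ) := by
    refine ⟨fun _ => hθ, fun a b hab => absurd (Subsingleton.elim a b) hab⟩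
  obtain ⟨b, hb⟩ := hon.exists_orthonormalBasis_extension_of_card_eq (by simp)
  have hb' : b i = θ := hb i rfl
  refine ⟨⟨Matrix.of fun j k => b k j, ?_⟩, ?_⟩
  · rw [Matrix.mem_orthogonalGroup_iff']
    ext k l
    have := orthonormal_iff_ite.1 b.orthonormal k l
    rw [Matrix.mul_apply, Matrix.one_apply, ← this, PiLp.inner_apply]
    refine Finset.sum_congr rfl fun j _ => ?_
    simp [mul_comm]
  · ext j
    simp [basisVec_apply, hb']

/-- A right translate of Haar measure is again left-invariant of mass one, so uniqueness identifies
it with Haar measure. -/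
instance isMulRightInvariant_haarOrtho : (haarOrtho d).IsMulRightInvariant where
  map_mul_right_eq_self g := by
    have h : IsProbabilityMeasure ((haarOrtho d).map (· * g)) :=
      Measure.isProbabilityMeasure_map (measurable_mul_const g).aemeasurable
    exact Measure.isHaarMeasure_eq_of_isProbabilityMeasure _ _

/-! ### Invariance of the uniform measure on the sphere -/

/-- The uniform measure on the sphere, as a measure on the ambient space. -/
noncomputable def sphereMeasure (d : ℕ) : Measure (Euc d) := (uniformSphere d).map Subtype.val

theorem isProbabilityMeasure_uniformSphere (hd : 1 ≤ d) :
    IsProbabilityMeasure (uniformSphere d) := by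
  have : Nontrivial (Euc d) := by
    have : Nonempty (Fin d) := ⟨⟨0, hd⟩⟩
    infer_instance
  refine ⟨?_⟩
  rw [uniformSphere, Measure.smul_apply, smul_eq_mul]
  refine ENNReal.inv_mul_cancel ?_ (measure_ne_top _ _)
  rw [Ne, Measure.measure_univ_eq_zero]
  exact Measure.toSphere_ne_zero _

/-- The surface measure is the normalised volume of a cone. Written with ambient vectors only, it
can be moved by isometries of the whole space. -/
theorem sphereMeasure_apply {s : Set (Euc d)} (hs : MeasurableSet s) :
    sphereMeasure d s = ((volume : Measure (Euc d)).toSphere univ)⁻¹ *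
      (Module.finrank ℝ (Euc d) *
        volume {x : Euc d | ∃ r ∈ Ioo (0 : ℝ) 1, ∃ y, ‖y‖ = 1 ∧ y ∈ s ∧ r • y = x}) := by
  rw [sphereMeasure, Measure.map_apply measurable_subtype_coe hs, uniformSphere,
    Measure.smul_apply, smul_eq_mul, Measure.toSphere_apply' _ (measurable_subtype_coe hs)]
  congr 3
  ext x
  simp only [Set.mem_smul, mem_image, mem_preimage, Subtype.exists, mem_ofPred_eq,
    mem_sphere_iff_norm, sub_zero]
  constructor
  · rintro ⟨r, hr, y, ⟨z, hz, hzs, rfl⟩, rfl⟩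
    exact ⟨r, hr, z, hz, hzs, rfl⟩
  · rintro ⟨r, hr, y, hy, hys, rfl⟩
    exact ⟨r, hr, y, ⟨y, hy, hys, rfl⟩, rfl⟩

theorem map_sphereMeasure (L : Euc d ≃ₗᵢ[ℝ] Euc d) :
    (sphereMeasure d).map L = sphereMeasure d := by
  refine Measure.ext fun s hs => ?_
  have hL : Measurable L := L.continuous.measurable
  rw [Measure.map_apply hL hs, sphereMeasure_apply hs, sphereMeasure_apply (hL hs)]
  congr 2
  have h := L.measurePreserving.measure_preimage_equiv (f := L.toMeasurableEquiv)
    {x : Euc d | ∃ r ∈ Ioo (0 : ℝ) 1, ∃ y, ‖y‖ = 1 ∧ y ∈ s ∧ r • y = x}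
  rw [← h]
  congr 1
  ext x
  simp only [mem_ofPred_eq, mem_preimage]
  constructor
  · rintro ⟨r, hr, y, hy, hys, rfl⟩
    exact ⟨r, hr, L y, by simpa using hy, hys, (map_smul L r y).symm⟩
  · rintro ⟨r, hr, y, hy, hys, h⟩
    refine ⟨r, hr, L.symm y, by simpa using hy, by simpa using hys, ?_⟩
    have : L.symm (r • y) = L.symm (L x) := congrArg L.symm h
    simpa using this

/-- Average f(Qθ) over both Q and θ. For fixed Q, rotation invariance gives the spherical integral.
For fixed θ, written as the i-th column of some P, the vector Qθ is the i-th column of QP, and right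
invariance gives the Haar integral. Tonelli equates the two. -/
theorem lintegral_sphere_eq_haar (hd : 1 ≤ d) {f : Euc d → ℝ≥0∞} (hf : Measurable f)
    (i : Fin d) :
    ∫⁻ θ : Metric.sphere (0 : Euc d) 1, f θ ∂(uniformSphere d) =
      ∫⁻ P, f (basisVec P i) ∂(haarOrtho d) := by
  have := isProbabilityMeasure_uniformSphere hd
  have : IsProbabilityMeasure (sphereMeasure d) :=
    Measure.isProbabilityMeasure_map measurable_subtype_coe.aemeasurable
  have hmeas : Measurable fun z : OrthoGroup d × Euc d => (orthoBasis z.1).repr.symm z.2 := by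
    have : (fun z : OrthoGroup d × Euc d => (orthoBasis z.1).repr.symm z.2) =
        fun z => ∑ j, z.2 j • basisVec z.1 j := by
      funext z
      rw [← (orthoBasis z.1).sum_repr_symm]; simp
    rw [this]
    refine Finset.measurable_sum _ fun j _ => ?_
    have hj : Measurable fun z : OrthoGroup d × Euc d => z.2 j := by fun_prop
    exact hj.smul ((measurable_basisVec j).comp measurable_fst)
  have h1 : ∫⁻ θ : Metric.sphere (0 : Euc d) 1, f θ ∂(uniformSphere d) =
      ∫⁻ θ, f θ ∂(sphereMeasure d) := by
    rw [sphereMeasure, lintegral_map hf measurable_subtype_coe]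
  have h2 : ∀ Q : OrthoGroup d, ∫⁻ θ, f ((orthoBasis Q).repr.symm θ) ∂(sphereMeasure d) =
      ∫⁻ θ, f θ ∂(sphereMeasure d) := by
    intro Q
    conv_rhs => rw [← map_sphereMeasure (orthoBasis Q).repr.symm]
    rw [lintegral_map hf (orthoBasis Q).repr.symm.continuous.measurable]
  have h3 : ∫⁻ θ, f θ ∂(sphereMeasure d) =
      ∫⁻ Q, ∫⁻ θ, f ((orthoBasis Q).repr.symm θ) ∂(sphereMeasure d) ∂(haarOrtho d) := by
    simp_rw [h2]; simp
  rw [h1, h3, lintegral_lintegral_swap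
    (f := fun Q θ => f ((orthoBasis Q).repr.symm θ)) (hf.comp hmeas).aemeasurable]
  have hae : ∀ᵐ θ ∂(sphereMeasure d), ‖θ‖ = 1 := by
    rw [sphereMeasure, ae_map_iff measurable_subtype_coe.aemeasurable
      (measurableSet_eq_fun measurable_norm measurable_const)]
    exact Eventually.of_forall fun θ => by simp
  have h4 : ∀ᵐ θ ∂(sphereMeasure d),
      ∫⁻ Q, f ((orthoBasis Q).repr.symm θ) ∂(haarOrtho d) =
        ∫⁻ P, f (basisVec P i) ∂(haarOrtho d) := by
    filter_upwards [hae] with θ hθ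
    obtain ⟨P, rfl⟩ := exists_basisVec_eq θ hθ i
    simp_rw [orthoBasis_repr_symm_basisVec]
    exact lintegral_mul_right_eq_self (fun Q => f (basisVec Q i)) P
  rw [lintegral_congr_ae h4]; simp

end Ortho

/-! ### Measurable dependence on parameters -/

section Measurability

variable {d : ℕ} {Ω X Y : Type*} [MeasurableSpace Ω] [MeasurableSpace X] [MeasurableSpace Y]

open ProbabilityTheory in
theorem measurable_measure_map {κ : Ω → Measure X} (hκ : Measurable κ)
    (hp : ∀ ω, IsProbabilityMeasure (κ ω)) {S : Ω × X → Y} (hS : Measurable S) :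
    Measurable fun ω => (κ ω).map fun x => S (ω, x) := by
  let K : Kernel Ω X := ⟨κ, hκ⟩
  have : IsMarkovKernel K := ⟨hp⟩
  refine Measure.measurable_of_measurable_coe _ fun s hs => ?_
  have h : (fun ω => (κ ω).map (fun x => S (ω, x)) s) =
      fun ω => K ω (Prod.mk ω ⁻¹' (S ⁻¹' s)) := by
    funext ω
    exact Measure.map_apply (hS.comp measurable_prodMk_left) hs
  rw [h]
  exact Kernel.measurable_kernel_prodMk_left (hS hs)

open ProbabilityTheory in
theorem measurable_integral_param {E : Type*} [NormedAddCommGroup E] [NormedSpace ℝ E]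
    {κ : Ω → Measure X} (hκ : Measurable κ)
    (hp : ∀ ω, IsProbabilityMeasure (κ ω)) {f : Ω × X → E} (hf : StronglyMeasurable f) :
    StronglyMeasurable fun ω => ∫ x, f (ω, x) ∂(κ ω) := by
  let K : Kernel Ω X := ⟨κ, hκ⟩
  have : IsMarkovKernel K := ⟨hp⟩
  exact hf.integral_kernel_prod_right' (κ := K)

theorem isProbabilityMeasure_projMeasure (σ : Measure (Euc d)) [IsProbabilityMeasure σ]
    (θ : Euc d) : IsProbabilityMeasure (projMeasure σ θ) :=
  Measure.isProbabilityMeasure_map (by fun_prop)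

theorem measurable_projMeasure {κ : Ω → Measure (Euc d)} (hκ : Measurable κ)
    (hp : ∀ ω, IsProbabilityMeasure (κ ω)) {θ : Ω → Euc d} (hθ : Measurable θ) :
    Measurable fun ω => projMeasure (κ ω) (θ ω) :=
  measurable_measure_map hκ hp (S := fun z : Ω × Euc d => ⟪z.2, θ z.1⟫) (by fun_prop)

/-- An infimum over couplings is not visibly measurable in the parameter; the quantile formula
replaces it by an integral of a jointly measurable function. -/
theorem measurable_wassersteinSq_proj {κ : Ω → Measure (Euc d)} (hκ : Measurable κ)
    (hp : ∀ ω, IsProbabilityMeasure (κ ω)) (μ : Measure (Euc d)) [IsProbabilityMeasure μ]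
    {θ : Ω → Euc d} (hθ : Measurable θ) :
    Measurable fun ω => wassersteinSq (projMeasure (κ ω) (θ ω)) (projMeasure μ (θ ω)) := by
  have h : (fun ω => wassersteinSq (projMeasure (κ ω) (θ ω)) (projMeasure μ (θ ω))) =
      fun ω => ∫⁻ p, edist (quantile (projMeasure (κ ω) (θ ω)) p)
        (quantile (projMeasure μ (θ ω)) p) ^ 2 ∂unifUnit := by
    funext ω
    have := isProbabilityMeasure_projMeasure (κ ω) (θ ω)
    have := isProbabilityMeasure_projMeasure μ (θ ω)
    rw [wassersteinSq_eq_lintegral_quantile]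
  rw [h]
  have m1 := measurable_quantile_kernel (measurable_projMeasure hκ hp hθ)
    fun ω => isProbabilityMeasure_projMeasure (κ ω) (θ ω)
  have m2 := measurable_quantile_kernel
    (measurable_projMeasure (κ := fun _ : Ω => μ) measurable_const (fun _ => inferInstance) hθ)
    fun ω => isProbabilityMeasure_projMeasure μ (θ ω)
  exact Measurable.lintegral_prod_right' (f := fun z : Ω × ℝ =>
    edist (quantile (projMeasure (κ z.1) (θ z.1)) z.2)
        (quantile (projMeasure μ (θ z.1)) z.2) ^ 2) ((m1.edist m2).pow_const 2)

theorem measurable_sliceMap_param {κ : Ω → Measure (Euc d)} (hκ : Measurable κ)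
    (hp : ∀ ω, IsProbabilityMeasure (κ ω)) (μ : Measure (Euc d)) [IsProbabilityMeasure μ]
    {P : Ω → OrthoGroup d} (hP : Measurable P) :
    Measurable fun z : Ω × Euc d => sliceMap μ (κ z.1) (P z.1) z.2 := by
  unfold sliceMap
  refine Finset.measurable_fun_sum _ fun i _ => ?_
  have hb : Measurable fun ω => basisVec (P ω) i := (measurable_basisVec i).comp hP
  have hb' : Measurable fun z : Ω × Euc d => basisVec (P z.1) i := hb.comp measurable_fst
  have m := measurable_otMap_kernel (measurable_projMeasure hκ hp hb)
    (measurable_projMeasure (κ := fun _ : Ω => μ) measurable_const (fun _ => inferInstance) hb)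
    (fun ω => isProbabilityMeasure_projMeasure (κ ω) (basisVec (P ω) i))
    fun ω => isProbabilityMeasure_projMeasure μ (basisVec (P ω) i)
  have m' := m.comp (f := fun z : Ω × Euc d => (z.1, ⟪basisVec (P z.1) i, z.2⟫))
    (measurable_fst.prodMk (hb'.inner measurable_snd))
  exact Measurable.smul (f := fun z : Ω × Euc d => otMap (projMeasure (κ z.1) (basisVec (P z.1) i))
    (projMeasure μ (basisVec (P z.1) i)) ⟪basisVec (P z.1) i, z.2⟫) m' hb'

theorem measurable_sliceMap (μ σ : Measure (Euc d)) [IsProbabilityMeasure μ]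
    [IsProbabilityMeasure σ] :
    Measurable fun z : OrthoGroup d × Euc d => sliceMap μ σ z.1 z.2 :=
  measurable_sliceMap_param (Ω := OrthoGroup d) (κ := fun _ => σ) measurable_const
    (fun _ => inferInstance) μ (P := fun P => P) measurable_id

theorem measurable_sliceMap_apply (μ σ : Measure (Euc d)) [IsProbabilityMeasure μ]
    [IsProbabilityMeasure σ] (P : OrthoGroup d) : Measurable (sliceMap μ σ P) :=
  (measurable_sliceMap μ σ).comp (f := fun x => (P, x)) measurable_prodMk_left

end Measurability

/-! ### The objective as an average over random bases -/

section Loss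

variable {d : ℕ}

/-- The sum of the squared distances between the marginals of `ν` and `μ` in the directions of an
orthonormal basis. -/
noncomputable def sliceCost (μ ν : Measure (Euc d)) (P : OrthoGroup d) : ℝ≥0∞ :=
  ∑ i, wassersteinSq (projMeasure ν (basisVec P i)) (projMeasure μ (basisVec P i))

theorem measurable_sliceCost {Ω : Type*} [MeasurableSpace Ω] {κ : Ω → Measure (Euc d)}
    (hκ : Measurable κ) (hp : ∀ ω, IsProbabilityMeasure (κ ω)) (μ : Measure (Euc d))
    [IsProbabilityMeasure μ] {P : Ω → OrthoGroup d} (hP : Measurable P) :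
    Measurable fun ω => sliceCost μ (κ ω) (P ω) :=
  Finset.measurable_fun_sum _ fun i _ =>
    measurable_wassersteinSq_proj hκ hp μ ((measurable_basisVec i).comp hP)

theorem mul_slicedWassersteinSq (hd : 1 ≤ d) (μ ν : Measure (Euc d)) [IsProbabilityMeasure μ]
    [IsProbabilityMeasure ν] :
    d * slicedWassersteinSq ν μ = ∫⁻ P, sliceCost μ ν P ∂(haarOrtho d) := by
  have hm : Measurable fun θ : Euc d => wassersteinSq (projMeasure ν θ) (projMeasure μ θ) :=
    measurable_wassersteinSq_proj (Ω := Euc d) (κ := fun _ => ν) measurable_const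
      (fun _ => inferInstance) μ (θ := fun θ => θ) measurable_id
  unfold sliceCost
  rw [lintegral_finsetSum (f := fun i P => wassersteinSq (projMeasure ν (basisVec P i))
    (projMeasure μ (basisVec P i))) _ fun i _ => hm.comp (measurable_basisVec i)]
  unfold slicedWassersteinSq
  simp_rw [← lintegral_sphere_eq_haar hd hm]
  simp

theorem swLoss_eq (hd : 1 ≤ d) (μ ν : Measure (Euc d)) [IsProbabilityMeasure μ]
    [IsProbabilityMeasure ν] :
    swLoss μ ν = (∫⁻ P, sliceCost μ ν P ∂(haarOrtho d)).toReal / 2 := by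
  rw [← mul_slicedWassersteinSq hd, ENNReal.toReal_mul, ENNReal.toReal_natCast, swLoss]
  ring

end Loss

/-! ### Absolute continuity along the scheme -/

theorem pi_absolutelyContinuous {n : ℕ} {μ ν : Fin n → Measure ℝ} [∀ i, SigmaFinite (μ i)]
    [∀ i, SigmaFinite (ν i)] (h : ∀ i, μ i ≪ ν i) : Measure.pi μ ≪ Measure.pi ν := by
  induction n with
  | zero => rw [Measure.pi_of_empty, Measure.pi_of_empty]
  | succ n ih =>
    have h1 := measurePreserving_piFinSuccAbove μ 0
    have h2 := measurePreserving_piFinSuccAbove ν 0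
    have hprod := (h 0).prod (ih (μ := fun j => μ (Fin.succAbove 0 j))
      (ν := fun j => ν (Fin.succAbove 0 j)) fun j => h _)
    have h3 := (MeasurableEquiv.piFinSuccAbove (fun _ : Fin (n + 1) => ℝ) 0).symm
    rw [← h1.map_eq, ← h2.map_eq] at hprod
    have h4 := hprod.map (MeasurableEquiv.piFinSuccAbove (fun _ : Fin (n + 1) => ℝ) 0).symm.measurable
    rwa [MeasurableEquiv.map_symm_map, MeasurableEquiv.map_symm_map] at h4

theorem map_eval_absolutelyContinuous {n : ℕ} {ρ : Measure (Fin n → ℝ)} (hρ : ρ ≪ volume)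
    (i : Fin n) : ρ.map (Function.eval i) ≪ volume := by
  refine Measure.AbsolutelyContinuous.mk fun s hs hs0 => ?_
  rw [Measure.map_apply (measurable_pi_apply i) hs]
  refine hρ ?_
  rw [volume_pi]
  exact Measure.pi_eval_preimage_null _ hs0

/-- A probability measure on `ℝⁿ` with a density is absolutely continuous with respect to the
product of its marginals. -/
theorem absolutelyContinuous_pi_marginals {n : ℕ} {ρ : Measure (Fin n → ℝ)}
    [IsProbabilityMeasure ρ] (hρ : ρ ≪ volume) :
    ρ ≪ Measure.pi fun i => ρ.map (Function.eval i) := by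
  have hp : ∀ i, IsProbabilityMeasure (ρ.map (Function.eval i)) := fun i =>
    Measure.isProbabilityMeasure_map (measurable_pi_apply i).aemeasurable
  set f : Fin n → ℝ → ℝ≥0∞ := fun i => (ρ.map (Function.eval i)).rnDeriv volume with hf
  have hfm : ∀ i, Measurable (f i) := fun i => Measure.measurable_rnDeriv _ _
  have hfd : ∀ i, (volume : Measure ℝ).withDensity (f i) = ρ.map (Function.eval i) := fun i =>
    Measure.withDensity_rnDeriv_eq _ _ (map_eval_absolutelyContinuous hρ i)
  -- `A i` is where the i-th marginal density is nonzero. There Lebesgue measure is dominated by the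
  -- marginal, and `ρ` puts no mass outside the product of these sets.
  set A : Fin n → Set ℝ := fun i => {x | f i x ≠ 0} with hA
  have hAm : ∀ i, MeasurableSet (A i) := fun i => (hfm i) (measurableSet_singleton 0).compl
  have h1 : ∀ i, (volume : Measure ℝ).restrict (A i) ≪ ρ.map (Function.eval i) := by
    intro i
    have h2 : (volume : Measure ℝ).restrict (A i) ≪
        ((volume : Measure ℝ).restrict (A i)).withDensity (f i) :=
      withDensity_absolutelyContinuous' (hfm i).aemeasurable (ae_restrict_mem (hAm i))
    rw [← restrict_withDensity (hAm i), hfd] at h2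
    exact h2.trans Measure.restrict_le_self.absolutelyContinuous
  refine Measure.AbsolutelyContinuous.trans ?_ (pi_absolutelyContinuous h1)
  rw [← Measure.restrict_pi_pi, ← volume_pi]
  refine Measure.AbsolutelyContinuous.mk fun s hs hs0 => ?_
  rw [Measure.restrict_apply hs] at hs0
  have hcompl : ρ (univ.pi A)ᶜ = 0 := by
    have : (univ.pi A)ᶜ = ⋃ i, Function.eval i ⁻¹' (A i)ᶜ := by
      ext x; simp
    rw [this, measure_iUnion_null_iff]
    intro i
    rw [← Measure.map_apply (measurable_pi_apply i) (hAm i).compl, ← hfd,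
      withDensity_apply _ (hAm i).compl, setLIntegral_eq_zero_iff (hAm i).compl (hfm i)]
    exact Eventually.of_forall fun x hx => not_not.1 hx
  exact measure_mono_null (fun x hx => by
    by_cases hxA : x ∈ univ.pi A
    · exact Or.inl ⟨hx, hxA⟩
    · exact Or.inr hxA) (measure_union_null (hρ hs0) hcompl)

/-- Since `ρ` is dominated by the product of its marginals, its image is dominated by the product of
the one-dimensional images. This reduces the question to one coordinate. -/
theorem map_pi_absolutelyContinuous {n : ℕ} {ρ : Measure (Fin n → ℝ)}
    [IsProbabilityMeasure ρ] (hρ : ρ ≪ volume) {s : Fin n → ℝ → ℝ} (hs : ∀ i, Measurable (s i))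
    (hac : ∀ i, (ρ.map (Function.eval i)).map (s i) ≪ volume) :
    ρ.map (fun x i => s i (x i)) ≪ volume := by
  have hp : ∀ i, IsProbabilityMeasure (ρ.map (Function.eval i)) := fun i =>
    Measure.isProbabilityMeasure_map (measurable_pi_apply i).aemeasurable
  have hp' : ∀ i, IsProbabilityMeasure ((ρ.map (Function.eval i)).map (s i)) := fun i =>
    Measure.isProbabilityMeasure_map (hs i).aemeasurable
  have hm : Measurable fun (x : Fin n → ℝ) i => s i (x i) :=
    measurable_pi_lambda _ fun i => (hs i).comp (measurable_pi_apply i)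
  refine ((absolutelyContinuous_pi_marginals hρ).map hm).trans ?_
  rw [Measure.pi_map_pi fun i => (hs i).aemeasurable, volume_pi]
  exact pi_absolutelyContinuous hac

/-! ### Monotone interpolation keeps densities in one dimension -/

open ProbabilityTheory in
theorem monotoneOn_otMap (α β : Measure ℝ) :
    MonotoneOn (otMap α β) {x | cdf α x ∈ Ioo (0 : ℝ) 1} := fun _ hx _ hy hxy =>
  monotoneOn_quantile β hx hy (monotone_cdf α hxy)

open ProbabilityTheory in
-- For γ = 1 the image is β. For γ < 1 the optimal map is nondecreasing, so the interpolation
-- expands distances by at least 1 - γ; its inverse is Lipschitz and preimages of null sets are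
-- null.
theorem map_interp_otMap_absolutelyContinuous {α β : Measure ℝ} [IsProbabilityMeasure α]
    [IsProbabilityMeasure β] (hα : α ≪ volume) (hβ : β ≪ volume) {γ : ℝ} (h0 : 0 ≤ γ)
    (h1 : γ ≤ 1) : α.map (fun x => (1 - γ) * x + γ * otMap α β x) ≪ volume := by
  have hna : NullSingletonClass α := ⟨fun x => hα (measure_singleton x)⟩
  have hmt := measurable_otMap α β
  rcases h1.eq_or_lt with rfl | h1
  · simpa [map_otMap] using hβ
  set s : ℝ → ℝ := fun x => (1 - γ) * x + γ * otMap α β x with hs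
  have hsm : Measurable s := by fun_prop
  -- At levels 0 and 1 `quantile` may return a default value, so monotonicity is used only on this
  -- set of full α-measure.
  set G : Set ℝ := {x | cdf α x ∈ Ioo (0 : ℝ) 1} with hG
  have hGae : ∀ᵐ x ∂α, x ∈ G := by
    have := ae_unifUnit_mem
    rw [← map_cdf α] at this
    exact ae_of_ae_map (monotone_cdf α).measurable.aemeasurable this
  refine Measure.AbsolutelyContinuous.mk fun N hN hN0 => ?_
  rw [Measure.map_apply hsm hN]
  have hanti : AntilipschitzWith (Real.toNNReal (1 - γ)⁻¹) (G.domRestrict s) := by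
    refine AntilipschitzWith.of_le_mul_dist fun x y => ?_
    have hpos := sub_pos.2 h1
    rw [Subtype.dist_eq, Real.coe_toNNReal _ (by positivity), inv_mul_eq_div, le_div_iff₀ hpos, Real.dist_eq,
      Real.dist_eq]
    simp only [domRestrict_apply, hs]
    rcases le_total (x : ℝ) y with h | h
    · have hm := monotoneOn_otMap α β x.2 y.2 h
      rw [abs_sub_comm, abs_of_nonneg (sub_nonneg.2 h), abs_sub_comm, abs_of_nonneg] <;>
        nlinarith
    · have hm := monotoneOn_otMap α β y.2 x.2 h
      rw [abs_of_nonneg (sub_nonneg.2 h), abs_of_nonneg] <;> nlinarith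
  -- On the line Lebesgue measure is one-dimensional Hausdorff measure, for which antilipschitz maps
  -- have controlled preimages.
  have hle := hanti.hausdorffMeasure_preimage_le zero_le_one N
  rw [hausdorffMeasure_real, hN0, mul_zero, nonpos_iff_eq_zero] at hle
  have himg : volume (G ∩ s ⁻¹' N) = 0 := by
    have h2 := (isometry_subtype_coe (s := G)).hausdorffMeasure_image (d := 1)
      (Or.inl zero_le_one) (G.domRestrict s ⁻¹' N)
    rw [hle, hausdorffMeasure_real] at h2
    rw [← h2]
    congr 1
    ext x
    simp [and_comm]
  rw [← measure_inter_add_sdiff₀ (s ⁻¹' N) (t := G)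
    (((monotone_cdf α).measurable measurableSet_Ioo).nullMeasurableSet), inter_comm, hα himg,
    zero_add]
  exact measure_mono_null (fun x hx => hx.2) hGae

/-! ### The step in the coordinates of a random basis -/

section Coordinates

variable {d : ℕ}

/-- Coordinates in an orthonormal basis. -/
noncomputable def orthoCoord (P : OrthoGroup d) (x : Euc d) : Fin d → ℝ :=
  fun i => ⟪basisVec P i, x⟫

/-- The point with given coordinates in an orthonormal basis. -/
noncomputable def ofOrthoCoord (P : OrthoGroup d) (y : Fin d → ℝ) : Euc d :=
  ∑ i, y i • basisVec P i

theorem measurePreserving_orthoCoord (P : OrthoGroup d) :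
    MeasurePreserving (orthoCoord P) volume volume := by
  have h := (PiLp.volume_preserving_ofLp (Fin d)).comp
    (orthoBasis P).measurePreserving_repr
  have heq : orthoCoord P = WithLp.ofLp ∘ (orthoBasis P).repr := by
    funext x i
    simp [orthoCoord, OrthonormalBasis.repr_apply_apply]
  rw [heq]
  exact h

theorem measurePreserving_ofOrthoCoord (P : OrthoGroup d) :
    MeasurePreserving (ofOrthoCoord P) volume volume := by
  have h := (orthoBasis P).measurePreserving_repr_symm.comp
    (PiLp.volume_preserving_toLp (Fin d))
  have heq : ofOrthoCoord P = (orthoBasis P).repr.symm ∘ WithLp.toLp 2 := by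
    funext y
    simp [ofOrthoCoord, ← (orthoBasis P).sum_repr_symm]
  rw [heq]
  exact h

theorem projMeasure_basisVec_eq (σ : Measure (Euc d)) (P : OrthoGroup d) (i : Fin d) :
    projMeasure σ (basisVec P i) = (σ.map (orthoCoord P)).map (Function.eval i) := by
  rw [Measure.map_map (measurable_pi_apply i) (measurePreserving_orthoCoord P).measurable]
  unfold projMeasure
  congr 1
  funext x
  exact real_inner_comm _ _

theorem map_orthoCoord_absolutelyContinuous {σ : Measure (Euc d)} (hσ : σ ≪ volume)
    (P : OrthoGroup d) : σ.map (orthoCoord P) ≪ volume := by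
  have := hσ.map (measurePreserving_orthoCoord P).measurable
  rwa [(measurePreserving_orthoCoord P).map_eq] at this

theorem projMeasure_absolutelyContinuous {σ : Measure (Euc d)} (hσ : σ ≪ volume)
    (P : OrthoGroup d) (i : Fin d) : projMeasure σ (basisVec P i) ≪ volume := by
  rw [projMeasure_basisVec_eq]
  exact map_eval_absolutelyContinuous (map_orthoCoord_absolutelyContinuous hσ P) i

theorem nullSingletonClass_projMeasure {σ : Measure (Euc d)} (hσ : σ ≪ volume)
    (P : OrthoGroup d) (i : Fin d) : NullSingletonClass (projMeasure σ (basisVec P i)) :=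
  ⟨fun x => projMeasure_absolutelyContinuous hσ P i (measure_singleton x)⟩

theorem interp_sliceMap_eq (μ σ : Measure (Euc d)) (P : OrthoGroup d) (γ : ℝ) (x : Euc d) :
    (1 - γ) • x + γ • sliceMap μ σ P x = ofOrthoCoord P (fun i =>
      (1 - γ) * orthoCoord P x i + γ * otMap (projMeasure σ (basisVec P i))
        (projMeasure μ (basisVec P i)) (orthoCoord P x i)) := by
  conv_lhs => rw [← sum_inner_basisVec_smul P x]
  rw [ofOrthoCoord, Finset.smul_sum]
  have h : ∀ c : Fin d → ℝ, ∑ i, ((1 - γ) * orthoCoord P x i + γ * c i) • basisVec P i =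
      ∑ i, (1 - γ) • ⟪basisVec P i, x⟫ • basisVec P i + γ • ∑ i, c i • basisVec P i := by
    intro c
    rw [Finset.smul_sum, ← Finset.sum_add_distrib]
    refine Finset.sum_congr rfl fun i _ => ?_
    rw [add_smul, mul_smul, mul_smul]; rfl
  rw [h, sum_inner_basisVec_smul]
  rfl

theorem map_interp_sliceMap_absolutelyContinuous {μ σ : Measure (Euc d)}
    [IsProbabilityMeasure μ] [IsProbabilityMeasure σ] (hμ : μ ≪ volume) (hσ : σ ≪ volume)
    (P : OrthoGroup d) {γ : ℝ} (h0 : 0 ≤ γ) (h1 : γ ≤ 1) :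
    σ.map (fun x => (1 - γ) • x + γ • sliceMap μ σ P x) ≪ volume := by
  have hpm : ∀ i, IsProbabilityMeasure (projMeasure μ (basisVec P i)) := fun i =>
    isProbabilityMeasure_projMeasure _ _
  have hps : ∀ i, IsProbabilityMeasure (projMeasure σ (basisVec P i)) := fun i =>
    isProbabilityMeasure_projMeasure _ _
  have hc := (measurePreserving_orthoCoord P).measurable
  have hoc := (measurePreserving_ofOrthoCoord P).measurable
  have : IsProbabilityMeasure (σ.map (orthoCoord P)) :=
    Measure.isProbabilityMeasure_map hc.aemeasurable
  set s : Fin d → ℝ → ℝ := fun i u => (1 - γ) * u + γ * otMap (projMeasure σ (basisVec P i))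
        (projMeasure μ (basisVec P i)) u with hs
  have hsm : ∀ i, Measurable (s i) := fun i => by
    have := measurable_otMap (projMeasure σ (basisVec P i)) (projMeasure μ (basisVec P i))
    simp only [hs]; fun_prop
  have hm : Measurable fun (x : Fin d → ℝ) i => s i (x i) :=
    measurable_pi_lambda _ fun i => (hsm i).comp (measurable_pi_apply i)
  have key : (σ.map (orthoCoord P)).map (fun x i => s i (x i)) ≪ volume := by
    refine map_pi_absolutelyContinuous (map_orthoCoord_absolutelyContinuous hσ P) hsm fun i => ?_
    rw [← projMeasure_basisVec_eq]
    exact map_interp_otMap_absolutelyContinuous (projMeasure_absolutelyContinuous hσ P i)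
      (projMeasure_absolutelyContinuous hμ P i) h0 h1
  have key2 := key.map hoc
  rw [(measurePreserving_ofOrthoCoord P).map_eq, Measure.map_map hm hc,
    Measure.map_map hoc (hm.comp hc)] at key2
  have heq : (fun x => (1 - γ) • x + γ • sliceMap μ σ P x) =
      ofOrthoCoord P ∘ (fun x i => s i (x i)) ∘ orthoCoord P :=
    funext fun x => interp_sliceMap_eq μ σ P γ x
  rw [heq]
  exact key2

end Coordinates

/-! ### Square-integrability of the slice-matching map -/

section SliceMap

variable {d : ℕ} {μ σ : Measure (Euc d)}

theorem memLp_projMeasure {ν : Measure (Euc d)} (hν : MemLp (fun x => x) 2 ν) (θ : Euc d) :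
    MemLp (fun u => u) 2 (projMeasure ν θ) :=
  (memLp_map_id (by fun_prop)).2 (hν.inner_const θ)

theorem inner_basisVec_sliceMap (P : OrthoGroup d) (i : Fin d) (x : Euc d) :
    ⟪basisVec P i, sliceMap μ σ P x⟫ = otMap (projMeasure σ (basisVec P i))
      (projMeasure μ (basisVec P i)) ⟪basisVec P i, x⟫ :=
  inner_basisVec_sum P _ i

theorem map_otMap_inner [IsProbabilityMeasure μ] [IsProbabilityMeasure σ] (hσ : σ ≪ volume)
    (P : OrthoGroup d) (i : Fin d) :
    σ.map (fun x => ⟪basisVec P i, sliceMap μ σ P x⟫) = projMeasure μ (basisVec P i) := by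
  have := nullSingletonClass_projMeasure hσ P i
  have := isProbabilityMeasure_projMeasure σ (basisVec P i)
  have := isProbabilityMeasure_projMeasure μ (basisVec P i)
  simp_rw [inner_basisVec_sliceMap]
  conv_rhs => rw [← map_otMap (projMeasure σ (basisVec P i)) (projMeasure μ (basisVec P i))]
  conv_rhs => arg 2; rw [projMeasure]
  rw [Measure.map_map (measurable_otMap _ _) (by fun_prop)]
  simp only [Function.comp_def, real_inner_comm]

theorem memLp_sliceMap (hμ : IsP2 μ) [IsProbabilityMeasure σ] (hσ : σ ≪ volume)
    (P : OrthoGroup d) : MemLp (sliceMap μ σ P) 2 σ := by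
  have := hμ.isProbabilityMeasure
  have hT := measurable_sliceMap_apply μ σ P
  have h1 : ∀ i, MemLp (fun x => ⟪basisVec P i, sliceMap μ σ P x⟫) 2 σ := fun i =>
    memLp_of_map_eq (by fun_prop) (map_otMap_inner hσ P i) (memLp_projMeasure hμ.memLp _)
  refine (memLp_two_iff_integrable_sq_norm hT.aestronglyMeasurable).2 ?_
  simp_rw [← sum_inner_basisVec_sq P]
  exact integrable_finsetSum _ fun i _ => (h1 i).integrable_sq

theorem integral_norm_sq_eq_sum {Y : Type*} [MeasurableSpace Y] {m : Measure Y} {f : Y → Euc d}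
    (hf : MemLp f 2 m) (P : OrthoGroup d) :
    ∫ y, ‖f y‖ ^ 2 ∂m = ∑ i, ∫ y, ⟪basisVec P i, f y⟫ ^ 2 ∂m := by
  simp_rw [← sum_inner_basisVec_sq P]
  exact integral_finsetSum _ fun i _ => (hf.const_inner (basisVec P i)).integrable_sq

theorem secondMoment_eq_sum {ν : Measure (Euc d)} (hν : IsP2 ν) (P : OrthoGroup d) :
    secondMoment ν = ∑ i, ∫ u, u ^ 2 ∂(projMeasure ν (basisVec P i)) := by
  rw [secondMoment, integral_norm_sq_eq_sum hν.memLp P]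
  refine Finset.sum_congr rfl fun i _ => ?_
  rw [projMeasure, integral_map (by fun_prop) (by fun_prop)]
  simp_rw [real_inner_comm]

/-- The map matches the marginals of μ along the basis, and these determine the second moment, even
though the image of σ need not be μ. -/
theorem integral_norm_sliceMap_sq (hμ : IsP2 μ) [IsProbabilityMeasure σ] (hσ : σ ≪ volume)
    (P : OrthoGroup d) : ∫ x, ‖sliceMap μ σ P x‖ ^ 2 ∂σ = secondMoment μ := by
  have := hμ.isProbabilityMeasure
  have hT := measurable_sliceMap_apply μ σ P
  rw [integral_norm_sq_eq_sum (memLp_sliceMap hμ hσ P) P, secondMoment_eq_sum hμ P]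
  refine Finset.sum_congr rfl fun i _ => ?_
  rw [← map_otMap_inner hσ P i, integral_map (by fun_prop) (by fun_prop)]

/-- In each direction the one-dimensional map is optimal, and Pythagoras in the orthonormal basis
adds up the costs. -/
theorem sliceCost_eq (hμ : IsP2 μ) (hσ : IsP2ac σ) (P : OrthoGroup d) :
    sliceCost μ σ P = ENNReal.ofReal (∫ x, ‖x - sliceMap μ σ P x‖ ^ 2 ∂σ) := by
  have := hμ.isProbabilityMeasure
  have := hσ.isProbabilityMeasure
  have hac := hσ.absolutelyContinuous
  have hT := measurable_sliceMap_apply μ σ P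
  have hL : MemLp (fun x => x - sliceMap μ σ P x) 2 σ := hσ.toIsP2.memLp.sub (memLp_sliceMap hμ hac P)
  rw [integral_norm_sq_eq_sum hL P, ENNReal.ofReal_sum_of_nonneg
    fun i _ => integral_nonneg fun x => sq_nonneg _, sliceCost]
  refine Finset.sum_congr rfl fun i _ => ?_
  have := nullSingletonClass_projMeasure hac P i
  have := isProbabilityMeasure_projMeasure σ (basisVec P i)
  have := isProbabilityMeasure_projMeasure μ (basisVec P i)
  rw [wassersteinSq_eq_lintegral_otMap]
  conv_lhs => arg 1; rw [projMeasure]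
  have hmt := measurable_otMap (projMeasure σ (basisVec P i)) (projMeasure μ (basisVec P i))
  rw [lintegral_map (by fun_prop) (by fun_prop)]
  have hL2 : MemLp (fun x => ⟪x, basisVec P i⟫ - otMap (projMeasure σ (basisVec P i))
      (projMeasure μ (basisVec P i)) ⟪x, basisVec P i⟫) 2 σ := by
    refine (hL.const_inner (basisVec P i)).ae_eq (Eventually.of_forall fun x => ?_)
    simp only [inner_sub_right, inner_basisVec_sliceMap, real_inner_comm]
  have h5 := lintegral_edist_sq_eq hL2
  simp only at h5 ⊢
  rw [h5]
  congr 2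
  funext x
  rw [inner_sub_right, inner_basisVec_sliceMap, Real.norm_eq_abs, sq_abs,
    real_inner_comm x (basisVec P i)]

theorem isP2ac_step (hμ : IsP2ac μ) (hσ : IsP2ac σ) (P : OrthoGroup d) {γ : ℝ} (h0 : 0 ≤ γ)
    (h1 : γ ≤ 1) : IsP2ac (σ.map fun x => (1 - γ) • x + γ • sliceMap μ σ P x) := by
  have := hμ.isProbabilityMeasure
  have := hσ.isProbabilityMeasure
  have hT := measurable_sliceMap_apply μ σ P
  have hS : Measurable fun x => (1 - γ) • x + γ • sliceMap μ σ P x := by fun_prop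
  have hL : MemLp (fun x => (1 - γ) • x + γ • sliceMap μ σ P x) 2 σ :=
    (hσ.toIsP2.memLp.const_smul (1 - γ)).add
      ((memLp_sliceMap hμ.toIsP2 hσ.absolutelyContinuous P).const_smul γ)
  exact ⟨isP2_of_memLp (Measure.isProbabilityMeasure_map hS.aemeasurable)
    ((memLp_map_id hS.aemeasurable).2 hL),
    map_interp_sliceMap_absolutelyContinuous hμ.absolutelyContinuous hσ.absolutelyContinuous P
      h0 h1⟩

end SliceMap

/-! ### Expansion of the slice cost along a coupling -/

section Expansion

variable {d : ℕ} {μ σ ν : Measure (Euc d)} {π : Measure (Euc d × Euc d)}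

theorem IsTransportPlan.isProbabilityMeasure_of_isP2 (h : IsTransportPlan π σ ν) (hσ : IsP2 σ) :
    IsProbabilityMeasure π := by
  have := hσ.isProbabilityMeasure
  exact h.isProbabilityMeasure

theorem memLp_comp_fst (h : IsTransportPlan π σ ν) {f : Euc d → Euc d} (hf : MemLp f 2 σ) :
    MemLp (fun p : Euc d × Euc d => f p.1) 2 π := by
  rw [← h.map_fst] at hf
  exact hf.comp_of_map measurable_fst.aemeasurable

theorem integral_comp_fst (h : IsTransportPlan π σ ν) {f : Euc d → ℝ}
    (hf : AEStronglyMeasurable f σ) : ∫ p, f p.1 ∂π = ∫ x, f x ∂σ := by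
  rw [← h.map_fst] at hf ⊢
  rw [integral_map measurable_fst.aemeasurable hf]

/-- For (x, y) drawn from π, the pair (y, T(x)) projects in each direction of P to a coupling of the
marginals of ν and μ, in general not an optimal one. -/
theorem sliceCost_le (hμ : IsP2 μ) (hσ : IsP2ac σ) (hν : IsP2 ν) (h : IsTransportPlan π σ ν)
    (P : OrthoGroup d) :
    sliceCost μ ν P ≤ ENNReal.ofReal (∫ p, ‖p.2 - sliceMap μ σ P p.1‖ ^ 2 ∂π) := by
  have := hμ.isProbabilityMeasure
  have := hσ.isProbabilityMeasure
  have hT := measurable_sliceMap_apply μ σ P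
  have hTL : MemLp (fun p : Euc d × Euc d => sliceMap μ σ P p.1) 2 π :=
    memLp_comp_fst h (memLp_sliceMap hμ hσ.absolutelyContinuous P)
  have hL : MemLp (fun p : Euc d × Euc d => p.2 - sliceMap μ σ P p.1) 2 π :=
    (h.memLp_snd hν.memLp).sub hTL
  rw [integral_norm_sq_eq_sum hL P, ENNReal.ofReal_sum_of_nonneg
    fun i _ => integral_nonneg fun x => sq_nonneg _, sliceCost]
  refine Finset.sum_le_sum fun i _ => ?_
  have hm : Measurable fun p : Euc d × Euc d =>
      (⟪p.2, basisVec P i⟫, ⟪basisVec P i, sliceMap μ σ P p.1⟫) := by fun_prop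
  have hpl : IsTransportPlan (π.map fun p =>
      (⟪p.2, basisVec P i⟫, ⟪basisVec P i, sliceMap μ σ P p.1⟫))
      (projMeasure ν (basisVec P i)) (projMeasure μ (basisVec P i)) := by
    constructor
    · rw [Measure.map_map measurable_fst hm, projMeasure, ← h.map_snd,
        Measure.map_map (by fun_prop) measurable_snd]
      rfl
    · rw [Measure.map_map measurable_snd hm, ← map_otMap_inner hσ.absolutelyContinuous P i]
      have hf : Measurable fun x => ⟪basisVec P i, sliceMap μ σ P x⟫ := by fun_prop
      have hmm := Measure.map_map (μ := π) hf measurable_fst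
      rw [h.map_fst] at hmm
      exact hmm.symm
  refine (wassersteinSq_le_transportCost hpl).trans_eq ?_
  rw [transportCost, lintegral_map (by fun_prop) hm]
  have hL2 : MemLp (fun p : Euc d × Euc d =>
      ⟪p.2, basisVec P i⟫ - ⟪basisVec P i, sliceMap μ σ P p.1⟫) 2 π := by
    refine (hL.const_inner (basisVec P i)).ae_eq (Eventually.of_forall fun x => ?_)
    simp only [inner_sub_right, real_inner_comm]
  rw [lintegral_edist_sq_eq hL2]
  congr 2
  funext p
  rw [inner_sub_right, Real.norm_eq_abs, sq_abs, real_inner_comm p.2 (basisVec P i)]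

/-- The correlation between the displacement of the slice-matching map and the displacement of a
coupling. -/
noncomputable def sliceCorr (μ σ : Measure (Euc d)) (π : Measure (Euc d × Euc d))
    (P : OrthoGroup d) : ℝ :=
  ∫ p, ⟪p.1 - sliceMap μ σ P p.1, p.2 - p.1⟫ ∂π

/-- The remainder in the first-order expansion of the slice cost along a coupling. -/
noncomputable def sliceRem (μ σ : Measure (Euc d)) (π : Measure (Euc d × Euc d))
    (P : OrthoGroup d) : ℝ :=
  (sliceCost μ σ P).toReal + 2 * sliceCorr μ σ π P + ∫ p, ‖p.1 - p.2‖ ^ 2 ∂π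
    - (sliceCost μ (π.map Prod.snd) P).toReal

/-- Expand the square in `sliceCost_le` around x. As π is an arbitrary coupling, this yields both
the upper half of the expansion of F and the descent inequality. -/
theorem sliceRem_nonneg (hμ : IsP2 μ) (hσ : IsP2ac σ) (hν : IsP2 ν) (h : IsTransportPlan π σ ν)
    (P : OrthoGroup d) : 0 ≤ sliceRem μ σ π P := by
  have := hμ.isProbabilityMeasure
  have := hσ.isProbabilityMeasure
  have hT := measurable_sliceMap_apply μ σ P
  have hL : MemLp (fun x => x - sliceMap μ σ P x) 2 σ :=
    hσ.toIsP2.memLp.sub (memLp_sliceMap hμ hσ.absolutelyContinuous P)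
  have hL1 : MemLp (fun p : Euc d × Euc d => p.1 - sliceMap μ σ P p.1) 2 π := memLp_comp_fst h hL
  have hL2 : MemLp (fun p : Euc d × Euc d => p.2 - p.1) 2 π :=
    (h.memLp_snd hν.memLp).sub (h.memLp_fst hσ.toIsP2.memLp)
  have h1 := ENNReal.toReal_le_of_le_ofReal (integral_nonneg fun x => by positivity)
    (sliceCost_le hμ hσ hν h P)
  rw [sliceRem, sliceCost_eq hμ hσ,
    ENNReal.toReal_ofReal (integral_nonneg fun x => by positivity), h.map_snd,
    ← integral_comp_fst h (by fun_prop), sliceCorr]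
  have i1 := hL1.integrable_norm_sq
  have i2 := integrable_inner_of_memLp hL1 hL2
  have i3 := hL2.integrable_norm_sq
  have j1 : Integrable (fun p : Euc d × Euc d => ‖p.1 - sliceMap μ σ P p.1‖ ^ 2
    + 2 * ⟪p.1 - sliceMap μ σ P p.1, p.2 - p.1⟫) π := i1.add (i2.const_mul 2)
  simp_rw [norm_sub_rev (_ : Euc d × Euc d).1 (_ : Euc d × Euc d).2]
  have hexp : ∫ p, ‖p.2 - sliceMap μ σ P p.1‖ ^ 2 ∂π = ∫ p, ‖p.1 - sliceMap μ σ P p.1‖ ^ 2 ∂π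
      + 2 * ∫ p, ⟪p.1 - sliceMap μ σ P p.1, p.2 - p.1⟫ ∂π + ∫ p, ‖p.2 - p.1‖ ^ 2 ∂π := by
    rw [← integral_const_mul, ← integral_add i1 (i2.const_mul 2), ← integral_add j1 i3]
    refine integral_congr_ae (Eventually.of_forall fun p => ?_)
    simp only
    rw [← norm_add_sq_real]
    congr 2; abel
  linarith

/-- The projection of a coupling on a direction. -/
theorem isTransportPlan_proj (h : IsTransportPlan π σ ν) (θ : Euc d) :
    IsTransportPlan (π.map fun p => (⟪p.1, θ⟫, ⟪p.2, θ⟫)) (projMeasure σ θ) (projMeasure ν θ) where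
  map_fst := by
    rw [Measure.map_map measurable_fst (by fun_prop), projMeasure, ← h.map_fst,
      Measure.map_map (by fun_prop) measurable_fst]
    rfl
  map_snd := by
    rw [Measure.map_map measurable_snd (by fun_prop), projMeasure, ← h.map_snd,
      Measure.map_map (by fun_prop) measurable_snd]
    rfl

theorem integral_proj_sq_le (hσ : IsP2 σ) (hν : IsP2 ν) (h : IsTransportPlan π σ ν)
    {θ : Euc d} (hθ : ‖θ‖ = 1) :
    ∫ q, ‖q.1 - q.2‖ ^ 2 ∂(π.map fun p => (⟪p.1, θ⟫, ⟪p.2, θ⟫)) ≤ ∫ p, ‖p.1 - p.2‖ ^ 2 ∂π := by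
  rw [integral_map (by fun_prop) (by fun_prop)]
  refine integral_mono_of_nonneg (Eventually.of_forall fun p => by positivity)
    (h.memLp_sub hσ.memLp hν.memLp).integrable_norm_sq (Eventually.of_forall fun p => ?_)
  simp only
  gcongr
  rw [← inner_sub_left]
  refine (norm_inner_le_norm _ _).trans ?_
  rw [hθ, mul_one]

theorem wassersteinSq_proj_ge (hμ : IsP2 μ) (hσ : IsP2ac σ) (hν : IsP2 ν)
    (h : IsTransportPlan π σ ν) (P : OrthoGroup d) (i : Fin d) {e : ℝ}
    (he : ∀ Γ : Measure ((ℝ × ℝ) × ℝ),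
      Γ.map Prod.fst = π.map (fun p => (⟪p.1, basisVec P i⟫, ⟪p.2, basisVec P i⟫)) →
      Γ.map (fun w => (w.1.2, w.2)) =
        unifUnit.map (fun p => (quantile (projMeasure ν (basisVec P i)) p, p)) →
      √(∫ w, (otMap (projMeasure σ (basisVec P i)) (projMeasure μ (basisVec P i)) w.1.1
        - quantile (projMeasure μ (basisVec P i)) w.2) ^ 2 ∂Γ) ≤ e) :
    (wassersteinSq (projMeasure σ (basisVec P i)) (projMeasure μ (basisVec P i))).toReal
      + 2 * ∫ p, ⟪basisVec P i, p.1 - sliceMap μ σ P p.1⟫ * ⟪basisVec P i, p.2 - p.1⟫ ∂π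
      - 2 * (e * √(∫ p, ‖p.1 - p.2‖ ^ 2 ∂π)) ≤
      (wassersteinSq (projMeasure ν (basisVec P i)) (projMeasure μ (basisVec P i))).toReal := by
  have := hμ.isProbabilityMeasure
  have := hσ.isProbabilityMeasure
  have := hν.isProbabilityMeasure
  have := nullSingletonClass_projMeasure hσ.absolutelyContinuous P i
  have := isProbabilityMeasure_projMeasure σ (basisVec P i)
  have := isProbabilityMeasure_projMeasure μ (basisVec P i)
  have := isProbabilityMeasure_projMeasure ν (basisVec P i)
  have hpl := isTransportPlan_proj h (basisVec P i)
  obtain ⟨Γ, -, h1, h2⟩ := exists_quantile_gluing hpl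
  have hge := wassersteinSq_ge_of_gluing (memLp_projMeasure hσ.toIsP2.memLp _)
    (memLp_projMeasure hμ.memLp (basisVec P i)) (memLp_projMeasure hν.memLp _) hpl h1 h2
  have h3 := mul_le_mul (he Γ h1 h2)
    (Real.sqrt_le_sqrt (integral_proj_sq_le hσ.toIsP2 hν h (norm_basisVec P i)))
    (Real.sqrt_nonneg _) ((Real.sqrt_nonneg _).trans (he Γ h1 h2))
  have hmt := measurable_otMap (projMeasure σ (basisVec P i)) (projMeasure μ (basisVec P i))
  have h4 : ∫ q, (q.1 - otMap (projMeasure σ (basisVec P i)) (projMeasure μ (basisVec P i)) q.1)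
        * (q.2 - q.1) ∂(π.map fun p => (⟪p.1, basisVec P i⟫, ⟪p.2, basisVec P i⟫)) =
      ∫ p, ⟪basisVec P i, p.1 - sliceMap μ σ P p.1⟫ * ⟪basisVec P i, p.2 - p.1⟫ ∂π := by
    rw [integral_map (by fun_prop) (Measurable.aestronglyMeasurable (by fun_prop))]
    refine integral_congr_ae (Eventually.of_forall fun p => ?_)
    simp only [inner_sub_right, inner_basisVec_sliceMap, real_inner_comm]
  rw [h4] at hge
  linarith

/-- The bound `e` on the L² error is left abstract because it is needed twice: as a constant uniform
in P, for domination, and as a small number for fixed P. -/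
theorem sliceRem_le (hμ : IsP2 μ) (hσ : IsP2ac σ) (hν : IsP2 ν) (h : IsTransportPlan π σ ν)
    (P : OrthoGroup d) {e : ℝ}
    (he : ∀ i, ∀ Γ : Measure ((ℝ × ℝ) × ℝ),
      Γ.map Prod.fst = π.map (fun p => (⟪p.1, basisVec P i⟫, ⟪p.2, basisVec P i⟫)) →
      Γ.map (fun w => (w.1.2, w.2)) =
        unifUnit.map (fun p => (quantile (projMeasure ν (basisVec P i)) p, p)) →
      √(∫ w, (otMap (projMeasure σ (basisVec P i)) (projMeasure μ (basisVec P i)) w.1.1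
        - quantile (projMeasure μ (basisVec P i)) w.2) ^ 2 ∂Γ) ≤ e) :
    sliceRem μ σ π P ≤ ∫ p, ‖p.1 - p.2‖ ^ 2 ∂π + 2 * d * e * √(∫ p, ‖p.1 - p.2‖ ^ 2 ∂π) := by
  have := hμ.isProbabilityMeasure
  have := hσ.isProbabilityMeasure
  have := hν.isProbabilityMeasure
  have hfin : ∀ {ρ : Measure (Euc d)}, IsP2 ρ → ∀ i,
      wassersteinSq (projMeasure ρ (basisVec P i)) (projMeasure μ (basisVec P i)) ≠ ∞ := by
    intro ρ hρ i
    have := hρ.isProbabilityMeasure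
    have := isProbabilityMeasure_projMeasure ρ (basisVec P i)
    have := isProbabilityMeasure_projMeasure μ (basisVec P i)
    exact wassersteinSq_ne_top (memLp_projMeasure hρ.memLp _) (memLp_projMeasure hμ.memLp _)
  have hT := measurable_sliceMap_apply μ σ P
  have hL : MemLp (fun x => x - sliceMap μ σ P x) 2 σ :=
    hσ.toIsP2.memLp.sub (memLp_sliceMap hμ hσ.absolutelyContinuous P)
  have hL1 : MemLp (fun p : Euc d × Euc d => p.1 - sliceMap μ σ P p.1) 2 π := memLp_comp_fst h hL
  have hL2 : MemLp (fun p : Euc d × Euc d => p.2 - p.1) 2 π :=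
    (h.memLp_snd hν.memLp).sub (h.memLp_fst hσ.toIsP2.memLp)
  have hsum := Finset.sum_le_sum fun i (_ : i ∈ Finset.univ) =>
    wassersteinSq_proj_ge hμ hσ hν h P i (he i)
  have hcorr : sliceCorr μ σ π P =
      ∑ i, ∫ p, ⟪basisVec P i, p.1 - sliceMap μ σ P p.1⟫ * ⟪basisVec P i, p.2 - p.1⟫ ∂π := by
    have hfun : (fun p : Euc d × Euc d => ⟪p.1 - sliceMap μ σ P p.1, p.2 - p.1⟫) = fun p =>
        ∑ i, ⟪basisVec P i, p.1 - sliceMap μ σ P p.1⟫ * ⟪basisVec P i, p.2 - p.1⟫ :=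
      funext fun p => inner_eq_sum_basisVec P _ _
    rw [sliceCorr, hfun]
    exact integral_finsetSum _ fun i _ =>
      (hL1.const_inner (basisVec P i)).integrable_mul (hL2.const_inner (basisVec P i))
  simp only [Finset.sum_sub_distrib, Finset.sum_add_distrib, Finset.sum_const, Finset.card_univ,
    Fintype.card_fin, nsmul_eq_mul, ← Finset.mul_sum] at hsum
  rw [sliceRem, h.map_snd, sliceCost, sliceCost, ENNReal.toReal_sum fun i _ => hfin hσ.toIsP2 i,
    ENNReal.toReal_sum fun i _ => hfin hν i, hcorr]
  linarith

theorem sliceRem_le_const (hμ : IsP2 μ) (hσ : IsP2ac σ) (hν : IsP2 ν)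
    (h : IsTransportPlan π σ ν) (P : OrthoGroup d) :
    sliceRem μ σ π P ≤ ∫ p, ‖p.1 - p.2‖ ^ 2 ∂π +
      2 * d * √(4 * secondMoment μ) * √(∫ p, ‖p.1 - p.2‖ ^ 2 ∂π) := by
  refine sliceRem_le hμ hσ hν h P fun i Γ h1 h2 => Real.sqrt_le_sqrt ?_
  have := hμ.isProbabilityMeasure
  have := hσ.isProbabilityMeasure
  have := hν.isProbabilityMeasure
  have := nullSingletonClass_projMeasure hσ.absolutelyContinuous P i
  have := isProbabilityMeasure_projMeasure σ (basisVec P i)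
  have := isProbabilityMeasure_projMeasure μ (basisVec P i)
  have := isProbabilityMeasure_projMeasure ν (basisVec P i)
  refine (integral_sq_otMap_sub_le (memLp_projMeasure hμ.memLp _)
    (isTransportPlan_proj h (basisVec P i)) h1 h2).trans ?_
  rw [secondMoment_eq_sum hμ P]
  gcongr
  simp only [Real.norm_eq_abs, sq_abs]
  exact Finset.single_le_sum (f := fun i => ∫ u, u ^ 2 ∂(projMeasure μ (basisVec P i)))
    (fun j _ => integral_nonneg fun u => sq_nonneg _) (Finset.mem_univ i)

/-- The threshold depends on P through the modulus of continuity of the marginals of σ. No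
uniformity in P is claimed, hence the later appeal to dominated convergence. -/
theorem exists_sliceRem_le (hμ : IsP2 μ) (hσ : IsP2ac σ) (P : OrthoGroup d) {ε : ℝ} (hε : 0 < ε) :
    ∃ δ > 0, ∀ (ν : Measure (Euc d)) (π : Measure (Euc d × Euc d)), IsP2 ν →
      IsTransportPlan π σ ν → ∫ p, ‖p.1 - p.2‖ ^ 2 ∂π < δ →
      sliceRem μ σ π P ≤ ∫ p, ‖p.1 - p.2‖ ^ 2 ∂π + 2 * d * ε * √(∫ p, ‖p.1 - p.2‖ ^ 2 ∂π) := by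
  have := hμ.isProbabilityMeasure
  have := hσ.isProbabilityMeasure
  have hna := nullSingletonClass_projMeasure hσ.absolutelyContinuous P
  have hps := fun i => isProbabilityMeasure_projMeasure σ (basisVec P i)
  have hpm := fun i => isProbabilityMeasure_projMeasure μ (basisVec P i)
  choose δ hδ hδ' using fun i => exists_integral_sq_otMap_sub_lt
    (projMeasure_absolutelyContinuous hσ.absolutelyContinuous P i)
    (memLp_projMeasure hμ.memLp (basisVec P i)) (sq_pos_of_pos hε)
  -- The smallest of finitely many thresholds; in dimension zero there are none and any positive
  -- value serves.
  obtain ⟨r, hr0, hr⟩ : ∃ r > 0, ∀ i, r ≤ δ i := by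
    rcases isEmpty_or_nonempty (Fin d) with hd | hd
    · exact ⟨1, one_pos, fun i => hd.elim i⟩
    · exact ⟨Finset.univ.inf' Finset.univ_nonempty δ,
        (Finset.lt_inf'_iff _).2 fun i _ => hδ i, fun i => Finset.inf'_le _ (Finset.mem_univ i)⟩
  refine ⟨r, hr0, fun ν π hν h hc => sliceRem_le hμ hσ hν h P fun i Γ h1 h2 => ?_⟩
  have := hν.isProbabilityMeasure
  have := isProbabilityMeasure_projMeasure ν (basisVec P i)
  have hpl := isTransportPlan_proj h (basisVec P i)
  refine (Real.sqrt_le_left hε.le).2 (hδ' i _ _ Γ hpl (hpl.memLp_sub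
    (memLp_projMeasure hσ.toIsP2.memLp _) (memLp_projMeasure hν.memLp _)) ?_ h1 h2)
  exact (integral_proj_sq_le hσ.toIsP2 hν h (norm_basisVec P i)).trans_lt (hc.trans_le (hr i))

end Expansion

/-! ### First-order expansion of the objective -/

/-- Use the product coupling and (u - v)² ≤ 2u² + 2v². -/
theorem toReal_wassersteinSq_le_moments {α β : Measure ℝ} [IsProbabilityMeasure α]
    [IsProbabilityMeasure β] (hα : MemLp (fun x => x) 2 α) (hβ : MemLp (fun x => x) 2 β) :
    (wassersteinSq α β).toReal ≤ 2 * ∫ u, u ^ 2 ∂α + 2 * ∫ u, u ^ 2 ∂β := by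
  have h : IsTransportPlan (α.prod β) α β := ⟨by simp, by simp⟩
  refine (toReal_wassersteinSq_le h hα hβ).trans ?_
  have h1 := (h.memLp_fst hα).integrable_norm_sq.const_mul 2
  have h2 := (h.memLp_snd hβ).integrable_norm_sq.const_mul 2
  have e1 : ∫ p, ‖p.1‖ ^ 2 ∂(α.prod β) = ∫ u, u ^ 2 ∂α := by
    conv_rhs => rw [← h.map_fst]
    rw [integral_map (by fun_prop) (by fun_prop)]
    simp [Real.norm_eq_abs, sq_abs]
  have e2 : ∫ p, ‖p.2‖ ^ 2 ∂(α.prod β) = ∫ u, u ^ 2 ∂β := by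
    conv_rhs => rw [← h.map_snd]
    rw [integral_map (by fun_prop) (by fun_prop)]
    simp [Real.norm_eq_abs, sq_abs]
  rw [← e1, ← e2, ← integral_const_mul, ← integral_const_mul, ← integral_add h1 h2]
  refine integral_mono_of_nonneg (Eventually.of_forall fun p => by positivity) (h1.add h2)
    (Eventually.of_forall fun p => ?_)
  simp only [Real.norm_eq_abs, sq_abs]
  nlinarith [sq_nonneg (p.1 + p.2)]

section Expansion

variable {d : ℕ} {μ σ ν : Measure (Euc d)} {π : Measure (Euc d × Euc d)}

theorem wassersteinSq_proj_ne_top (hμ : IsP2 μ) (hν : IsP2 ν) (θ : Euc d) :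
    wassersteinSq (projMeasure ν θ) (projMeasure μ θ) ≠ ∞ := by
  have := hμ.isProbabilityMeasure
  have := hν.isProbabilityMeasure
  have := isProbabilityMeasure_projMeasure ν θ
  have := isProbabilityMeasure_projMeasure μ θ
  exact wassersteinSq_ne_top (memLp_projMeasure hν.memLp _) (memLp_projMeasure hμ.memLp _)

theorem sliceCost_ne_top (hμ : IsP2 μ) (hν : IsP2 ν) (P : OrthoGroup d) :
    sliceCost μ ν P ≠ ∞ :=
  ENNReal.sum_ne_top.2 fun i _ => wassersteinSq_proj_ne_top hμ hν (basisVec P i)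

theorem toReal_sliceCost_le (hμ : IsP2 μ) (hν : IsP2 ν) (P : OrthoGroup d) :
    (sliceCost μ ν P).toReal ≤ 2 * (secondMoment ν + secondMoment μ) := by
  have := hμ.isProbabilityMeasure
  have := hν.isProbabilityMeasure
  rw [sliceCost, ENNReal.toReal_sum fun i _ => wassersteinSq_proj_ne_top hμ hν _,
    secondMoment_eq_sum hν P, secondMoment_eq_sum hμ P, mul_add, Finset.mul_sum, Finset.mul_sum,
    ← Finset.sum_add_distrib]
  refine Finset.sum_le_sum fun i _ => ?_
  have := isProbabilityMeasure_projMeasure ν (basisVec P i)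
  have := isProbabilityMeasure_projMeasure μ (basisVec P i)
  exact toReal_wassersteinSq_le_moments (memLp_projMeasure hν.memLp _)
    (memLp_projMeasure hμ.memLp _)

theorem measurable_sliceCost_apply (μ ν : Measure (Euc d)) [IsProbabilityMeasure μ]
    [IsProbabilityMeasure ν] : Measurable (sliceCost μ ν) :=
  measurable_sliceCost (Ω := OrthoGroup d) (κ := fun _ => ν) measurable_const
    (fun _ => inferInstance) μ (P := fun P => P) measurable_id

theorem integrable_sliceCost (hμ : IsP2 μ) (hν : IsP2 ν) :
    Integrable (fun P => (sliceCost μ ν P).toReal) (haarOrtho d) := by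
  have := hμ.isProbabilityMeasure
  have := hν.isProbabilityMeasure
  refine Integrable.of_bound
    (measurable_sliceCost_apply μ ν).ennreal_toReal.aestronglyMeasurable
    (2 * (secondMoment ν + secondMoment μ)) (Eventually.of_forall fun P => ?_)
  rw [Real.norm_of_nonneg ENNReal.toReal_nonneg]
  exact toReal_sliceCost_le hμ hν P

theorem swLoss_eq_integral (hd : 1 ≤ d) (hμ : IsP2 μ) (hν : IsP2 ν) :
    swLoss μ ν = (∫ P, (sliceCost μ ν P).toReal ∂(haarOrtho d)) / 2 := by
  have := hμ.isProbabilityMeasure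
  have := hν.isProbabilityMeasure
  rw [swLoss_eq hd, integral_toReal (measurable_sliceCost_apply μ ν).aemeasurable
    (Eventually.of_forall fun P => (sliceCost_ne_top hμ hν P).lt_top)]

theorem swLoss_le_moments (hd : 1 ≤ d) (hμ : IsP2 μ) (hν : IsP2 ν) :
    swLoss μ ν ≤ secondMoment ν + secondMoment μ := by
  rw [swLoss_eq_integral hd hμ hν]
  have h := integral_mono (integrable_sliceCost hμ hν)
    (integrable_const (2 * (secondMoment ν + secondMoment μ))) (toReal_sliceCost_le hμ hν)
  rw [integral_const, probReal_univ, one_smul] at h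
  linarith

theorem swLoss_nonneg (μ ν : Measure (Euc d)) : 0 ≤ swLoss μ ν := by
  unfold swLoss; positivity

/-- The candidate gradient `x ↦ x - 𝔼[T_{σ,P}(x)]`. -/
noncomputable def swGrad (μ σ : Measure (Euc d)) (x : Euc d) : Euc d :=
  x - ∫ P, sliceMap μ σ P x ∂(haarOrtho d)

/-- The slice-matching displacement is square-integrable jointly in the basis and the point. -/
theorem memLp_sliceMap_prod {Y : Type*} [MeasurableSpace Y] {m : Measure Y}
    [IsProbabilityMeasure m] (hμ : IsP2 μ) (hσ : IsP2ac σ) {f : Y → Euc d} (hf : Measurable f)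
    (hmf : m.map f = σ) :
    MemLp (fun z : OrthoGroup d × Y => f z.2 - sliceMap μ σ z.1 (f z.2)) 2
      ((haarOrtho d).prod m) := by
  have := hμ.isProbabilityMeasure
  have := hσ.isProbabilityMeasure
  have hm : Measurable fun z : OrthoGroup d × Y => sliceMap μ σ z.1 (f z.2) :=
    (measurable_sliceMap μ σ).comp (f := fun z : OrthoGroup d × Y => (z.1, f z.2)) (by fun_prop)
  have hL : ∀ P, MemLp (fun y => sliceMap μ σ P (f y)) 2 m := fun P =>
    MemLp.comp_of_map (g := sliceMap μ σ P) (by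
      rw [hmf]; exact memLp_sliceMap hμ hσ.absolutelyContinuous P) hf.aemeasurable
  have h1 : MemLp (fun z : OrthoGroup d × Y => sliceMap μ σ z.1 (f z.2)) 2
      ((haarOrtho d).prod m) := by
    refine (memLp_two_iff_integrable_sq_norm hm.aestronglyMeasurable).2 ?_
    rw [integrable_prod_iff (hm.norm.pow_const 2).aestronglyMeasurable]
    refine ⟨Eventually.of_forall fun P => (hL P).integrable_norm_sq, ?_⟩
    have : ∀ P, ∫ y, ‖‖sliceMap μ σ P (f y)‖ ^ 2‖ ∂m = secondMoment μ := by
      intro P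
      have hT := measurable_sliceMap_apply μ σ P
      have hmap := integral_map (μ := m) hf.aemeasurable (f := fun x => ‖sliceMap μ σ P x‖ ^ 2)
        (by fun_prop)
      rw [hmf, integral_norm_sliceMap_sq hμ hσ.absolutelyContinuous P] at hmap
      rw [hmap]
      simp
    simp_rw [this]
    exact integrable_const _
  have h2 : MemLp f 2 m := memLp_of_map_eq hf.aemeasurable hmf hσ.toIsP2.memLp
  exact (h2.comp_snd _).sub h1

/-- Fubini gives integrability in P only at almost every point; elsewhere the Bochner integral in
`swGrad` may be the default 0. The map f lets the statement serve both on σ and on a coupling with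
first marginal σ. -/
theorem integral_displacement_ae {Y : Type*} [MeasurableSpace Y] {m : Measure Y}
    [IsProbabilityMeasure m] (hμ : IsP2 μ) (hσ : IsP2ac σ) {f : Y → Euc d} (hf : Measurable f)
    (hmf : m.map f = σ) :
    ∀ᵐ y ∂m, Integrable (fun P => f y - sliceMap μ σ P (f y)) (haarOrtho d) ∧
      ∫ P, (f y - sliceMap μ σ P (f y)) ∂(haarOrtho d) = swGrad μ σ (f y) := by
  have h := (memLp_sliceMap_prod hμ hσ hf hmf).integrable one_le_two
  filter_upwards [h.prod_left_ae] with y hy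
  refine ⟨hy, ?_⟩
  have hT : Integrable (fun P => sliceMap μ σ P (f y)) (haarOrtho d) := by
    refine ((integrable_const (f y)).sub hy).congr (Eventually.of_forall fun P => ?_)
    simp
  rw [integral_sub (integrable_const _) hT, integral_const, probReal_univ, one_smul, swGrad]

theorem norm_integral_sq_le {Y E : Type*} [MeasurableSpace Y] {m : Measure Y}
    [IsProbabilityMeasure m] [NormedAddCommGroup E] [NormedSpace ℝ E]
    {f : Y → E} (hf : MemLp f 2 m) : ‖∫ y, f y ∂m‖ ^ 2 ≤ ∫ y, ‖f y‖ ^ 2 ∂m := by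
  have h1 := abs_integral_inner_le hf.norm (memLp_const (1 : ℝ) (μ := m) (p := 2))
  simp only [RCLike.inner_apply, conj_trivial, one_mul, norm_norm, norm_one, one_pow,
    integral_const, probReal_univ, smul_eq_mul, mul_one, Real.sqrt_one] at h1
  have h2 := (norm_integral_le_integral_norm f).trans ((le_abs_self _).trans h1)
  calc ‖∫ y, f y ∂m‖ ^ 2 ≤ √(∫ y, ‖f y‖ ^ 2 ∂m) ^ 2 := by gcongr
    _ = _ := Real.sq_sqrt (integral_nonneg fun y => by positivity)

theorem measurable_swGrad_param {Ω : Type*} [MeasurableSpace Ω] {κ : Ω → Measure (Euc d)}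
    (hκ : Measurable κ) (hp : ∀ ω, IsProbabilityMeasure (κ ω)) (μ : Measure (Euc d))
    [IsProbabilityMeasure μ] : Measurable fun z : Ω × Euc d => swGrad μ (κ z.1) z.2 := by
  have h := measurable_sliceMap_param (Ω := Ω × OrthoGroup d) (κ := fun z => κ z.1)
    (hκ.comp measurable_fst) (fun z => hp z.1) μ (P := fun z => z.2) measurable_snd
  have h2 : Measurable fun w : (Ω × Euc d) × OrthoGroup d =>
      sliceMap μ (κ w.1.1) w.2 w.1.2 :=
    h.comp (f := fun w : (Ω × Euc d) × OrthoGroup d => ((w.1.1, w.2), w.1.2)) (by fun_prop)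
  exact measurable_snd.sub h2.stronglyMeasurable.integral_prod_right'.measurable

theorem measurable_swGrad (μ σ : Measure (Euc d)) [IsProbabilityMeasure μ]
    [IsProbabilityMeasure σ] : Measurable (swGrad μ σ) :=
  (measurable_swGrad_param (Ω := Unit) (κ := fun _ => σ) measurable_const
    (fun _ => inferInstance) μ).comp (f := fun x => ((), x)) (by fun_prop)

/-- Jensen's inequality in P at almost every point, then Fubini and the formula for the slice cost.
-/
theorem swGrad_sq_le (hμ : IsP2 μ) (hσ : IsP2ac σ) :
    MemLp (swGrad μ σ) 2 σ ∧ ∫ x, ‖swGrad μ σ x‖ ^ 2 ∂σ ≤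
      ∫ P, (sliceCost μ σ P).toReal ∂(haarOrtho d) := by
  have := hμ.isProbabilityMeasure
  have := hσ.isProbabilityMeasure
  have hmg := measurable_swGrad μ σ
  have hL := memLp_sliceMap_prod hμ hσ measurable_id (Measure.map_id (μ := σ))
  have hint := hL.integrable_norm_sq
  have hae : ∀ᵐ x ∂σ, ‖swGrad μ σ x‖ ^ 2 ≤ ∫ P, ‖x - sliceMap μ σ P x‖ ^ 2 ∂(haarOrtho d) := by
    filter_upwards [integral_displacement_ae hμ hσ measurable_id (Measure.map_id (μ := σ)),
      hint.prod_left_ae] with x hx hx2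
    have hmem : MemLp (fun P => x - sliceMap μ σ P x) 2 (haarOrtho d) :=
      (memLp_two_iff_integrable_sq_norm hx.1.1).2 hx2
    have hx' := hx.2
    simp only [id] at hx'
    rw [← hx']
    exact norm_integral_sq_le hmem
  have hI : Integrable (fun x => ∫ P, ‖x - sliceMap μ σ P x‖ ^ 2 ∂(haarOrtho d)) σ :=
    hint.integral_prod_right
  have hI2 : Integrable (fun x => ‖swGrad μ σ x‖ ^ 2) σ :=
    hI.mono' (by fun_prop) (by
      filter_upwards [hae] with x hx
      rwa [Real.norm_of_nonneg (by positivity)])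
  refine ⟨(memLp_two_iff_integrable_sq_norm hmg.aestronglyMeasurable).2 hI2,
    (integral_mono_ae hI2 hI hae).trans_eq ?_⟩
  rw [integral_integral_swap (f := fun x P => ‖x - sliceMap μ σ P x‖ ^ 2) hint.swap]
  refine integral_congr_ae (Eventually.of_forall fun P => ?_)
  simp only
  rw [sliceCost_eq hμ hσ, ENNReal.toReal_ofReal (integral_nonneg fun x => by positivity)]

/-- Fubini: averaging correlations with the slice-matching displacement over random bases gives
the correlation with the gradient. -/
theorem integral_inner_displacement {Y : Type*} [MeasurableSpace Y] {m : Measure Y}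
    [IsProbabilityMeasure m] (hμ : IsP2 μ) (hσ : IsP2ac σ) {f k : Y → Euc d} (hf : Measurable f)
    (hmf : m.map f = σ) (hk : MemLp k 2 m) :
    Integrable (fun P => ∫ y, ⟪f y - sliceMap μ σ P (f y), k y⟫ ∂m) (haarOrtho d) ∧
    ∫ P, ∫ y, ⟪f y - sliceMap μ σ P (f y), k y⟫ ∂m ∂(haarOrtho d) =
      ∫ y, ⟪swGrad μ σ (f y), k y⟫ ∂m := by
  have hint := integrable_inner_of_memLp (memLp_sliceMap_prod hμ hσ hf hmf)
    (hk.comp_snd (haarOrtho d))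
  refine ⟨hint.integral_prod_left, ?_⟩
  rw [integral_integral_swap (f := fun P y => ⟪f y - sliceMap μ σ P (f y), k y⟫) hint]
  refine integral_congr_ae ?_
  filter_upwards [integral_displacement_ae hμ hσ hf hmf] with y hy
  rw [← hy.2]
  simp_rw [real_inner_comm (k y)]
  exact integral_inner hy.1 (k y)

theorem sliceCorr_avg (hμ : IsP2 μ) (hσ : IsP2ac σ) (hν : IsP2 ν) (h : IsTransportPlan π σ ν) :
    Integrable (sliceCorr μ σ π) (haarOrtho d) ∧
      ∫ P, sliceCorr μ σ π P ∂(haarOrtho d) = ∫ p, ⟪swGrad μ σ p.1, p.2 - p.1⟫ ∂π := by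
  have := h.isProbabilityMeasure_of_isP2 hσ.toIsP2
  exact integral_inner_displacement hμ hσ measurable_fst h.map_fst
    ((h.memLp_snd hν.memLp).sub (h.memLp_fst hσ.toIsP2.memLp))

theorem integrable_sliceRem (hμ : IsP2 μ) (hσ : IsP2ac σ) (hν : IsP2 ν)
    (h : IsTransportPlan π σ ν) : Integrable (sliceRem μ σ π) (haarOrtho d) := by
  have hc := integrable_sliceCost hμ hν
  rw [← h.map_snd] at hc
  exact (((integrable_sliceCost hμ hσ.toIsP2).add ((sliceCorr_avg hμ hσ hν h).1.const_mul 2)).add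
    (integrable_const _)).sub hc

theorem swLoss_expansion (hd : 1 ≤ d) (hμ : IsP2 μ) (hσ : IsP2ac σ) (hν : IsP2 ν)
    (h : IsTransportPlan π σ ν) :
    swLoss μ ν - swLoss μ σ - ∫ p, ⟪swGrad μ σ p.1, p.2 - p.1⟫ ∂π =
      (∫ p, ‖p.1 - p.2‖ ^ 2 ∂π) / 2 - (∫ P, sliceRem μ σ π P ∂(haarOrtho d)) / 2 := by
  have hc := integrable_sliceCost hμ hν
  obtain ⟨h1, h2⟩ := sliceCorr_avg hμ hσ hν h
  have i0 := integrable_sliceCost hμ hσ.toIsP2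
  have i1 : Integrable (fun P => (sliceCost μ σ P).toReal + 2 * sliceCorr μ σ π P)
    (haarOrtho d) := i0.add (h1.const_mul 2)
  have i2 : Integrable (fun P => (sliceCost μ σ P).toReal + 2 * sliceCorr μ σ π P
    + ∫ p, ‖p.1 - p.2‖ ^ 2 ∂π) (haarOrtho d) := i1.add (integrable_const _)
  have h3 : ∫ P, sliceRem μ σ π P ∂(haarOrtho d) =
      ∫ P, (sliceCost μ σ P).toReal ∂(haarOrtho d)
      + 2 * ∫ p, ⟪swGrad μ σ p.1, p.2 - p.1⟫ ∂π + ∫ p, ‖p.1 - p.2‖ ^ 2 ∂π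
      - ∫ P, (sliceCost μ ν P).toReal ∂(haarOrtho d) := by
    unfold sliceRem
    rw [h.map_snd, integral_sub i2 hc, integral_add i1 (integrable_const _),
      integral_add i0 (h1.const_mul 2), integral_const_mul, h2, integral_const, probReal_univ,
      one_smul]
  rw [swLoss_eq_integral hd hμ hν, swLoss_eq_integral hd hμ hσ.toIsP2, h3]
  ring

/-- The averaged remainder is `o(W)` along couplings of small cost. -/
theorem exists_integral_sliceRem_le (hμ : IsP2 μ) (hσ : IsP2ac σ) {ε : ℝ} (hε : 0 < ε) :
    ∃ δ > 0, ∀ (ν : Measure (Euc d)) (π : Measure (Euc d × Euc d)), IsP2 ν →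
      IsTransportPlan π σ ν → ∫ p, ‖p.1 - p.2‖ ^ 2 ∂π < δ →
      ∫ P, sliceRem μ σ π P ∂(haarOrtho d) ≤ ε * √(∫ p, ‖p.1 - p.2‖ ^ 2 ∂π) := by
  set c : Measure (Euc d × Euc d) → ℝ := fun π => ∫ p, ‖p.1 - p.2‖ ^ 2 ∂π with hc
  have hc0 : ∀ π, 0 ≤ c π := fun π => integral_nonneg fun p => by positivity
  -- The filter of couplings with first marginal σ and cost tending to zero. It is countably
  -- generated, so dominated convergence in P applies along it and turns the P-dependent thresholds
  -- into one.
  set l : Filter (Measure (Euc d × Euc d)) :=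
    comap c (𝓝 0) ⊓ 𝓟 {π | ∃ ν, IsP2 ν ∧ IsTransportPlan π σ ν} with hl
  set C : ℝ := 2 * d * √(4 * secondMoment μ) with hC
  have hC0 : 0 ≤ C := by positivity
  have hev : ∀ δ > 0, ∀ᶠ π in l, c π < δ ∧ ∃ ν, IsP2 ν ∧ IsTransportPlan π σ ν := by
    intro δ hδ
    refine Filter.eventually_inf_principal.2 ?_
    have : ∀ᶠ π in comap c (𝓝 0), c π < δ := tendsto_comap.eventually (gt_mem_nhds hδ)
    filter_upwards [this] with π h1 h2 using ⟨h1, h2⟩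
  have hdiv : ∀ x e : ℝ, 0 ≤ x → 0 ≤ e → ∀ R, R ≤ x + e * √x → R / √x ≤ √x + e := by
    intro x e hx he R hR
    rcases hx.eq_or_lt with rfl | hx
    · simpa using he
    · rw [div_le_iff₀ (Real.sqrt_pos.2 hx), add_mul, Real.mul_self_sqrt hx.le]
      exact hR
  have hlim : Tendsto (fun π => ∫ P, sliceRem μ σ π P / √(c π) ∂(haarOrtho d)) l
      (𝓝 (∫ _P, (0 : ℝ) ∂(haarOrtho d))) := by
    refine tendsto_integral_filter_of_dominated_convergence (fun _ => 1 + C) ?_ ?_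
      (integrable_const _) ?_
    · filter_upwards [hev 1 one_pos] with π hπ
      obtain ⟨-, ν, hν, h⟩ := hπ
      exact ((integrable_sliceRem hμ hσ hν h).div_const _).aestronglyMeasurable
    · filter_upwards [hev 1 one_pos] with π hπ
      obtain ⟨h1, ν, hν, h⟩ := hπ
      refine Eventually.of_forall fun P => ?_
      rw [Real.norm_of_nonneg (div_nonneg (sliceRem_nonneg hμ hσ hν h P) (Real.sqrt_nonneg _))]
      refine (hdiv _ _ (hc0 π) hC0 _ (sliceRem_le_const hμ hσ hν h P)).trans ?_
      gcongr
      exact Real.sqrt_le_one.2 h1.le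
    · refine Eventually.of_forall fun P => ?_
      rw [Metric.tendsto_nhds]
      intro e he
      -- The factor 2d in the remainder bound then contributes at most e/2, and √cost contributes
      -- the other half.
      have he' : 0 < e / (2 * (2 * d + 1)) := by positivity
      obtain ⟨δ, hδ, hR⟩ := exists_sliceRem_le hμ hσ P he'
      filter_upwards [hev δ hδ, hev ((e / 2) ^ 2) (by positivity)] with π hπ hπ2
      obtain ⟨h1, ν, hν, h⟩ := hπ
      rw [Real.dist_0_eq_abs, abs_of_nonneg
        (div_nonneg (sliceRem_nonneg hμ hσ hν h P) (Real.sqrt_nonneg _))]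
      refine (hdiv _ _ (hc0 π) (by positivity) _ (hR ν π hν h h1)).trans_lt ?_
      have h3 : √(c π) < e / 2 := (Real.sqrt_lt' (by positivity)).2 hπ2.1
      have h4 : 2 * (d : ℝ) * (e / (2 * (2 * d + 1))) ≤ e / 2 := by
        rw [← mul_div_assoc, div_le_div_iff₀ (by positivity) (by positivity)]
        nlinarith
      linarith
  rw [integral_zero] at hlim
  have hlt := hlim.eventually (gt_mem_nhds hε)
  rw [hl, eventually_inf_principal, eventually_comap] at hlt
  obtain ⟨δ, hδ, hball⟩ := Metric.eventually_nhds_iff.1 hlt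
  refine ⟨δ, hδ, fun ν π hν h hcδ => ?_⟩
  have h5 := hball (y := c π) (by rwa [Real.dist_0_eq_abs, abs_of_nonneg (hc0 π)]) π rfl
    ⟨ν, hν, h⟩
  rw [integral_div] at h5
  -- At zero cost the quotient is a division by zero and carries no information; the uniform bound
  -- then gives a nonpositive remainder directly.
  rcases (hc0 π).eq_or_lt with h0 | h0
  · change _ ≤ ε * √(c π)
    rw [← h0, Real.sqrt_zero, mul_zero]
    refine integral_nonpos fun P => ?_
    have := sliceRem_le_const hμ hσ hν h P
    change _ ≤ c π + _ * √(c π) at this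
    rwa [← h0, Real.sqrt_zero, mul_zero, add_zero] at this
  · rw [div_lt_iff₀ (Real.sqrt_pos.2 h0)] at h5
    exact h5.le

theorem IsOptimalPlan.wassersteinDist_eq (h : IsOptimalPlan π σ ν) (hσ : IsP2 σ) (hν : IsP2 ν) :
    wassersteinDist σ ν = √(∫ p, ‖p.1 - p.2‖ ^ 2 ∂π) := by
  rw [wassersteinDist, ← h.cost_eq,
    transportCost_eq_ofReal (h.toIsTransportPlan.memLp_sub hσ.memLp hν.memLp),
    ENNReal.toReal_ofReal (integral_nonneg fun p => by positivity)]

theorem swLoss_isLittleO (hd : 1 ≤ d) (hμ : IsP2 μ) (hσ : IsP2ac σ) {ε : ℝ} (hε : 0 < ε) :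
    ∃ δ : ℝ, 0 < δ ∧ ∀ ν : Measure (Euc d), IsP2 ν →
      wassersteinDist σ ν < δ → ∀ π : Measure (Euc d × Euc d), IsOptimalPlan π σ ν →
        |swLoss μ ν - swLoss μ σ - ∫ p, ⟪swGrad μ σ p.1, p.2 - p.1⟫ ∂π| ≤
          ε * wassersteinDist σ ν := by
  obtain ⟨δ, hδ, hR⟩ := exists_integral_sliceRem_le hμ hσ hε
  -- A distance below √δ means a cost below δ; a distance below ε makes the quadratic term at most ε
  -- times the distance.
  refine ⟨min (√δ) ε, lt_min (Real.sqrt_pos.2 hδ) hε, fun ν hν hW π hπ => ?_⟩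
  have hpl := hπ.toIsTransportPlan
  rw [hπ.wassersteinDist_eq hσ.toIsP2 hν] at hW ⊢
  rw [swLoss_expansion hd hμ hσ hν hpl]
  have hc0 : 0 ≤ ∫ p, ‖p.1 - p.2‖ ^ 2 ∂π := integral_nonneg fun p => by positivity
  have h1 := hR ν π hν hpl ((Real.sqrt_lt_sqrt_iff hc0).1 (hW.trans_le (min_le_left _ _)))
  have h2 : 0 ≤ ∫ P, sliceRem μ σ π P ∂(haarOrtho d) :=
    integral_nonneg fun P => sliceRem_nonneg hμ hσ hν hpl P
  have h3 := hW.le.trans (min_le_right _ _)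
  have h4 := Real.mul_self_sqrt hc0
  have h5 : ∫ p, ‖p.1 - p.2‖ ^ 2 ∂π ≤ ε * √(∫ p, ‖p.1 - p.2‖ ^ 2 ∂π) := by
    conv_lhs => rw [← h4]
    exact mul_le_mul_of_nonneg_right h3 (Real.sqrt_nonneg _)
  exact abs_le.2 ⟨by linarith, by linarith⟩

end Expansion

/-! ### The tangent space -/

section Tangent

variable {d : ℕ}

/-- Smooth compactly supported functions. -/
def IsTestFunction (ψ : Euc d → ℝ) : Prop :=
  ContDiff ℝ ((⊤ : ℕ∞) : WithTop ℕ∞) ψ ∧ HasCompactSupport ψ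

theorem inner_gradient (ψ : Euc d → ℝ) (x v : Euc d) : ⟪∇ ψ x, v⟫ = fderiv ℝ ψ x v := by
  simp [gradient]

theorem IsTestFunction.differentiable {ψ : Euc d → ℝ} (h : IsTestFunction ψ) :
    Differentiable ℝ ψ := h.1.differentiable (by simp)

theorem IsTestFunction.continuous_fderiv {ψ : Euc d → ℝ} (h : IsTestFunction ψ) :
    Continuous (fderiv ℝ ψ) := h.1.continuous_fderiv (by simp)

theorem IsTestFunction.continuous_gradient {ψ : Euc d → ℝ} (h : IsTestFunction ψ) :
    Continuous (∇ ψ) :=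
  (InnerProductSpace.toDual ℝ (Euc d)).symm.continuous.comp h.continuous_fderiv

theorem IsTestFunction.memLp_gradient {ψ : Euc d → ℝ} (h : IsTestFunction ψ)
    (σ : Measure (Euc d)) [IsFiniteMeasure σ] : MemLp (∇ ψ) 2 σ := by
  refine h.continuous_gradient.memLp_of_hasCompactSupport ?_
  exact (h.2.fderiv ℝ).comp_left (g := (InnerProductSpace.toDual ℝ (Euc d)).symm) (map_zero _)

theorem IsTestFunction.gradient_add {ψ φ : Euc d → ℝ} (hψ : IsTestFunction ψ)
    (hφ : IsTestFunction φ) (x : Euc d) : ∇ (ψ + φ) x = ∇ ψ x + ∇ φ x := by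
  simp only [gradient]
  rw [fderiv_add (hψ.differentiable x) (hφ.differentiable x), map_add]

theorem IsTestFunction.gradient_smul {ψ : Euc d → ℝ} (hψ : IsTestFunction ψ) (c : ℝ)
    (x : Euc d) : ∇ (c • ψ) x = c • ∇ ψ x := by
  simp only [gradient]
  rw [fderiv_const_smul (hψ.differentiable x)]
  simp

/-- Gradients of test functions, as a subspace of `L²(σ)`. -/
noncomputable def gradSubmodule (σ : Measure (Euc d)) : Submodule ℝ (Lp (Euc d) 2 σ) where
  carrier := {f | ∃ ψ : Euc d → ℝ, IsTestFunction ψ ∧ f =ᵐ[σ] ∇ ψ}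
  zero_mem' := by
    refine ⟨0, ⟨contDiff_const, HasCompactSupport.zero⟩, ?_⟩
    filter_upwards [Lp.coeFn_zero (Euc d) 2 σ] with x hx
    rw [hx, gradient]
    simp
  add_mem' := by
    rintro f g ⟨ψ, hψ, hf⟩ ⟨φ, hφ, hg⟩
    refine ⟨ψ + φ, ⟨hψ.1.add hφ.1, hψ.2.add hφ.2⟩, ?_⟩
    filter_upwards [Lp.coeFn_add f g, hf, hg] with x hx h1 h2
    rw [hx, Pi.add_apply, h1, h2, hψ.gradient_add hφ]
  smul_mem' := by
    rintro c f ⟨ψ, hψ, hf⟩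
    refine ⟨c • ψ, ⟨contDiff_const.smul hψ.1, hψ.2.smul_left (f := fun _ => c)⟩, ?_⟩
    filter_upwards [Lp.coeFn_smul c f, hf] with x hx h1
    rw [hx, Pi.smul_apply, h1, hψ.gradient_smul]

theorem inTangentSpace_iff {σ : Measure (Euc d)} [IsFiniteMeasure σ] {g : Euc d → Euc d}
    (hg : MemLp g 2 σ) :
    InTangentSpace σ g ↔ hg.toLp g ∈ (gradSubmodule σ).topologicalClosure := by
  rw [← SetLike.mem_coe, Submodule.topologicalClosure_coe, EMetric.mem_closure_iff]
  constructor
  · rintro ⟨-, h⟩ ε hε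
    obtain ⟨ψ, h1, h2, h3⟩ := h ε hε
    have hψ : IsTestFunction ψ := ⟨h1, h2⟩
    have hm := hψ.memLp_gradient σ
    refine ⟨hm.toLp _, ⟨ψ, hψ, hm.coeFn_toLp⟩, ?_⟩
    rw [Lp.edist_toLp_toLp]
    exact h3
  · intro h
    refine ⟨hg, fun ε hε => ?_⟩
    obtain ⟨f, ⟨ψ, hψ, hf⟩, hd⟩ := h ε hε
    refine ⟨ψ, hψ.1, hψ.2, ?_⟩
    have hm := hψ.memLp_gradient σ
    have : f = hm.toLp _ := Lp.ext (hf.trans hm.coeFn_toLp.symm)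
    rw [this, Lp.edist_toLp_toLp] at hd
    exact hd

theorem inner_toLp {Y E : Type*} [MeasurableSpace Y] {m : Measure Y} [NormedAddCommGroup E]
    [InnerProductSpace ℝ E] (f g : Lp E 2 m) {f' g' : Y → E} (hf : f =ᵐ[m] f')
    (hg : g =ᵐ[m] g') : ⟪f, g⟫ = ∫ y, ⟪f' y, g' y⟫ ∂m := by
  rw [L2.inner_def]
  refine integral_congr_ae ?_
  filter_upwards [hf, hg] with y h1 h2
  rw [h1, h2]

/-- A square-integrable field orthogonal to every field orthogonal to gradients is tangent. -/
theorem inTangentSpace_of_orthogonal {σ : Measure (Euc d)} [IsFiniteMeasure σ]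
    {g : Euc d → Euc d} (hg : MemLp g 2 σ)
    (h : ∀ k : Euc d → Euc d, MemLp k 2 σ →
      (∀ ψ, IsTestFunction ψ → ∫ x, ⟪∇ ψ x, k x⟫ ∂σ = 0) → ∫ x, ⟪g x, k x⟫ ∂σ = 0) :
    InTangentSpace σ g := by
  rw [inTangentSpace_iff hg, ← Submodule.orthogonal_orthogonal_eq_closure,
    Submodule.mem_orthogonal']
  intro k hk
  rw [inner_toLp _ _ hg.coeFn_toLp (EventuallyEq.refl _ k)]
  refine h k (Lp.memLp k) fun ψ hψ => ?_
  have hm := hψ.memLp_gradient σ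
  rw [← inner_toLp (hm.toLp _) k hm.coeFn_toLp (EventuallyEq.refl _ _)]
  exact (Submodule.mem_orthogonal _ _).1 hk _ ⟨ψ, hψ, hm.coeFn_toLp⟩

/-- The difference lies both in the closed span of the gradients and in its orthogonal complement.
-/
theorem ae_eq_of_tangent_of_orthogonal {σ : Measure (Euc d)} [IsFiniteMeasure σ]
    {g₁ g₂ : Euc d → Euc d} (h₁ : InTangentSpace σ g₁) (h₂ : InTangentSpace σ g₂)
    (h : ∀ ψ, IsTestFunction ψ → ∫ x, ⟪∇ ψ x, g₁ x - g₂ x⟫ ∂σ = 0) : g₁ =ᵐ[σ] g₂ := by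
  have m₁ := h₁.1
  have m₂ := h₂.1
  have c₁ := (inTangentSpace_iff m₁).1 h₁
  have c₂ := (inTangentSpace_iff m₂).1 h₂
  have hc := Submodule.sub_mem _ c₁ c₂
  have ho : m₁.toLp g₁ - m₂.toLp g₂ ∈ (gradSubmodule σ).topologicalClosureᗮ := by
    rw [Submodule.orthogonal_closure, Submodule.mem_orthogonal]
    rintro f ⟨ψ, hψ, hf⟩
    rw [← MemLp.toLp_sub, inner_toLp _ _ hf (m₁.sub m₂).coeFn_toLp]
    exact h ψ hψ
  have h0 : m₁.toLp g₁ - m₂.toLp g₂ = 0 := by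
    have := (Submodule.mem_inf.2 ⟨hc, ho⟩)
    rwa [Submodule.inf_orthogonal_eq_bot, Submodule.mem_bot] at this
  exact (MemLp.toLp_eq_toLp_iff m₁ m₂).1 (sub_eq_zero.1 h0)

/-! #### Fields depending on one coordinate are tangent -/

/-- Boundedness, by the L¹ norm of f, is what lets the ridge function survive a cut-off in the next
lemma. -/
theorem exists_bounded_antideriv {f : ℝ → ℝ} (hf : ContDiff ℝ ((⊤ : ℕ∞) : WithTop ℕ∞) f)
    (hc : HasCompactSupport f) :
    ∃ φ : ℝ → ℝ, ContDiff ℝ ((⊤ : ℕ∞) : WithTop ℕ∞) φ ∧ (∀ u, HasDerivAt φ (f u) u) ∧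
      ∃ B, ∀ u, |φ u| ≤ B := by
  have hcont := hf.continuous
  have hint : Integrable f := hcont.integrable_of_hasCompactSupport hc
  have hder : ∀ u, HasDerivAt (fun u => ∫ s in (0 : ℝ)..u, f s) (f u) u := fun u =>
    intervalIntegral.integral_hasDerivAt_right (hcont.intervalIntegrable _ _)
      (hcont.stronglyMeasurableAtFilter _ _) hcont.continuousAt
  refine ⟨fun u => ∫ s in (0 : ℝ)..u, f s, ?_, hder, ∫ s, |f s|, fun u => ?_⟩
  · rw [contDiff_infty_iff_deriv]
    refine ⟨fun u => (hder u).differentiableAt, ?_⟩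
    have : deriv (fun u => ∫ s in (0 : ℝ)..u, f s) = f := funext fun u => (hder u).deriv
    rwa [this]
  · refine (intervalIntegral.norm_integral_le_integral_norm_uIoc (f := f)).trans ?_
    exact setIntegral_le_integral hint.norm (Eventually.of_forall fun s => norm_nonneg _)

/-- The field f(⟨θ,x⟩)θ is the gradient of φ(⟨θ,x⟩), which need not have compact support.
Multiplying by the cut-off χ(x/(n+1)) adds a gradient term of size 1/(n+1), since φ and ∇χ are
bounded; dominated convergence removes it. -/
theorem integral_ridge_eq_zero_of_smooth {σ : Measure (Euc d)} [IsProbabilityMeasure σ]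
    {k : Euc d → Euc d} (hk : MemLp k 2 σ)
    (h : ∀ ψ, IsTestFunction ψ → ∫ x, ⟪∇ ψ x, k x⟫ ∂σ = 0) (θ : Euc d) {f : ℝ → ℝ}
    (hf : ContDiff ℝ ((⊤ : ℕ∞) : WithTop ℕ∞) f) (hc : HasCompactSupport f) :
    ∫ x, f ⟪θ, x⟫ * ⟪θ, k x⟫ ∂σ = 0 := by
  obtain ⟨φ, hφ, hφd, B, hB⟩ := exists_bounded_antideriv hf hc
  obtain ⟨M, hM⟩ := hc.exists_bound_of_continuous hf.continuous
  obtain ⟨χ, hχ, hχ0, hχn, hχ1⟩ : ∃ χ : Euc d → ℝ, IsTestFunction χ ∧ χ 0 = 1 ∧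
      (∀ x, 0 ≤ χ x) ∧ ∀ x, χ x ≤ 1 :=
    let χ : ContDiffBump (0 : Euc d) := ⟨1, 2, one_pos, one_lt_two⟩
    ⟨χ, ⟨χ.contDiff, χ.hasCompactSupport⟩,
      χ.one_of_mem_closedBall (Metric.mem_closedBall_self zero_le_one),
      fun _ => χ.nonneg, fun _ => χ.le_one⟩
  obtain ⟨L, hL⟩ := (hχ.2.fderiv ℝ).exists_bound_of_continuous hχ.continuous_fderiv
  set r : ℕ → ℝ := fun n => ((n : ℝ) + 1)⁻¹ with hr
  have hr0 : ∀ n, 0 < r n := fun n => by positivity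
  have hr1 : ∀ n, r n ≤ 1 := fun n => inv_le_one_of_one_le₀ (by linarith [n.cast_nonneg (α := ℝ)])
  have hrt : Tendsto r atTop (𝓝 0) := by
    simpa [hr, one_div] using tendsto_one_div_add_atTop_nhds_zero_nat (𝕜 := ℝ)
  set ψ : ℕ → Euc d → ℝ := fun n x => χ (r n • x) * φ ⟪θ, x⟫ with hψ
  have hψt : ∀ n, IsTestFunction (ψ n) := by
    intro n
    refine ⟨?_, ?_⟩
    · exact (hχ.1.comp (contDiff_const_smul (r n))).mul
        (hφ.comp (contDiff_const.inner ℝ contDiff_id))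
    · refine HasCompactSupport.mul_right ?_
      exact hχ.2.comp_smul (hr0 n).ne'
  have hder : ∀ n x v, fderiv ℝ (ψ n) x v =
      χ (r n • x) * (f ⟪θ, x⟫ * ⟪θ, v⟫) + φ ⟪θ, x⟫ * (r n * fderiv ℝ χ (r n • x) v) := by
    intro n x v
    have h1 : HasFDerivAt (fun x => χ (r n • x))
        ((fderiv ℝ χ (r n • x)).comp (r n • ContinuousLinearMap.id ℝ (Euc d))) x :=
      HasFDerivAt.comp x (hχ.differentiable (r n • x)).hasFDerivAt
        ((hasFDerivAt_id x).const_smul (r n))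
    have h2 : HasFDerivAt (fun x => φ ⟪θ, x⟫) (f ⟪θ, x⟫ • innerSL ℝ θ) x :=
      (hφd ⟪θ, x⟫).comp_hasFDerivAt x (innerSL ℝ θ).hasFDerivAt
    have h3 : HasFDerivAt (ψ n) _ x := h1.mul h2
    rw [h3.fderiv]
    simp
  have hlim : Tendsto (fun n => ∫ x, ⟪∇ (ψ n) x, k x⟫ ∂σ) atTop
      (𝓝 (∫ x, f ⟪θ, x⟫ * ⟪θ, k x⟫ ∂σ)) := by
    refine tendsto_integral_of_dominated_convergence
      (fun x => (M * ‖θ‖ + B * L) * ‖k x‖) ?_ ?_ ?_ ?_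
    · intro n
      exact (integrable_inner_of_memLp ((hψt n).memLp_gradient σ) hk).aestronglyMeasurable
    · exact (hk.integrable one_le_two).norm.const_mul _
    · intro n
      refine Eventually.of_forall fun x => ?_
      rw [inner_gradient, hder, add_mul]
      refine (norm_add_le _ _).trans (add_le_add ?_ ?_)
      · rw [norm_mul, norm_mul, mul_assoc]
        have a1 : ‖χ (r n • x)‖ ≤ 1 := by
          rw [Real.norm_of_nonneg (hχn _)]; exact hχ1 _
        calc ‖χ (r n • x)‖ * (‖f ⟪θ, x⟫‖ * ‖⟪θ, k x⟫‖) ≤ 1 * (M * (‖θ‖ * ‖k x‖)) := by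
              have hM0 := (norm_nonneg _).trans (hM 0)
              gcongr
              · exact hM _
              · exact norm_inner_le_norm _ _
          _ = _ := one_mul _
      · rw [norm_mul, norm_mul, mul_assoc]
        have hB0 := (abs_nonneg _).trans (hB 0)
        have hL0 := (norm_nonneg _).trans (hL 0)
        calc ‖φ ⟪θ, x⟫‖ * (‖r n‖ * ‖fderiv ℝ χ (r n • x) (k x)‖) ≤ B * (1 * (L * ‖k x‖)) := by
              gcongr
              · exact hB _
              · rw [Real.norm_of_nonneg (hr0 n).le]; exact hr1 n
              · exact (ContinuousLinearMap.le_opNorm _ _).trans (by gcongr; exact hL _)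
          _ = _ := by ring
    · refine Eventually.of_forall fun x => ?_
      simp_rw [inner_gradient, hder]
      have t1 : Tendsto (fun n => r n • x) atTop (𝓝 0) := by
        simpa using hrt.smul_const x
      have t2 : Tendsto (fun n => χ (r n • x)) atTop (𝓝 1) := by
        have := (hχ.1.continuous.tendsto 0).comp t1
        rwa [hχ0] at this
      have t3 : Tendsto (fun n => r n * fderiv ℝ χ (r n • x) (k x)) atTop (𝓝 0) := by
        have q := ((hχ.continuous_fderiv.clm_apply
          (continuous_const (y := k x))).tendsto 0).comp t1
        simpa using hrt.mul q
      have := (t2.mul_const (f ⟪θ, x⟫ * ⟪θ, k x⟫)).add (t3.const_mul (φ ⟪θ, x⟫))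
      simpa using this
  have hz : ∀ n, ∫ x, ⟪∇ (ψ n) x, k x⟫ ∂σ = 0 := fun n => h _ (hψt n)
  simp_rw [hz] at hlim
  exact (tendsto_nhds_unique tendsto_const_nhds hlim).symm

/-- Smooth compactly supported functions are dense in L² of the projected measure, and
Cauchy–Schwarz carries the identity to the limit. -/
theorem integral_ridge_eq_zero {σ : Measure (Euc d)} [IsProbabilityMeasure σ]
    {k : Euc d → Euc d} (hk : MemLp k 2 σ)
    (h : ∀ ψ, IsTestFunction ψ → ∫ x, ⟪∇ ψ x, k x⟫ ∂σ = 0) (θ : Euc d) {f : ℝ → ℝ}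
    (hf : MemLp f 2 (projMeasure σ θ)) :
    ∫ x, f ⟪θ, x⟫ * ⟪θ, k x⟫ ∂σ = 0 := by
  have := isProbabilityMeasure_projMeasure σ θ
  have hmθ : Measurable fun x : Euc d => ⟪x, θ⟫ := by fun_prop
  have hkθ : MemLp (fun x => ⟪θ, k x⟫) 2 σ := hk.const_inner θ
  set N := √(∫ x, ‖⟪θ, k x⟫‖ ^ 2 ∂σ) with hN
  have key : ∀ ε > 0, |∫ x, f ⟪θ, x⟫ * ⟪θ, k x⟫ ∂σ| ≤ N * ε := by
    intro ε hε
    obtain ⟨g, hgc, hgs, hle⟩ := hf.exist_eLpNorm_sub_le (by simp) one_le_two hε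
    have hgL : MemLp g 2 (projMeasure σ θ) := hgs.continuous.memLp_of_hasCompactSupport hgc
    have hD := hf.sub hgL
    have hDσ : MemLp (fun x => f ⟪x, θ⟫ - g ⟪x, θ⟫) 2 σ := hD.comp_of_map hmθ.aemeasurable
    have hgσ : MemLp (fun x => g ⟪x, θ⟫) 2 σ := hgL.comp_of_map hmθ.aemeasurable
    have hsz : √(∫ x, ‖f ⟪x, θ⟫ - g ⟪x, θ⟫‖ ^ 2 ∂σ) ≤ ε := by
      have e1 : ∫ x, ‖f ⟪x, θ⟫ - g ⟪x, θ⟫‖ ^ 2 ∂σ =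
          ∫ u, ‖f u - g u‖ ^ 2 ∂(projMeasure σ θ) := by
        rw [projMeasure, integral_map hmθ.aemeasurable]
        exact (hD.1.norm.pow 2)
      rw [hD.eLpNorm_eq_integral_rpow_norm (by simp) (by simp)] at hle
      have h4 := (ENNReal.ofReal_le_ofReal_iff hε.le).1 hle
      simp only [ENNReal.toReal_ofNat, Real.rpow_two, Pi.sub_apply] at h4
      rw [← one_div, ← Real.sqrt_eq_rpow] at h4
      rwa [e1]
    have hz := integral_ridge_eq_zero_of_smooth hk h θ hgs hgc
    have hi1 := integrable_inner_of_memLp hkθ hDσ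
    have hi2 := integrable_inner_of_memLp hkθ hgσ
    have hCS := abs_integral_inner_le hkθ hDσ
    simp only [RCLike.inner_apply, conj_trivial] at hi1 hi2 hCS
    have e2 : ∫ x, f ⟪θ, x⟫ * ⟪θ, k x⟫ ∂σ =
        ∫ x, (f ⟪x, θ⟫ - g ⟪x, θ⟫) * ⟪θ, k x⟫ ∂σ + ∫ x, g ⟪x, θ⟫ * ⟪θ, k x⟫ ∂σ := by
      rw [← integral_add hi1 hi2]
      refine integral_congr_ae (Eventually.of_forall fun x => ?_)
      simp only [real_inner_comm x θ]
      ring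
    have e3 : ∫ x, g ⟪x, θ⟫ * ⟪θ, k x⟫ ∂σ = 0 := by
      rw [← hz]
      refine integral_congr_ae (Eventually.of_forall fun x => ?_)
      simp only [real_inner_comm x θ]
    rw [e2, e3, add_zero]
    exact hCS.trans (by gcongr)
  by_contra hne
  have hpos : 0 < |∫ x, f ⟪θ, x⟫ * ⟪θ, k x⟫ ∂σ| := abs_pos.2 hne
  have hN0 : 0 ≤ N := Real.sqrt_nonneg _
  have := key (|∫ x, f ⟪θ, x⟫ * ⟪θ, k x⟫ ∂σ| / (2 * (N + 1))) (by positivity)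
  have h2 : N * (|∫ x, f ⟪θ, x⟫ * ⟪θ, k x⟫ ∂σ| / (2 * (N + 1))) <
      |∫ x, f ⟪θ, x⟫ * ⟪θ, k x⟫ ∂σ| := by
    rw [← mul_div_assoc, div_lt_iff₀ (by positivity)]
    nlinarith
  linarith

/-- For fixed P the displacement is a sum of fields, each a function of one coordinate times its
basis vector, hence orthogonal to whatever is orthogonal to all gradients. Fubini passes this to the
average over P. -/
theorem inTangentSpace_swGrad {μ σ : Measure (Euc d)} (hμ : IsP2 μ) (hσ : IsP2ac σ) :
    InTangentSpace σ (swGrad μ σ) := by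
  have := hμ.isProbabilityMeasure
  have := hσ.isProbabilityMeasure
  refine inTangentSpace_of_orthogonal (swGrad_sq_le hμ hσ).1 fun k hk h => ?_
  have hF := (integral_inner_displacement hμ hσ measurable_id (Measure.map_id (μ := σ)) hk).2
  simp only [id] at hF
  rw [← hF]
  have hz : ∀ P : OrthoGroup d, ∫ x, ⟪x - sliceMap μ σ P x, k x⟫ ∂σ = 0 := by
    intro P
    have hL : MemLp (fun x => x - sliceMap μ σ P x) 2 σ :=
      hσ.toIsP2.memLp.sub (memLp_sliceMap hμ hσ.absolutelyContinuous P)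
    have hfun : (fun x => ⟪x - sliceMap μ σ P x, k x⟫) = fun x =>
        ∑ i, ⟪basisVec P i, x - sliceMap μ σ P x⟫ * ⟪basisVec P i, k x⟫ :=
      funext fun p => inner_eq_sum_basisVec P _ _
    rw [hfun, integral_finsetSum _ fun i _ =>
      (hL.const_inner (basisVec P i)).integrable_mul (hk.const_inner (basisVec P i))]
    refine Finset.sum_eq_zero fun i _ => ?_
    have := nullSingletonClass_projMeasure hσ.absolutelyContinuous P i
    have := isProbabilityMeasure_projMeasure σ (basisVec P i)
    have := isProbabilityMeasure_projMeasure μ (basisVec P i)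
    have hf : MemLp (fun u => u - otMap (projMeasure σ (basisVec P i))
        (projMeasure μ (basisVec P i)) u) 2 (projMeasure σ (basisVec P i)) :=
      (memLp_projMeasure hσ.toIsP2.memLp _).sub (memLp_otMap (memLp_projMeasure hμ.memLp _))
    have hr := integral_ridge_eq_zero hk h (basisVec P i) hf
    rw [← hr]
    refine integral_congr_ae (Eventually.of_forall fun x => ?_)
    simp only [inner_sub_right, inner_basisVec_sliceMap]
  simp_rw [hz]
  simp

theorem isWassersteinGradient_swGrad (hd : 1 ≤ d) {μ σ : Measure (Euc d)} (hμ : IsP2 μ)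
    (hσ : IsP2ac σ) : IsWassersteinGradient (swLoss μ) σ (swGrad μ σ) where
  isP2 := hσ.toIsP2
  inTangentSpace := inTangentSpace_swGrad hμ hσ
  expansion _ hε := swLoss_isLittleO hd hμ hσ hε

end Tangent

/-! ### Uniqueness of the Wasserstein gradient -/

section Unique

variable {d : ℕ} {σ : Measure (Euc d)}

/-- The derivative is C¹ with compact support, hence Lipschitz; the mean value inequality on the
ball of radius ‖y - x‖ finishes. -/
theorem IsTestFunction.exists_taylor {ψ : Euc d → ℝ} (h : IsTestFunction ψ) :
    ∃ L : ℝ, 0 ≤ L ∧ ∀ x y, |ψ y - ψ x - ⟪∇ ψ x, y - x⟫| ≤ L * ‖y - x‖ ^ 2 := by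
  obtain ⟨L, hL⟩ := ContDiff.lipschitzWith_of_hasCompactSupport (𝕂 := ℝ) (n := 1)
    (h.2.fderiv ℝ) (h.1.fderiv_right (m := 1) (WithTop.coe_le_coe.2 (le_top : (2 : ℕ∞) ≤ ⊤))) one_ne_zero
  refine ⟨L, L.2, fun x y => ?_⟩
  have := Convex.norm_image_sub_le_of_norm_fderiv_le' (𝕜 := ℝ) (f := ψ) (C := L * ‖y - x‖)
    (s := Metric.closedBall x ‖y - x‖) (x := x) (y := y) (φ := fderiv ℝ ψ x)
    (fun z _ => h.differentiable z) (fun z hz => ?_) (convex_closedBall _ _)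
    (Metric.mem_closedBall_self (norm_nonneg _)) (by rw [Metric.mem_closedBall, dist_eq_norm])
  · rw [inner_gradient]
    refine this.trans_eq ?_
    ring
  · refine (hL.norm_sub_le z x).trans ?_
    rw [Metric.mem_closedBall, dist_eq_norm] at hz
    gcongr

/-- A map whose graph lies in the contact set of a quadratic `c`-transform is optimal. -/
theorem isOptimalPlan_of_potential [IsProbabilityMeasure σ] (hσ : MemLp (fun x => x) 2 σ)
    {S : Euc d → Euc d} (hS : Measurable S) (hS2 : MemLp S 2 σ) {φ : Euc d → ℝ}
    (hφ : Continuous φ) {B : ℝ} (hB : ∀ x, |φ x| ≤ B)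
    (h : ∀ x x', ‖x - S x‖ ^ 2 / 2 + φ x ≤ ‖x' - S x‖ ^ 2 / 2 + φ x') :
    IsOptimalPlan (σ.map fun x => (x, S x)) σ (σ.map S) := by
  have hpair : Measurable fun x => (x, S x) := measurable_id.prodMk hS
  have hplan : IsTransportPlan (σ.map fun x => (x, S x)) σ (σ.map S) := by
    constructor
    · rw [Measure.map_map measurable_fst hpair]
      exact Measure.map_id
    · rw [Measure.map_map measurable_snd hpair]
      rfl
  refine ⟨hplan, le_antisymm (le_iInf₂ fun ρ hρ => ?_) (wassersteinSq_le_transportCost hplan)⟩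
  have hν2 : MemLp (fun x => x) 2 (σ.map S) := (memLp_map_id hS.aemeasurable).2 hS2
  have : IsProbabilityMeasure ρ := hρ.isProbabilityMeasure
  have hρm := hρ.memLp_sub hσ hν2
  rw [transportCost_eq_ofReal hρm, transportCost_eq_ofReal (hplan.memLp_sub hσ hν2)]
  refine ENNReal.ofReal_le_ofReal ?_
  rw [integral_map hpair.aemeasurable (by fun_prop)]
  -- Kantorovich duality by hand: G(y) - φ(x) ≤ ‖x - y‖²/2 everywhere, with equality on the graph of
  -- S, so integrating against any competitor compares the costs.
  set G : Euc d → ℝ := fun y => ⨅ x, (‖x - y‖ ^ 2 / 2 + φ x) with hG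
  have hbdd : ∀ y, BddBelow (range fun x => ‖x - y‖ ^ 2 / 2 + φ x) := by
    refine fun y => ⟨-B, ?_⟩
    rintro _ ⟨x, rfl⟩
    have := (abs_le.1 (hB x)).1
    have : (0 : ℝ) ≤ ‖x - y‖ ^ 2 / 2 := by positivity
    dsimp only
    linarith
  have hGm : Measurable G := by
    refine (upperSemicontinuous_ciInf hbdd fun x => ?_).measurable
    exact Continuous.upperSemicontinuous (by fun_prop)
  have hGle : ∀ x y, G y ≤ ‖x - y‖ ^ 2 / 2 + φ x := fun x y => ciInf_le (hbdd y) x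
  have hGS : ∀ x, G (S x) = ‖x - S x‖ ^ 2 / 2 + φ x := fun x =>
    le_antisymm (hGle x _) (le_ciInf fun x' => h x x')
  have hGB : ∀ y, |G y| ≤ B := by
    intro y
    refine abs_le.2 ⟨le_ciInf fun x => ?_, ?_⟩
    · have := (abs_le.1 (hB x)).1
      have : (0 : ℝ) ≤ ‖x - y‖ ^ 2 / 2 := by positivity
      linarith
    · refine (hGle y y).trans ?_
      simpa using (abs_le.1 (hB y)).2
  have hφi : ∀ {Y : Type} [MeasurableSpace Y] (m : Measure Y) [IsProbabilityMeasure m]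
      (f : Y → Euc d), Measurable f → Integrable (fun y => φ (f y)) m := fun m _ f hf =>
    Integrable.of_bound (hφ.measurable.comp hf).aestronglyMeasurable B
      (Eventually.of_forall fun y => hB _)
  have hGi : ∀ {Y : Type} [MeasurableSpace Y] (m : Measure Y) [IsProbabilityMeasure m]
      (f : Y → Euc d), Measurable f → Integrable (fun y => G (f y)) m := fun m _ f hf =>
    Integrable.of_bound (hGm.comp hf).aestronglyMeasurable B
      (Eventually.of_forall fun y => hGB _)
  have e1 : ∫ p, φ p.1 ∂ρ = ∫ x, φ x ∂σ := by
    have := integral_map (μ := ρ) measurable_fst.aemeasurable (f := φ)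
      hφ.aestronglyMeasurable
    rw [hρ.map_fst] at this
    exact this.symm
  have e2 : ∫ p, G p.2 ∂ρ = ∫ x, G (S x) ∂σ := by
    have := integral_map (μ := ρ) measurable_snd.aemeasurable (f := G)
      hGm.aestronglyMeasurable
    rw [hρ.map_snd, integral_map hS.aemeasurable hGm.aestronglyMeasurable] at this
    exact this.symm
  have e3 : ∫ x, G (S x) ∂σ = (∫ x, ‖x - S x‖ ^ 2 ∂σ) / 2 + ∫ x, φ x ∂σ := by
    simp only [hGS]
    rw [integral_add, integral_div]
    · exact ((hσ.sub hS2).integrable_norm_sq).div_const 2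
    · exact hφi σ _ measurable_id
  have e4 : ∫ p, G p.2 ∂ρ - ∫ p, φ p.1 ∂ρ ≤ (∫ p, ‖p.1 - p.2‖ ^ 2 ∂ρ) / 2 := by
    rw [← integral_sub (hGi ρ _ measurable_snd) (hφi ρ _ measurable_fst), ← integral_div]
    refine integral_mono ((hGi ρ _ measurable_snd).sub (hφi ρ _ measurable_fst))
      (hρm.integrable_norm_sq.div_const 2) fun p => ?_
    have := hGle p.1 p.2
    dsimp only
    linarith
  linarith

/-- Take tψ as potential. Moving from x to x' changes the quantity to be minimised by at least (1/2
- tL)‖x' - x‖², which is where the condition on t comes from. -/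
theorem IsTestFunction.isOptimalPlan {ψ : Euc d → ℝ} (hψ : IsTestFunction ψ)
    [IsProbabilityMeasure σ] (hσ : MemLp (fun x => x) 2 σ) {L t : ℝ}
    (hL : ∀ x y, |ψ y - ψ x - ⟪∇ ψ x, y - x⟫| ≤ L * ‖y - x‖ ^ 2) (ht : 0 ≤ t)
    (htL : t * L ≤ 1 / 2) :
    IsOptimalPlan (σ.map fun x => (x, x + t • ∇ ψ x)) σ (σ.map fun x => x + t • ∇ ψ x) := by
  obtain ⟨B, hB⟩ := hψ.2.exists_bound_of_continuous hψ.1.continuous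
  have hg := hψ.continuous_gradient
  refine isOptimalPlan_of_potential hσ (φ := fun x => t * ψ x) (B := t * B)
    (by fun_prop) (hσ.add ((hψ.memLp_gradient σ).const_smul t))
    (by have := hψ.1.continuous; fun_prop) (fun x => ?_) (fun x x' => ?_)
  · rw [abs_mul, abs_of_nonneg ht]
    exact mul_le_mul_of_nonneg_left (hB x) ht
  · have e1 : x - (x + t • ∇ ψ x) = -(t • ∇ ψ x) := by abel
    have e2 : x' - (x + t • ∇ ψ x) = (x' - x) - t • ∇ ψ x := by abel
    rw [e1, e2, norm_neg, norm_sub_sq_real, inner_smul_right, real_inner_comm]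
    have h1 := (abs_le.1 (hL x x')).1
    have h2 := mul_le_mul_of_nonneg_left h1 ht
    have h3 := mul_le_mul_of_nonneg_right htL (sq_nonneg ‖x' - x‖)
    nlinarith

/-- The Wasserstein gradient is unique up to null sets. -/
theorem IsWassersteinGradient.ae_eq {𝓕 : Measure (Euc d) → ℝ} {g₁ g₂ : Euc d → Euc d}
    (h₁ : IsWassersteinGradient 𝓕 σ g₁) (h₂ : IsWassersteinGradient 𝓕 σ g₂) : g₁ =ᵐ[σ] g₂ := by
  have hσ := h₁.isP2
  have := hσ.isProbabilityMeasure
  refine ae_eq_of_tangent_of_orthogonal h₁.inTangentSpace h₂.inTangentSpace fun ψ hψ => ?_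
  have hψm := hψ.memLp_gradient σ
  have hψc := hψ.continuous_gradient
  set A := √(∫ x, ‖∇ ψ x‖ ^ 2 ∂σ) with hA
  have hA0 : 0 ≤ A := Real.sqrt_nonneg _
  set I := ∫ x, ⟪∇ ψ x, g₁ x - g₂ x⟫ ∂σ with hI
  obtain ⟨L, hL0, hL⟩ := hψ.exists_taylor
  -- Subtract the two expansions at the image of σ under x + t∇ψ, which lies at distance exactly tA
  -- from σ along an explicit optimal coupling; then divide by t.
  have key : ∀ ε : ℝ, 0 < ε → |I| ≤ 2 * ε * A := by
    intro ε hε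
    obtain ⟨δ₁, hδ₁, H₁⟩ := h₁.expansion ε hε
    obtain ⟨δ₂, hδ₂, H₂⟩ := h₂.expansion ε hε
    set δ := min δ₁ δ₂ with hδ
    have hδ0 : 0 < δ := lt_min hδ₁ hδ₂
    -- The first condition on t ensures optimality, the second puts the perturbed measure within
    -- range of both expansions.
    obtain ⟨t, ht0, htL, htA⟩ : ∃ t : ℝ, 0 < t ∧ t * L ≤ 1 / 2 ∧ t * A < δ := by
      refine ⟨min (1 / (2 * (L + 1))) (δ / (A + 1)), by positivity, ?_, ?_⟩
      · refine (mul_le_mul_of_nonneg_right (min_le_left _ _) hL0).trans ?_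
        rw [div_mul_eq_mul_div, div_le_div_iff₀ (by positivity) (by positivity)]
        linarith
      · refine (mul_le_mul_of_nonneg_right (min_le_right _ _) hA0).trans_lt ?_
        rw [div_mul_eq_mul_div, div_lt_iff₀ (by positivity)]
        nlinarith
    set S : Euc d → Euc d := fun x => x + t • ∇ ψ x with hS
    have hSm : Measurable S := by fun_prop
    have hpm : Measurable fun x => (x, S x) := measurable_id.prodMk hSm
    have hS2 : MemLp S 2 σ := hσ.memLp.add (hψm.const_smul t)
    have hopt := hψ.isOptimalPlan hσ.memLp hL ht0.le htL
    have hν : IsP2 (σ.map S) := isP2_of_memLp (Measure.isProbabilityMeasure_map hSm.aemeasurable)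
      ((memLp_map_id hSm.aemeasurable).2 hS2)
    have hW : wassersteinDist σ (σ.map S) = t * A := by
      rw [hopt.wassersteinDist_eq hσ hν, integral_map hpm.aemeasurable (by fun_prop)]
      have : ∀ x, ‖x - S x‖ ^ 2 = t ^ 2 * ‖∇ ψ x‖ ^ 2 := by
        intro x
        rw [hS, sub_add_cancel_left, norm_neg, norm_smul, mul_pow, Real.norm_eq_abs, sq_abs]
      simp only [this]
      rw [integral_const_mul, Real.sqrt_mul (sq_nonneg t), Real.sqrt_sq ht0.le]
    have hint : ∀ g : Euc d → Euc d, MemLp g 2 σ →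
        ∫ p, ⟪g p.1, p.2 - p.1⟫ ∂(σ.map fun x => (x, S x)) = t * ∫ x, ⟪∇ ψ x, g x⟫ ∂σ := by
      intro g hg
      have hgm : AEStronglyMeasurable (fun p : Euc d × Euc d => g p.1)
          (σ.map fun x => (x, S x)) :=
        (memLp_comp_fst hopt.toIsTransportPlan hg).aestronglyMeasurable
      rw [integral_map hpm.aemeasurable (hgm.inner (by fun_prop)), ← integral_const_mul]
      refine integral_congr_ae (Eventually.of_forall fun x => ?_)
      simp [hS, inner_smul_right]
    have b₁ := H₁ _ hν (hW ▸ htA.trans_le (min_le_left _ _)) _ hopt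
    have b₂ := H₂ _ hν (hW ▸ htA.trans_le (min_le_right _ _)) _ hopt
    rw [hint _ h₁.inTangentSpace.1, hW] at b₁
    rw [hint _ h₂.inTangentSpace.1, hW] at b₂
    have hsub : I = ∫ x, ⟪∇ ψ x, g₁ x⟫ ∂σ - ∫ x, ⟪∇ ψ x, g₂ x⟫ ∂σ := by
      rw [hI, ← integral_sub (integrable_inner_of_memLp hψm h₁.inTangentSpace.1)
        (integrable_inner_of_memLp hψm h₂.inTangentSpace.1)]
      simp only [inner_sub_right]
    have : t * |I| ≤ t * (2 * ε * A) := by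
      rw [← abs_of_pos ht0, ← abs_mul, abs_of_pos ht0, hsub, mul_sub]
      rw [abs_le] at b₁ b₂ ⊢
      constructor <;> linarith [b₁.1, b₁.2, b₂.1, b₂.2]
    exact le_of_mul_le_mul_left this ht0
  have hlim : |I| ≤ 0 := by
    refine le_of_forall_pos_le_add fun ε hε => ?_
    have := key (ε / (2 * (A + 1))) (by positivity)
    refine this.trans ?_
    rw [zero_add, mul_div_assoc', div_mul_eq_mul_div, div_le_iff₀ (by positivity)]
    nlinarith
  exact abs_nonpos_iff.1 hlim

theorem gradNormSq_eq {𝓕 : Measure (Euc d) → ℝ} {g : Euc d → Euc d}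
    (h : IsWassersteinGradient 𝓕 σ g) : gradNormSq 𝓕 σ = ∫ x, ‖g x‖ ^ 2 ∂σ := by
  have hd : WassersteinDifferentiableAt 𝓕 σ := ⟨g, h⟩
  have he : wassersteinGradient 𝓕 σ =ᵐ[σ] g := by
    rw [wassersteinGradient, dif_pos hd]
    exact hd.choose_spec.ae_eq h
  refine integral_congr_ae ?_
  filter_upwards [he] with x hx
  rw [hx]

end Unique

/-! ### One step of the scheme -/

section Step

variable {d : ℕ} {μ σ : Measure (Euc d)}

/-- One step of the slice-matching scheme. -/
noncomputable def sliceStep (μ : Measure (Euc d)) (γ : ℝ) (σ : Measure (Euc d))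
    (P : OrthoGroup d) : Measure (Euc d) :=
  σ.map fun x => (1 - γ) • x + γ • sliceMap μ σ P x

/-- Expand F along the coupling (x, S(x)), which need not be optimal. Its displacement is -γ(x -
T(x)), its cost is γ² times the slice cost, and the nonnegative remainder is dropped. -/
theorem swLoss_sliceStep_le (hd : 1 ≤ d) (hμ : IsP2ac μ) (hσ : IsP2ac σ) {γ : ℝ} (h0 : 0 ≤ γ)
    (h1 : γ ≤ 1) (P : OrthoGroup d) :
    swLoss μ (sliceStep μ γ σ P) ≤
      swLoss μ σ - γ * ∫ x, ⟪x - sliceMap μ σ P x, swGrad μ σ x⟫ ∂σ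
        + γ ^ 2 / 2 * (sliceCost μ σ P).toReal := by
  have := hμ.isProbabilityMeasure
  have := hσ.isProbabilityMeasure
  have hT := measurable_sliceMap_apply μ σ P
  have hg := measurable_swGrad μ σ
  set S : Euc d → Euc d := fun x => (1 - γ) • x + γ • sliceMap μ σ P x with hS
  have hSm : Measurable S := by fun_prop
  have hpm : Measurable fun x => (x, S x) := measurable_id.prodMk hSm
  have hplan : IsTransportPlan (σ.map fun x => (x, S x)) σ (sliceStep μ γ σ P) := by
    constructor
    · rw [Measure.map_map measurable_fst hpm]
      exact Measure.map_id
    · rw [Measure.map_map measurable_snd hpm]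
      rfl
  have hν : IsP2 (sliceStep μ γ σ P) := (isP2ac_step hμ hσ P h0 h1).toIsP2
  have hexp := swLoss_expansion hd hμ.toIsP2 hσ hν hplan
  have hrem : 0 ≤ ∫ Q, sliceRem μ σ (σ.map fun x => (x, S x)) Q ∂(haarOrtho d) :=
    integral_nonneg fun Q => sliceRem_nonneg hμ.toIsP2 hσ hν hplan Q
  have e : ∀ x, S x - x = -(γ • (x - sliceMap μ σ P x)) := by
    intro x
    change (1 - γ) • x + γ • sliceMap μ σ P x - x = _
    rw [sub_smul, one_smul, smul_sub]
    abel
  have e1 : ∫ p, ⟪swGrad μ σ p.1, p.2 - p.1⟫ ∂(σ.map fun x => (x, S x)) =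
      -(γ * ∫ x, ⟪x - sliceMap μ σ P x, swGrad μ σ x⟫ ∂σ) := by
    rw [integral_map hpm.aemeasurable (by fun_prop), ← integral_const_mul, ← integral_neg]
    refine integral_congr_ae (Eventually.of_forall fun x => ?_)
    dsimp only
    rw [e, inner_neg_right, inner_smul_right, real_inner_comm]
  have e2 : ∫ p, ‖p.1 - p.2‖ ^ 2 ∂(σ.map fun x => (x, S x)) =
      γ ^ 2 * (sliceCost μ σ P).toReal := by
    rw [integral_map hpm.aemeasurable (by fun_prop), sliceCost_eq hμ.toIsP2 hσ,
      ENNReal.toReal_ofReal (integral_nonneg fun x => by positivity), ← integral_const_mul]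
    refine integral_congr_ae (Eventually.of_forall fun x => ?_)
    dsimp only
    rw [norm_sub_rev, e, norm_neg, norm_smul, mul_pow, Real.norm_eq_abs, sq_abs]
  rw [e1, e2] at hexp
  linarith

/-- Convexity of the squared norm, together with the fact that T has second moment M₂(μ) under σ. -/
theorem secondMoment_sliceStep_le (hμ : IsP2ac μ) (hσ : IsP2ac σ) {γ : ℝ} (h0 : 0 ≤ γ)
    (h1 : γ ≤ 1) (P : OrthoGroup d) :
    secondMoment (sliceStep μ γ σ P) ≤ (1 - γ) * secondMoment σ + γ * secondMoment μ := by
  have := hμ.isProbabilityMeasure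
  have := hσ.isProbabilityMeasure
  have hT := measurable_sliceMap_apply μ σ P
  have hT2 := memLp_sliceMap hμ.toIsP2 hσ.absolutelyContinuous P
  have hi := hσ.toIsP2.memLp
  rw [secondMoment, sliceStep, integral_map (by fun_prop) (by fun_prop), secondMoment,
    ← integral_norm_sliceMap_sq hμ.toIsP2 hσ.absolutelyContinuous P, ← integral_const_mul,
    ← integral_const_mul, ← integral_add (hi.integrable_norm_sq.const_mul _)
      (hT2.integrable_norm_sq.const_mul _)]
  refine integral_mono ((hi.const_smul (1 - γ)).add (hT2.const_smul γ)).integrable_norm_sq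
    ((hi.integrable_norm_sq.const_mul _).add (hT2.integrable_norm_sq.const_mul _)) fun x => ?_
  have hc : ConvexOn ℝ univ fun x : Euc d => ‖x‖ ^ 2 :=
    (convexOn_norm convex_univ).pow (fun _ _ => norm_nonneg _) 2
  exact hc.2 (mem_univ x) (mem_univ (sliceMap μ σ P x)) (by linarith) h0 (by ring)

theorem measurable_swLoss_param {Ω : Type*} [MeasurableSpace Ω] (hd : 1 ≤ d)
    {κ : Ω → Measure (Euc d)} (hκ : Measurable κ) (hp : ∀ ω, IsProbabilityMeasure (κ ω))
    (μ : Measure (Euc d)) [IsProbabilityMeasure μ] : Measurable fun ω => swLoss μ (κ ω) := by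
  have h : Measurable fun z : Ω × OrthoGroup d => sliceCost μ (κ z.1) z.2 :=
    measurable_sliceCost (Ω := Ω × OrthoGroup d) (κ := fun z => κ z.1)
      (hκ.comp measurable_fst) (fun z => hp z.1) μ (P := fun z => z.2) measurable_snd
  have he : (fun ω => swLoss μ (κ ω)) = fun ω =>
      (∫⁻ P, sliceCost μ (κ ω) P ∂(haarOrtho d)).toReal / 2 := by
    funext ω
    have := hp ω
    exact swLoss_eq hd μ (κ ω)
  rw [he]
  exact (h.lintegral_prod_right' (ν := haarOrtho d)).ennreal_toReal.div_const 2

theorem measurable_sliceStep {Ω : Type*} [MeasurableSpace Ω]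
    {κ : Ω → Measure (Euc d)} (hκ : Measurable κ) (hp : ∀ ω, IsProbabilityMeasure (κ ω))
    (μ : Measure (Euc d)) [IsProbabilityMeasure μ] (γ : ℝ) {P : Ω → OrthoGroup d}
    (hP : Measurable P) : Measurable fun ω => sliceStep μ γ (κ ω) (P ω) := by
  have h := measurable_sliceMap_param hκ hp μ hP
  have h2 : Measurable fun z : Ω × Euc d => (1 - γ) • z.2 + γ • sliceMap μ (κ z.1) (P z.1) z.2 :=
    (measurable_snd.const_smul (1 - γ)).add (h.const_smul γ)
  exact measurable_measure_map hκ hp h2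

/-- The squared norm of the gradient of the objective. -/
noncomputable def gradSq (μ σ : Measure (Euc d)) : ℝ := ∫ x, ‖swGrad μ σ x‖ ^ 2 ∂σ

theorem measurable_gradSq_param {Ω : Type*} [MeasurableSpace Ω]
    {κ : Ω → Measure (Euc d)} (hκ : Measurable κ) (hp : ∀ ω, IsProbabilityMeasure (κ ω))
    (μ : Measure (Euc d)) [IsProbabilityMeasure μ] : Measurable fun ω => gradSq μ (κ ω) :=
  (measurable_integral_param hκ hp (f := fun z : Ω × Euc d => ‖swGrad μ (κ z.1) z.2‖ ^ 2)
    ((measurable_swGrad_param hκ hp μ).norm.pow_const 2).stronglyMeasurable).measurable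

theorem gradSq_nonneg (μ σ : Measure (Euc d)) : 0 ≤ gradSq μ σ :=
  integral_nonneg fun _ => by positivity

theorem gradSq_le (hd : 1 ≤ d) (hμ : IsP2 μ) (hσ : IsP2ac σ) : gradSq μ σ ≤ 2 * swLoss μ σ := by
  refine (swGrad_sq_le hμ hσ).2.trans_eq ?_
  rw [swLoss_eq_integral hd hμ hσ.toIsP2]
  ring

theorem gradNormSq_swLoss (hd : 1 ≤ d) (hμ : IsP2 μ) (hσ : IsP2ac σ) :
    gradNormSq (swLoss μ) σ = gradSq μ σ :=
  gradNormSq_eq (isWassersteinGradient_swGrad hd hμ hσ)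

theorem integrable_swLoss_sliceStep (hd : 1 ≤ d) (hμ : IsP2ac μ) (hσ : IsP2ac σ) {γ : ℝ}
    (h0 : 0 ≤ γ) (h1 : γ ≤ 1) :
    Integrable (fun P => swLoss μ (sliceStep μ γ σ P)) (haarOrtho d) := by
  have := hμ.isProbabilityMeasure
  have := hσ.isProbabilityMeasure
  have hp := fun P => isP2ac_step hμ hσ P h0 h1
  refine Integrable.of_bound (measurable_swLoss_param hd
    (measurable_sliceStep (κ := fun _ => σ) measurable_const (fun _ => inferInstance) μ γ
      (P := fun P => P) measurable_id)
    (fun P => (hp P).isProbabilityMeasure) μ).aestronglyMeasurable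
    ((1 - γ) * secondMoment σ + γ * secondMoment μ + secondMoment μ)
    (Eventually.of_forall fun P => ?_)
  rw [Real.norm_of_nonneg (swLoss_nonneg _ _)]
  refine (swLoss_le_moments hd hμ.toIsP2 (hp P).toIsP2).trans ?_
  gcongr
  exact secondMoment_sliceStep_le hμ hσ h0 h1 P

/-- Expected descent over a random basis. -/
theorem integral_swLoss_sliceStep_le (hd : 1 ≤ d) (hμ : IsP2ac μ) (hσ : IsP2ac σ) {γ : ℝ}
    (h0 : 0 ≤ γ) (h1 : γ ≤ 1) :
    ∫ P, swLoss μ (sliceStep μ γ σ P) ∂(haarOrtho d) ≤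
      swLoss μ σ - γ * gradSq μ σ + γ ^ 2 * swLoss μ σ := by
  have := hμ.isProbabilityMeasure
  have := hσ.isProbabilityMeasure
  have hg := (swGrad_sq_le hμ.toIsP2 hσ).1
  -- Unbiasedness: the displacement averages to the gradient, so its correlation with the gradient
  -- averages to the squared norm.
  obtain ⟨i1, e1⟩ := integral_inner_displacement hμ.toIsP2 hσ measurable_id
    (Measure.map_id (μ := σ)) hg
  simp only [id] at i1 e1
  have i2 := integrable_sliceCost hμ.toIsP2 hσ.toIsP2
  have i3 := (integrable_const (μ := haarOrtho d) (swLoss μ σ)).sub (i1.const_mul γ)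
  refine (integral_mono (integrable_swLoss_sliceStep hd hμ hσ h0 h1)
    (i3.add (i2.const_mul (γ ^ 2 / 2)))
    (swLoss_sliceStep_le hd hμ hσ h0 h1)).trans_eq ?_
  have e2 : ∫ x, ⟪swGrad μ σ x, swGrad μ σ x⟫ ∂σ = gradSq μ σ := by
    simp only [real_inner_self_eq_norm_sq]
    rfl
  have e3 : ∫ P, (sliceCost μ σ P).toReal ∂(haarOrtho d) = 2 * swLoss μ σ := by
    rw [swLoss_eq_integral hd hμ.toIsP2 hσ.toIsP2]
    ring
  refine (integral_add i3 (i2.const_mul (γ ^ 2 / 2))).trans ?_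
  have e4 := integral_sub (integrable_const (μ := haarOrtho d) (swLoss μ σ)) (i1.const_mul γ)
  simp only [Pi.sub_apply] at e4 ⊢
  rw [e4, integral_const_mul, integral_const_mul, e1, e2, e3, integral_const, probReal_univ, one_smul]
  ring

end Step

/-! ### The random scheme -/

section RandomScheme

variable {d : ℕ} {μ σ₀ : Measure (Euc d)} {γ : ℕ → ℝ}

theorem schemeIterate_succ (P : ℕ → OrthoGroup d) (k : ℕ) :
    schemeIterate μ σ₀ γ P (k + 1) = sliceStep μ (γ k) (schemeIterate μ σ₀ γ P k) (P k) := rfl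

theorem isP2ac_schemeIterate (hμ : IsP2ac μ) (hσ₀ : IsP2ac σ₀) (hγ : ∀ k, 0 < γ k ∧ γ k ≤ 1)
    (P : ℕ → OrthoGroup d) (k : ℕ) : IsP2ac (schemeIterate μ σ₀ γ P k) := by
  induction k with
  | zero => exact hσ₀
  | succ k ih => exact isP2ac_step hμ ih (P k) (hγ k).1.le (hγ k).2

theorem secondMoment_schemeIterate_le (hμ : IsP2ac μ) (hσ₀ : IsP2ac σ₀)
    (hγ : ∀ k, 0 < γ k ∧ γ k ≤ 1) (P : ℕ → OrthoGroup d) (k : ℕ) :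
    secondMoment (schemeIterate μ σ₀ γ P k) ≤ max (secondMoment σ₀) (secondMoment μ) := by
  induction k with
  | zero => exact le_max_left _ _
  | succ k ih =>
    refine (secondMoment_sliceStep_le hμ (isP2ac_schemeIterate hμ hσ₀ hγ P k) (hγ k).1.le
      (hγ k).2 (P k)).trans ?_
    nlinarith [hγ k, le_max_right (secondMoment σ₀) (secondMoment μ)]

/-- A full first step forgets the second moment of σ₀, and later convex combinations stay below
M₂(μ). Only the initial loss then needs a separate assumption. -/
theorem secondMoment_schemeIterate_succ_le (hμ : IsP2ac μ) (hσ₀ : IsP2ac σ₀)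
    (hγ : ∀ k, 0 < γ k ∧ γ k ≤ 1) (h0 : γ 0 = 1) (P : ℕ → OrthoGroup d) (k : ℕ) :
    secondMoment (schemeIterate μ σ₀ γ P (k + 1)) ≤ secondMoment μ := by
  have hs := fun k => secondMoment_sliceStep_le hμ (isP2ac_schemeIterate hμ hσ₀ hγ P k)
    (hγ k).1.le (hγ k).2 (P k)
  induction k with
  | zero =>
    refine (hs 0).trans_eq ?_
    simp [h0]
  | succ k ih =>
    refine (hs (k + 1)).trans ?_
    nlinarith [hγ (k + 1)]

theorem swLoss_schemeIterate_le (hd : 1 ≤ d) (hμ : IsP2ac μ) (hσ₀ : IsP2ac σ₀)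
    (hγ : ∀ k, 0 < γ k ∧ γ k ≤ 1) (P : ℕ → OrthoGroup d) (k : ℕ) :
    swLoss μ (schemeIterate μ σ₀ γ P k) ≤ 2 * max (secondMoment σ₀) (secondMoment μ) := by
  have h1 := swLoss_le_moments hd hμ.toIsP2 (isP2ac_schemeIterate hμ hσ₀ hγ P k).toIsP2
  have h2 := secondMoment_schemeIterate_le hμ hσ₀ hγ P k
  have h3 := le_max_right (secondMoment σ₀) (secondMoment μ)
  linarith

theorem swLoss_schemeIterate_le_of_full_step (hd : 1 ≤ d) (hμ : IsP2ac μ) (hσ₀ : IsP2ac σ₀)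
    (hγ : ∀ k, 0 < γ k ∧ γ k ≤ 1) (h0 : γ 0 = 1) (hF : swLoss μ σ₀ ≤ 2 * secondMoment μ)
    (P : ℕ → OrthoGroup d) (k : ℕ) :
    swLoss μ (schemeIterate μ σ₀ γ P k) ≤ 2 * secondMoment μ := by
  cases k with
  | zero => exact hF
  | succ k =>
    have h1 := swLoss_le_moments hd hμ.toIsP2 (isP2ac_schemeIterate hμ hσ₀ hγ P (k + 1)).toIsP2
    have h2 := secondMoment_schemeIterate_succ_le hμ hσ₀ hγ h0 P k
    linarith

/-- The k-th iterate sees only the bases with index below k, which makes it independent of the basis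
used next. -/
theorem schemeIterate_congr {P Q : ℕ → OrthoGroup d} {k : ℕ} (h : ∀ j < k, P j = Q j) :
    schemeIterate μ σ₀ γ P k = schemeIterate μ σ₀ γ Q k := by
  induction k with
  | zero => rfl
  | succ k ih =>
    rw [schemeIterate_succ, schemeIterate_succ, ih fun j hj => h j (hj.trans k.lt_succ_self),
      h k k.lt_succ_self]

variable {Ω : Type*} [MeasurableSpace Ω]

theorem measurable_schemeRandom (hμ : IsP2ac μ) (hσ₀ : IsP2ac σ₀) (hγ : ∀ k, 0 < γ k ∧ γ k ≤ 1)
    {P : ℕ → Ω → OrthoGroup d} (hP : ∀ k, Measurable (P k)) (k : ℕ) :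
    Measurable (schemeRandom μ σ₀ γ P k) := by
  have := hμ.isProbabilityMeasure
  induction k with
  | zero => exact measurable_const
  | succ k ih =>
    exact measurable_sliceStep ih
      (fun ω => (isP2ac_schemeIterate hμ hσ₀ hγ _ k).isProbabilityMeasure) μ (γ k) (hP k)

theorem integrable_swLoss_schemeRandom {ℙ : Measure Ω} [IsProbabilityMeasure ℙ] (hd : 1 ≤ d)
    (hμ : IsP2ac μ) (hσ₀ : IsP2ac σ₀) (hγ : ∀ k, 0 < γ k ∧ γ k ≤ 1)
    {P : ℕ → Ω → OrthoGroup d} (hP : ∀ k, Measurable (P k)) (k : ℕ) :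
    Integrable (fun ω => swLoss μ (schemeRandom μ σ₀ γ P k ω)) ℙ := by
  have := hμ.isProbabilityMeasure
  refine Integrable.of_bound (measurable_swLoss_param hd
    (measurable_schemeRandom hμ hσ₀ hγ hP k)
    (fun ω => (isP2ac_schemeIterate hμ hσ₀ hγ _ k).isProbabilityMeasure) μ).aestronglyMeasurable
    (2 * max (secondMoment σ₀) (secondMoment μ)) (Eventually.of_forall fun ω => ?_)
  rw [Real.norm_of_nonneg (swLoss_nonneg _ _)]
  exact swLoss_schemeIterate_le hd hμ hσ₀ hγ _ k

theorem integrable_gradSq_schemeRandom {ℙ : Measure Ω} [IsProbabilityMeasure ℙ] (hd : 1 ≤ d)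
    (hμ : IsP2ac μ) (hσ₀ : IsP2ac σ₀) (hγ : ∀ k, 0 < γ k ∧ γ k ≤ 1)
    {P : ℕ → Ω → OrthoGroup d} (hP : ∀ k, Measurable (P k)) (k : ℕ) :
    Integrable (fun ω => gradSq μ (schemeRandom μ σ₀ γ P k ω)) ℙ := by
  have := hμ.isProbabilityMeasure
  refine ((integrable_swLoss_schemeRandom (ℙ := ℙ) hd hμ hσ₀ hγ hP k).const_mul 2).mono'
    (measurable_gradSq_param (measurable_schemeRandom hμ hσ₀ hγ hP k)
    (fun ω => (isP2ac_schemeIterate hμ hσ₀ hγ _ k).isProbabilityMeasure) μ).aestronglyMeasurable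
    (Eventually.of_forall fun ω => ?_)
  rw [Real.norm_of_nonneg (gradSq_nonneg _ _)]
  exact gradSq_le hd hμ.toIsP2 (isP2ac_schemeIterate hμ hσ₀ hγ _ k)

/-- Extend the first `k` bases by the identity. -/
noncomputable def extendBases (k j : ℕ) (x : Finset.range k → OrthoGroup d) : OrthoGroup d :=
  if h : j ∈ Finset.range k then x ⟨j, h⟩ else 1

theorem measurable_extendBases (k j : ℕ) : Measurable (extendBases (d := d) k j) := by
  unfold extendBases
  split
  · exact measurable_pi_apply _
  · exact measurable_const

/-- The bases used before step `k` are independent of the `k`-th one. -/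
theorem IsIIDHaar.map_past_prod {ℙ : Measure Ω} [IsProbabilityMeasure ℙ]
    {P : ℕ → Ω → OrthoGroup d} (h : IsIIDHaar ℙ P) (k : ℕ) :
    ℙ.map (fun ω => ((fun j : Finset.range k => P j ω), P k ω)) =
      (ℙ.map fun ω (j : Finset.range k) => P j ω).prod (haarOrtho d) := by
  have h1 := h.indep.indepFun_finset (Finset.range k) {k} (by simp) h.measurable
  have h2 : ProbabilityTheory.IndepFun (fun ω (j : Finset.range k) => P j ω) (P k) ℙ :=
    h1.comp (φ := id) (ψ := fun x : ({k} : Finset ℕ) → OrthoGroup d =>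
      x ⟨k, Finset.mem_singleton_self k⟩) measurable_id (measurable_pi_apply _)
  have hm : Measurable fun ω (j : Finset.range k) => P j ω :=
    measurable_pi_lambda _ fun j => h.measurable j
  rw [(ProbabilityTheory.indepFun_iff_map_prod_eq_prod_map_map hm.aemeasurable
    (h.measurable k).aemeasurable).1 h2, h.law k]

theorem schemeRandom_extendBases (P : ℕ → Ω → OrthoGroup d) (k : ℕ) (ω : Ω) :
    schemeRandom μ σ₀ γ (extendBases k) k (fun j : Finset.range k => P j ω) =
      schemeRandom μ σ₀ γ P k ω := by
  refine schemeIterate_congr fun j hj => ?_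
  rw [extendBases, dif_pos (Finset.mem_range.2 hj)]

/-- Expected descent along the scheme. -/
theorem integral_swLoss_schemeRandom_succ_le {ℙ : Measure Ω} [IsProbabilityMeasure ℙ]
    (hd : 1 ≤ d) (hμ : IsP2ac μ) (hσ₀ : IsP2ac σ₀) (hγ : ∀ k, 0 < γ k ∧ γ k ≤ 1)
    {P : ℕ → Ω → OrthoGroup d} (hP : IsIIDHaar ℙ P) (k : ℕ) :
    ∫ ω, swLoss μ (schemeRandom μ σ₀ γ P (k + 1) ω) ∂ℙ ≤
      ∫ ω, swLoss μ (schemeRandom μ σ₀ γ P k ω) ∂ℙ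
        - γ k * ∫ ω, gradSq μ (schemeRandom μ σ₀ γ P k ω) ∂ℙ
        + γ k ^ 2 * ∫ ω, swLoss μ (schemeRandom μ σ₀ γ P k ω) ∂ℙ := by
  have := hμ.isProbabilityMeasure
  set X : Ω → (Finset.range k → OrthoGroup d) := fun ω j => P j ω with hX
  have hXm : Measurable X := measurable_pi_lambda _ fun j => hP.measurable j
  have : IsProbabilityMeasure (ℙ.map X) := Measure.isProbabilityMeasure_map hXm.aemeasurable
  -- `κ` is the k-th iterate as a measurable function of the past bases alone; the identity filling
  -- later indices is never read.
  set κ : (Finset.range k → OrthoGroup d) → Measure (Euc d) :=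
    schemeRandom μ σ₀ γ (extendBases k) k with hκ
  have hκac : ∀ x, IsP2ac (κ x) := fun x => isP2ac_schemeIterate hμ hσ₀ hγ _ k
  have hκm : Measurable κ := measurable_schemeRandom hμ hσ₀ hγ (measurable_extendBases k) k
  have hκX : ∀ ω, κ (X ω) = schemeRandom μ σ₀ γ P k ω := schemeRandom_extendBases P k
  set f : (Finset.range k → OrthoGroup d) × OrthoGroup d → ℝ :=
    fun z => swLoss μ (sliceStep μ (γ k) (κ z.1) z.2) with hf
  have hfac : ∀ z : (Finset.range k → OrthoGroup d) × OrthoGroup d,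
      IsP2ac (sliceStep μ (γ k) (κ z.1) z.2) :=
    fun z => isP2ac_step hμ (hκac z.1) z.2 (hγ k).1.le (hγ k).2
  have hfm : Measurable f := measurable_swLoss_param hd
    (measurable_sliceStep (κ := fun z : (Finset.range k → OrthoGroup d) × OrthoGroup d => κ z.1)
      (hκm.comp measurable_fst) (fun z => (hκac z.1).isProbabilityMeasure) μ (γ k)
      (P := fun z => z.2) measurable_snd)
    (fun z => (hfac z).isProbabilityMeasure) μ
  have hfi : Integrable f ((ℙ.map X).prod (haarOrtho d)) := by
    refine Integrable.of_bound hfm.aestronglyMeasurable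
      (max (secondMoment σ₀) (secondMoment μ) + secondMoment μ + secondMoment μ)
      (Eventually.of_forall fun z => ?_)
    rw [Real.norm_of_nonneg (swLoss_nonneg _ _)]
    refine (swLoss_le_moments hd hμ.toIsP2 (hfac z).toIsP2).trans ?_
    have h1 := secondMoment_sliceStep_le hμ (hκac z.1) (hγ k).1.le (hγ k).2 z.2
    have h2 : secondMoment (κ z.1) ≤ _ := secondMoment_schemeIterate_le hμ hσ₀ hγ _ k
    have h3 : 0 ≤ secondMoment (κ z.1) := integral_nonneg fun _ => by positivity
    have h4 : 0 ≤ secondMoment μ := integral_nonneg fun _ => by positivity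
    nlinarith [hγ k]
  -- Independence turns the expectation into an iterated integral, so the one-step inequality can be
  -- applied with the past frozen; no conditional expectations are needed.
  have hL : ∫ ω, swLoss μ (schemeRandom μ σ₀ γ P (k + 1) ω) ∂ℙ =
      ∫ x, ∫ Q, f (x, Q) ∂(haarOrtho d) ∂(ℙ.map X) := by
    rw [← integral_prod _ hfi, ← hP.map_past_prod k, integral_map
      (hXm.prodMk (hP.measurable k)).aemeasurable hfm.aestronglyMeasurable]
    refine integral_congr_ae (Eventually.of_forall fun ω => ?_)
    simp only [hf]
    rw [hκX]
    rfl
  have iF : Integrable (fun x => swLoss μ (κ x)) (ℙ.map X) :=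
    integrable_swLoss_schemeRandom hd hμ hσ₀ hγ (measurable_extendBases k) k
  have iG : Integrable (fun x => gradSq μ (κ x)) (ℙ.map X) :=
    integrable_gradSq_schemeRandom hd hμ hσ₀ hγ (measurable_extendBases k) k
  have eF : ∫ x, swLoss μ (κ x) ∂(ℙ.map X) = ∫ ω, swLoss μ (schemeRandom μ σ₀ γ P k ω) ∂ℙ := by
    rw [integral_map hXm.aemeasurable iF.aestronglyMeasurable]
    simp only [hκX]
  have eG : ∫ x, gradSq μ (κ x) ∂(ℙ.map X) = ∫ ω, gradSq μ (schemeRandom μ σ₀ γ P k ω) ∂ℙ := by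
    rw [integral_map hXm.aemeasurable iG.aestronglyMeasurable]
    simp only [hκX]
  have i1 : Integrable (fun x => swLoss μ (κ x) - γ k * gradSq μ (κ x)) (ℙ.map X) :=
    iF.sub (iG.const_mul _)
  have i2 : Integrable (fun x => γ k ^ 2 * swLoss μ (κ x)) (ℙ.map X) := iF.const_mul _
  rw [hL, ← eF, ← eG, ← integral_const_mul, ← integral_const_mul,
    ← integral_sub iF (iG.const_mul _), ← integral_add i1 i2]
  exact integral_mono hfi.integral_prod_left (i1.add i2)
    fun x => integral_swLoss_sliceStep_le hd hμ (hκac x) (hγ k).1.le (hγ k).2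

/-- Telescope the expected descent, bound each quadratic term by B, and discard the nonnegative
final loss. -/
theorem sum_integral_gradSq_le {ℙ : Measure Ω} [IsProbabilityMeasure ℙ]
    (hd : 1 ≤ d) (hμ : IsP2ac μ) (hσ₀ : IsP2ac σ₀) (hγ : ∀ k, 0 < γ k ∧ γ k ≤ 1)
    {P : ℕ → Ω → OrthoGroup d} (hP : IsIIDHaar ℙ P) {B : ℝ}
    (hB : ∀ k ω, swLoss μ (schemeRandom μ σ₀ γ P k ω) ≤ B) (n : ℕ) :
    ∑ k ∈ Finset.range n, γ k * ∫ ω, gradSq μ (schemeRandom μ σ₀ γ P k ω) ∂ℙ ≤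
      swLoss μ σ₀ + B * ∑ k ∈ Finset.range n, γ k ^ 2 := by
  have hEB : ∀ k, ∫ ω, swLoss μ (schemeRandom μ σ₀ γ P k ω) ∂ℙ ≤ B := by
    intro k
    refine (integral_mono (integrable_swLoss_schemeRandom hd hμ hσ₀ hγ hP.measurable k)
      (integrable_const B) (hB k)).trans_eq ?_
    rw [integral_const, probReal_univ, one_smul]
  have key : ∀ n, ∑ k ∈ Finset.range n, γ k * ∫ ω, gradSq μ (schemeRandom μ σ₀ γ P k ω) ∂ℙ
      + ∫ ω, swLoss μ (schemeRandom μ σ₀ γ P n ω) ∂ℙ ≤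
      swLoss μ σ₀ + B * ∑ k ∈ Finset.range n, γ k ^ 2 := by
    intro n
    induction n with
    | zero => simp [schemeRandom, schemeIterate]
    | succ n ih =>
      rw [Finset.sum_range_succ, Finset.sum_range_succ, mul_add]
      have h1 := integral_swLoss_schemeRandom_succ_le (ℙ := ℙ) hd hμ hσ₀ hγ hP n
      have h2 := mul_le_mul_of_nonneg_left (hEB n) (sq_nonneg (γ n))
      linarith
  exact (le_add_of_nonneg_right (integral_nonneg fun ω => swLoss_nonneg _ _)).trans (key n)

theorem avgGradNormSq_le {ℙ : Measure Ω} [IsProbabilityMeasure ℙ]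
    (hd : 1 ≤ d) (hμ : IsP2ac μ) (hσ₀ : IsP2ac σ₀) (hγ : ∀ k, 0 < γ k ∧ γ k ≤ 1)
    {P : ℕ → Ω → OrthoGroup d} (hP : IsIIDHaar ℙ P) {B : ℝ}
    (hB : ∀ k ω, swLoss μ (schemeRandom μ σ₀ γ P k ω) ≤ B) (K : ℕ) :
    avgGradNormSq ℙ μ σ₀ γ P K ≤ (swLoss μ σ₀ + B * ∑ k ∈ Finset.range (K + 1), γ k ^ 2) /
      ∑ k ∈ Finset.range (K + 1), γ k := by
  have h := sum_integral_gradSq_le hd hμ hσ₀ hγ hP hB (K + 1)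
  have h0 : 0 ≤ ∑ k ∈ Finset.range (K + 1), γ k := Finset.sum_nonneg fun k _ => (hγ k).1.le
  refine le_trans (le_of_eq ?_) (div_le_div_of_nonneg_right h h0)
  rw [avgGradNormSq, Finset.sum_div]
  refine Finset.sum_congr rfl fun k _ => ?_
  have e : ∀ ω, gradNormSq (swLoss μ) (schemeRandom μ σ₀ γ P k ω) =
      gradSq μ (schemeRandom μ σ₀ γ P k ω) := fun ω =>
    gradNormSq_swLoss hd hμ.toIsP2 (isP2ac_schemeIterate hμ hσ₀ hγ _ k)
  simp only [e]
  rw [stepWeight, div_mul_eq_mul_div]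

end RandomScheme

/-! ### The main theorem -/

/-- Each of the K + 1 terms is at least the last one, so the sum is at least (K+1)^{1-α}. -/
theorem rpow_le_sum_one_div_rpow {α : ℝ} (h0 : 0 ≤ α) (h1 : α ≤ 1) (K : ℕ) :
    (K : ℝ) ^ (1 - α) ≤ ∑ k ∈ Finset.range (K + 1), 1 / ((k : ℝ) + 1) ^ α := by
  have hK : (0 : ℝ) < (K : ℝ) + 1 := by positivity
  have h : ∀ k ∈ Finset.range (K + 1), 1 / ((K : ℝ) + 1) ^ α ≤ 1 / ((k : ℝ) + 1) ^ α := by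
    intro k hk
    have : (k : ℝ) ≤ K := by exact_mod_cast Nat.lt_succ_iff.1 (Finset.mem_range.1 hk)
    gcongr
  have hs := Finset.card_nsmul_le_sum _ _ _ h
  rw [Finset.card_range, nsmul_eq_mul] at hs
  refine le_trans ?_ hs
  push_cast
  rw [mul_one_div]
  calc (K : ℝ) ^ (1 - α) ≤ ((K : ℝ) + 1) ^ (1 - α) :=
        Real.rpow_le_rpow (Nat.cast_nonneg K) (by linarith) (by linarith)
    _ = ((K : ℝ) + 1) / ((K : ℝ) + 1) ^ α := by rw [Real.rpow_sub hK, Real.rpow_one]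

theorem summable_one_div_rpow_sq {α : ℝ} (h : 1 / 2 < α) :
    Summable fun k : ℕ => (1 / ((k : ℝ) + 1) ^ α) ^ 2 := by
  have h1 : Summable fun k : ℕ => 1 / (k : ℝ) ^ (α * 2) :=
    Real.summable_one_div_nat_rpow.2 (by linarith)
  refine ((summable_nat_add_iff 1).2 h1).congr fun k => ?_
  have hk : (0 : ℝ) ≤ (k : ℝ) + 1 := by positivity
  rw [div_pow, one_pow, Nat.cast_add, Nat.cast_one, Real.rpow_mul hk, Real.rpow_two]

theorem mainTheorem10 {d : ℕ} (hd : 1 ≤ d) (μ σ₀ : Measure (Euc d))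
    (hμ : IsP2ac μ) (hσ₀ : IsP2ac σ₀) :
    -- the bound, for step sizes in `(0, 1]`
    (∀ γ : ℕ → ℝ, (∀ k, 0 < γ k ∧ γ k ≤ 1) →
      ∀ (Ω : Type*) [MeasurableSpace Ω] (ℙ : Measure Ω) [IsProbabilityMeasure ℙ]
        (P : ℕ → Ω → OrthoGroup d), IsIIDHaar ℙ P →
        -- the gradients exist along the scheme and their squared norms have an expectation
        (∀ k ω, WassersteinDifferentiableAt (swLoss μ) (schemeRandom μ σ₀ γ P k ω)) ∧
        (∀ k, Integrable (fun ω => gradNormSq (swLoss μ) (schemeRandom μ σ₀ γ P k ω)) ℙ) ∧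
        ((secondMoment σ₀ ≤ secondMoment μ ∨ (γ 0 = 1 ∧ swLoss μ σ₀ ≤ 2 * secondMoment μ)) →
          ∀ K : ℕ, avgGradNormSq ℙ μ σ₀ γ P K ≤
            (swLoss μ σ₀ + 4 * secondMoment μ * ∑ k ∈ Finset.range (K + 1), γ k ^ 2) /
              ∑ k ∈ Finset.range (K + 1), γ k) ∧
        (∀ K : ℕ, avgGradNormSq ℙ μ σ₀ γ P K ≤
            (swLoss μ σ₀ + 4 * max (secondMoment σ₀) (secondMoment μ) *
                ∑ k ∈ Finset.range (K + 1), γ k ^ 2) /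
              ∑ k ∈ Finset.range (K + 1), γ k)) ∧
    -- the rate for polynomially decaying step sizes
    (∀ α : ℝ, 1 / 2 < α → α < 1 → ∃ C : ℝ,
      ∀ (Ω : Type*) [MeasurableSpace Ω] (ℙ : Measure Ω) [IsProbabilityMeasure ℙ]
        (P : ℕ → Ω → OrthoGroup d), IsIIDHaar ℙ P →
        ∀ K : ℕ, 1 ≤ K →
          avgGradNormSq ℙ μ σ₀ (fun k => 1 / ((k : ℝ) + 1) ^ α) P K ≤ C * (K : ℝ) ^ (α - 1)) := by
  refine ⟨fun γ hγ Ω _ ℙ _ P hP => ⟨fun k ω => ?_, fun k => ?_, fun h K => ?_, fun K => ?_⟩,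
    fun α hα hα1 => ?_⟩
  · exact ⟨_, isWassersteinGradient_swGrad hd hμ.toIsP2 (isP2ac_schemeIterate hμ hσ₀ hγ _ k)⟩
  · refine (integrable_gradSq_schemeRandom (ℙ := ℙ) hd hμ hσ₀ hγ hP.measurable k).congr
      (Eventually.of_forall fun ω => ?_)
    exact (gradNormSq_swLoss hd hμ.toIsP2 (isP2ac_schemeIterate hμ hσ₀ hγ _ k)).symm
  · have hM : 0 ≤ secondMoment μ := integral_nonneg fun _ => by positivity
    -- In both cases the loss stays below 2M₂(μ), so the constant 4 leaves a factor of two to spare.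
    refine avgGradNormSq_le hd hμ hσ₀ hγ hP (fun k ω => ?_) K
    rcases h with h | ⟨h0, hF⟩
    · have := swLoss_schemeIterate_le hd hμ hσ₀ hγ (fun j => P j ω) k
      rw [max_eq_right h] at this
      exact this.trans (by linarith)
    · exact (swLoss_schemeIterate_le_of_full_step hd hμ hσ₀ hγ h0 hF _ k).trans (by linarith)
  · have hM : 0 ≤ secondMoment μ := integral_nonneg fun _ => by positivity
    refine avgGradNormSq_le hd hμ hσ₀ hγ hP (fun k ω => ?_) K
    exact (swLoss_schemeIterate_le hd hμ hσ₀ hγ _ k).trans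
      (by linarith [le_max_right (secondMoment σ₀) (secondMoment μ)])
  · set γ : ℕ → ℝ := fun k => 1 / ((k : ℝ) + 1) ^ α with hγdef
    have hα0 : 0 ≤ α := by linarith
    have hγ : ∀ k, 0 < γ k ∧ γ k ≤ 1 := by
      intro k
      have h1 : (1 : ℝ) ≤ ((k : ℝ) + 1) ^ α :=
        Real.one_le_rpow (by linarith [k.cast_nonneg (α := ℝ)]) hα0
      exact ⟨by positivity, (div_le_one (by positivity)).2 h1⟩
    set M := max (secondMoment σ₀) (secondMoment μ) with hM
    have hM0 : 0 ≤ M := (integral_nonneg fun _ => by positivity).trans (le_max_right _ _)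
    -- The numerator uses the sharper bound 2M on the loss and the full series of squared steps,
    -- which converges because 2α > 1; this makes the constant independent of K.
    refine ⟨swLoss μ σ₀ + 2 * M * ∑' k, γ k ^ 2, fun Ω _ ℙ _ P hP K hK => ?_⟩
    have hK0 : (0 : ℝ) < K := by exact_mod_cast hK
    refine (avgGradNormSq_le hd hμ hσ₀ hγ hP
      (fun k ω => swLoss_schemeIterate_le hd hμ hσ₀ hγ _ k) K).trans ?_
    have hS : ∑ k ∈ Finset.range (K + 1), γ k ^ 2 ≤ ∑' k, γ k ^ 2 :=
      (summable_one_div_rpow_sq hα).sum_le_tsum _ fun k _ => sq_nonneg _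
    have hS0 : 0 ≤ ∑' k, γ k ^ 2 := tsum_nonneg fun k => sq_nonneg _
    have hF := swLoss_nonneg μ σ₀
    rw [show α - 1 = -(1 - α) by ring, Real.rpow_neg hK0.le, ← div_eq_mul_inv]
    exact div_le_div₀ (by positivity) (by gcongr) (Real.rpow_pos_of_pos hK0 _)
      (rpow_le_sum_one_div_rpow hα0 hα1.le K)
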